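/- **Setting.** Let $G(x)=\tfrac12 e^{-|x|}$ and $G'(x)=-\operatorname{sgn}(x)G(x)$. Let $L>0$, $k\ge 1$ an integer, and let $m_0\in C^k(\mathbb R)$ have support contained in $(-L,L)$; put $M_1=\|m_0\|_{L^1}$. For $D\subset\mathbb R$ and a time interval $I$, $C^k_n(D\times I)$ is the set of functions $f(x,t)$ whose pure derivatives $\partial_x^j f$ ($j\le k$) and $\partial_t^i f$ ($i\le n$) exist and are continuous on $D\times I$. The Lagrange dynamics is $$\dot X(\xi,t)=U(X(\xi,t),t),\quad X(\xi,0)=\xi,\qquad U(x,t)=\Big(\int_{-L}^{L}G(x-X(\theta,t))m_0(\theta)\,d\theta\Big)^2-\Big(\int_{-L}^{L}G'(x-X(\theta,t))m_0(\theta)\,d\theta\Big)^2$$ for $\xi\in[-L,L]$. The mCH equation is $$m_t+[(u^2-u_x^2)m]_x=0,\qquad m=u-u_{xx},\qquad m(x,0)=m_0(x).$$ A classical solution on $[0,T)$ is a pair $u\in C^{k+2}_1(\mathbb R\times[0,T))$, $m\in C^k_1(\mathbb R\times[0,T))$ satisfying these equations pointwise and such that $u,u_x$ are bounded on $\mathbb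 R\times[0,T']$ for every $T'<T$ (so that $u=G*m$). **Theorem.** There is a unique $T_{\max}\in(0,+\infty]$ which is the largest $T$ such that a classical solution exists on $[0,T)$, and also the largest $T$ such that the Lagrange dynamics has a solution $X\in C^{k+1}_1([-L,L]\times[0,T))$ with $X_\xi>0$. On $[0,T_{\max})$ the Lagrange dynamics has a unique solution $X\in C^{k+1}_1([-L,L]\times[0,T_{\max}))$, and $X_\xi(\xi,t)>0$ for $(\xi,t)\in[-L,L]\times[0,T_{\max})$. There is a unique classical solution $(u,m)$ on $[0,T_{\max})$. (In both cases any solution on a shorter interval $[0,T)$ is the restriction of this one.) It is represented as $$u(x,t)=\int_{-L}^{L}G(x-X(\theta,t))m_0(\theta)\,d\theta,\qquad m(x,t)=\int_{-L}^{L}\delta(x-X(\theta,t))m_0(\theta)\,d\theta,$$ the latter meaning $\int_{\mathbb R}\varphi(x)m(x,t)\,dx=\int_{-L}^L\varphi(X(\theta,t))m_0(\theta)\,d\theta$ for all $\varphi\in C_c(\mathbb R)$. Moreover $\operatorname{supp}m(\cdot,t)\subset(-L,L)$ for $t\in[0,T_{\max})$. If $T_{\max}<+\infty$, then: (i) $X$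 extends to a function in $C^{k+1}_1([-L,L]\times[0,T_{\max}])$. (ii) For every $p\in[1,\infty]$ the following statements hold with $T=T_{\max}$; moreover, for each $T\in(0,T_{\max}]$ they are equivalent to each other: (a) $\limsup_{t\to T^-}\|m(\cdot,t)\|_{L^\infty}=+\infty$; (b) $X_\xi>0$ on $[-L,L]\times[0,T)$ and $\min_{\xi\in[-L,L]}X_\xi(\xi,T)=0$; (c) $\liminf_{t\to T^-}\inf_{\xi\in[-L,L]}\int_0^t(mu_x)(X(\xi,s),s)\,ds=-\infty$; (d) $\liminf_{t\to T^-}\inf_{x\in\mathbb R}(mu_x)(x,t)=-\infty$; (e) $\limsup_{t\to T^-}\|m(\cdot,t)\|_{W^{1,p}}=+\infty$; (f) $\int_0^{T}\|m(\cdot,t)\|_{L^\infty}\,dt=+\infty$. (iii) There are unique functions $u(\cdot,T_{\max})$ and $u_x(\cdot,T_{\max})$, the second being the distributional derivative of the first, such that $\lim_{t\to T_{\max}^-}u(x,t)=u(x,T_{\max})$ and $\lim_{t\to T_{\max}^-}u_x(x,t)=u_x(x,T_{\max})$ for every $x\in\mathbb R$. For every $t\in[0,T_{\max}]$, $u(\cdot,t)$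 and $u_x(\cdot,t)$ belong to $BV(\mathbb R)$ (integrable with finite pointwise total variation), with $\mathrm{Tot.Var.}\{u(\cdot,t)\}\le M_1$ and $\mathrm{Tot.Var.}\{u_x(\cdot,t)\}\le 2M_1$. (iv) There is a unique finite signed Radon measure $m(\cdot,T_{\max})$ on $\mathbb R$ such that $m(\cdot,t)\,dx\stackrel{*}{\rightharpoonup}m(\cdot,T_{\max})$ as $t\to T_{\max}^-$, i.e. tested against all $\varphi\in C_0(\mathbb R)$. -/

import Mathlib

open Set Filter Topology MeasureTheory
open scoped ENNReal ContDiff ZeroAtInfty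

noncomputable section

namespace MCH

/-- The time interval `[0, T)`, where `T` may be `+∞`. -/
def timeIco (T : EReal) : Set ℝ := {t : ℝ | 0 ≤ t ∧ (t : EReal) < T}

/-- The space `C^k_n(D × I)`: the pure space derivatives up to order `k` and the pure time
derivatives up to order `n` of `f` exist and are jointly continuous on `D × I`
(one-sided derivatives at the end points of `D` and `I`). -/
structure MemC (k n : ℕ) (D I : Set ℝ) (f : ℝ → ℝ → ℝ) : Prop where
  space : ∀ t ∈ I, ContDiffOn ℝ k (fun x => f x t) D
  time : ∀ x ∈ D, ContDiffOn ℝ n (fun t => f x t) I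
  space_cont : ∀ j ≤ k, ContinuousOn
    (fun q : ℝ × ℝ => iteratedDerivWithin j (fun x => f x q.2) D q.1) (D ×ˢ I)
  time_cont : ∀ j ≤ n, ContinuousOn
    (fun q : ℝ × ℝ => iteratedDerivWithin j (fun t => f q.1 t) I q.2) (D ×ˢ I)

/-- The fundamental solution `G(x) = e^{-|x|}/2` of `1 - ∂ₓₓ`. -/
def G (x : ℝ) : ℝ := Real.exp (-|x|) / 2

/-- Its derivative `G'(x) = -sgn(x) G(x)`. -/
def G' (x : ℝ) : ℝ := -(SignType.sign x : ℝ) * G x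

/-- The velocity `U(x,t) = (∫ G(x - X(θ,t)) m₀(θ) dθ)² - (∫ G'(x - X(θ,t)) m₀(θ) dθ)²`
(the initial datum `m₀` is supported in `(-L, L)`). -/
def velocity (L : ℝ) (m₀ : ℝ → ℝ) (X : ℝ → ℝ → ℝ) (x t : ℝ) : ℝ :=
  (∫ θ in (-L)..L, G (x - X θ t) * m₀ θ) ^ 2 - (∫ θ in (-L)..L, G' (x - X θ t) * m₀ θ) ^ 2

/-- `X` is a solution of class `C^{k+1}_1([-L,L] × [0,T))` of the Lagrange dynamics
`∂ₜX(ξ,t) = U(X(ξ,t),t)`, `X(ξ,0) = ξ`. -/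
structure IsLagrangeSolution (k : ℕ) (L : ℝ) (m₀ : ℝ → ℝ) (T : EReal) (X : ℝ → ℝ → ℝ) :
    Prop where
  regular : MemC (k + 1) 1 (Icc (-L) L) (timeIco T) X
  initial : ∀ ξ ∈ Icc (-L) L, X ξ 0 = ξ
  ode : ∀ ξ ∈ Icc (-L) L, ∀ t ∈ timeIco T,
    HasDerivWithinAt (fun s => X ξ s) (velocity L m₀ X (X ξ t) t) (timeIco T) t

/-- The spatial derivative `X_ξ(ξ,t)` on `[-L,L]` (one-sided at the end points). -/
def Xξ (L : ℝ) (X : ℝ → ℝ → ℝ) (ξ t : ℝ) : ℝ :=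
  derivWithin (fun η => X η t) (Icc (-L) L) ξ

/-- The spatial derivative `f_x(x,t)`. -/
def dx (f : ℝ → ℝ → ℝ) (x t : ℝ) : ℝ := deriv (fun y => f y t) x

/-- `(u, m)` is a classical solution on `ℝ × [0,T)` of
`m_t + [(u² - u_x²) m]_x = 0`, `m = u - u_xx`, `m(·,0) = m₀`.
The boundedness of `u, u_x` on `ℝ × [0,T']`, `T' < T`, selects the bounded solution `u = G * m`
of `u - u_xx = m`; without a condition at infinity the kernel `a(t) eˣ + b(t) e⁻ˣ` of `1 - ∂ₓₓ`
is not excluded, and `u` is not determined by `m`. -/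
structure IsClassicalSolution (k : ℕ) (m₀ : ℝ → ℝ) (T : EReal) (u m : ℝ → ℝ → ℝ) :
    Prop where
  regular_u : MemC (k + 2) 1 univ (timeIco T) u
  regular_m : MemC k 1 univ (timeIco T) m
  helmholtz : ∀ x, ∀ t ∈ timeIco T, m x t = u x t - dx (dx u) x t
  bounded : ∀ T' ∈ timeIco T, ∃ C : ℝ, ∀ x, ∀ t ∈ Icc 0 T', |u x t| ≤ C ∧ |dx u x t| ≤ C
  pde : ∀ x, ∀ t ∈ timeIco T, 0 < t →
    deriv (fun s => m x s) t + dx (fun y s => (u y s ^ 2 - dx u y s ^ 2) * m y s) x t = 0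
  initial : ∀ x, m x 0 = m₀ x

/-! The six blow-up criteria at a time `T`. -/

/-- `limsup_{t → T} ‖m(·,t)‖_{L^∞} = +∞`. -/
def BlowUpSup (m : ℝ → ℝ → ℝ) (T : ℝ) : Prop :=
  limsup (fun t => eLpNorm (fun x => m x t) ⊤ volume) (𝓝[<] T) = ⊤

/-- `X_ξ > 0` on `[-L,L] × [0,T)` and `min_ξ X_ξ(ξ,T) = 0`. -/
def CharacteristicsCollide (L : ℝ) (X : ℝ → ℝ → ℝ) (T : ℝ) : Prop :=
  (∀ ξ ∈ Icc (-L) L, ∀ t ∈ Ico 0 T, 0 < Xξ L X ξ t) ∧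
    IsLeast ((fun ξ => Xξ L X ξ T) '' Icc (-L) L) 0

/-- `liminf_{t → T} inf_{ξ ∈ [-L,L]} ∫_0^t (m u_x)(X(ξ,s),s) ds = -∞`. -/
def BlowUpCharIntegral (L : ℝ) (X u m : ℝ → ℝ → ℝ) (T : ℝ) : Prop :=
  liminf (fun t => ⨅ ξ ∈ Icc (-L) L,
    ((∫ s in (0 : ℝ)..t, m (X ξ s) s * dx u (X ξ s) s : ℝ) : EReal)) (𝓝[<] T) = ⊥

/-- `liminf_{t → T} inf_{x ∈ ℝ} (m u_x)(x,t) = -∞`. -/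
def BlowUpInf (u m : ℝ → ℝ → ℝ) (T : ℝ) : Prop :=
  liminf (fun t => ⨅ x : ℝ, ((m x t * dx u x t : ℝ) : EReal)) (𝓝[<] T) = ⊥

/-- `limsup_{t → T} ‖m(·,t)‖_{W^{1,p}} = +∞`. -/
def BlowUpSobolev (p : ℝ≥0∞) (m : ℝ → ℝ → ℝ) (T : ℝ) : Prop :=
  limsup (fun t => eLpNorm (fun x => m x t) p volume + eLpNorm (fun x => dx m x t) p volume)
    (𝓝[<] T) = ⊤

/-- `∫_0^T ‖m(·,t)‖_{L^∞} dt = +∞`. -/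
def BlowUpTimeIntegral (m : ℝ → ℝ → ℝ) (T : ℝ) : Prop :=
  ∫⁻ t in Ioo 0 T, eLpNorm (fun x => m x t) ⊤ volume = ⊤

/-- The list (a), ..., (f) of the criteria, for a given exponent `p` in (e). -/
def blowUpCriteria (L : ℝ) (X u m : ℝ → ℝ → ℝ) (p : ℝ≥0∞) (T : ℝ) : List Prop :=
  [BlowUpSup m T, CharacteristicsCollide L X T, BlowUpCharIntegral L X u m T,
    BlowUpInf u m T, BlowUpSobolev p m T, BlowUpTimeIntegral m T]

/-- `f ∈ BV(ℝ)`: integrable, with finite pointwise total variation. -/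
def MemBV (f : ℝ → ℝ) : Prop := Integrable f ∧ BoundedVariationOn f univ

/-- `f ∈ BV(ℝ)` and `Tot.Var.{f} ≤ M`. -/
def BVBound (f : ℝ → ℝ) (M : ℝ) : Prop := MemBV f ∧ eVariationOn f univ ≤ ENNReal.ofReal M

/-- `v` is the derivative of `u` in the sense of distributions. -/
def IsWeakDeriv (u v : ℝ → ℝ) : Prop :=
  ∀ φ : ℝ → ℝ, ContDiff ℝ ∞ φ → HasCompactSupport φ →
    ∫ x, u x * deriv φ x = -∫ x, v x * φ x

/-- Weak-* convergence in `𝓜(ℝ) = C₀(ℝ)*` of the densities `m(·,t)` to the finite signed Radon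
measure `μ`, as `t → T` from below. -/
def WeakStarTendsto (m : ℝ → ℝ → ℝ) (T : ℝ) (μ : SignedMeasure ℝ) : Prop :=
  ∀ φ : C₀(ℝ, ℝ), Tendsto (fun t => ∫ x, φ x * m x t) (𝓝[<] T) (𝓝 (∫ᵛ x, φ x ∂<•μ))

end MCH

end

/-!
The proof works in the label coordinate `ξ`. For an increasing configuration `X(·,t)` the kernels
`G`, `G'` split at `X(ξ,t)` into exponentials, and the velocity becomes a product
`u² - u_x² = (u - u_x)(u + u_x) = (∫_{-L}^ξ e^{X(θ,t)} m₀ dθ) (∫_ξ^L e^{-X(θ,t)} m₀ dθ)`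
(`integral_kernel_split`), in which the singularity of `G'` has disappeared. With `e^{±x}` cut off
outside `[-L, L]`, the right-hand side is a bounded Lipschitz vector field on `C_b(ℝ)`, so that the
cut-off dynamics has a global solution `X`, defined for all labels and times (`CutoffFlow`,
`exists_cutoffFlow`). The product form also gains one derivative in `ξ`, whence
`X ∈ C^{k+1}_1` (`spaceC_X`), and `(X_ξ)_t = m₀ · 2 u_x(X)`. In particular `X_ξ = 1` where
`m₀ = 0`, and the end points `±L` do not move.

`T_max` is the first time at which `X_ξ` vanishes somewhere. Before that, `X(·,t)` is a
diffeomorphism of `ℝ` with inverse `Ξ(·,t)`, the cut-off plays no role, and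
`m(X, t) = m₀ / X_ξ`, `u = ∫ G(x - X) m₀` define a classical solution (`isClassicalSolution`,
`isLagrangeSolution`). Since `X` is defined beyond `T_max`, its extension to the closed time
interval is automatic, and so are the limits at `T_max`.

Uniqueness for the Lagrange dynamics: as long as a solution is increasing in `ξ` it solves the
cut-off dynamics, and it cannot lose monotonicity before `X` does (`lagrange_unique`). Uniqueness of
classical solutions: finite speed of propagation along the characteristics makes `m` compactly
supported; the potential `q = ∫_{-∞}^x (m - n)` of the difference of two solutions is then bounded,
it controls `u - v` and `u_x - v_x` because both are bounded solutions of the Helmholtz equation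
(`abs_le_of_helmholtz`), and its derivative along `X` is controlled by `q` itself
(`classical_unique`). At `T_max` the relation `m(X, t) X_ξ = m₀` with `X_ξ = 0`, `m₀ ≠ 0`
prevents a continuation (`classical_maximal`).

The blow-up criteria all follow from `m(X, t) = m₀ / X_ξ` and `∫₀ᵗ (m u_x)(X, s) ds = ½ log X_ξ`:
each fails where `X_ξ > 0` on the closed interval `[0, T]` (`not_blowUpCriteria`), and each holds
when `X_ξ` vanishes at time `T` for the first time (`blowUpCriteria_of_degenerate`).

At `T_max` the limit of `u_x` is the delicate one, because `G'` is discontinuous and a whole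
interval of labels may reach the same point `x`. Each such label with nonzero speed stays on one side of
`x` shortly before `T_max`, and at most two of them have speed zero (`ae_velocity_ne_zero`), so that
dominated convergence applies.
-/


noncomputable section

namespace MCH

open Function (uncurry)

/-! ### Differentiation of parametric integrals and of functions of two variables -/

lemma hasDerivAt_intervalIntegral_param {f f' : ℝ → ℝ → ℝ} {a b x₀ : ℝ} {U : Set ℝ}
    (hU : U ∈ 𝓝 x₀) (hf : ∀ x ∈ U, ContinuousOn (f x) (uIcc a b))
    (hd : ∀ x ∈ U, ∀ s ∈ uIcc a b, HasDerivAt (fun x => f x s) (f' x s) x)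
    (hc : ContinuousOn (uncurry f') (U ×ˢ uIcc a b)) :
    HasDerivAt (fun x => ∫ s in a..b, f x s) (∫ s in a..b, f' x₀ s) x₀ := by
  obtain ⟨ε, hε, hball⟩ := Metric.nhds_basis_closedBall.mem_iff.1 hU
  have hK : IsCompact (Metric.closedBall x₀ ε ×ˢ uIcc a b) :=
    (isCompact_closedBall x₀ ε).prod isCompact_uIcc
  obtain ⟨C, hC⟩ := hK.exists_bound_of_continuousOn (hc.mono (prod_mono_left hball))
  have hx₀ : x₀ ∈ Metric.closedBall x₀ ε := Metric.mem_closedBall_self hε.le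
  have hcx : ContinuousOn (f' x₀) (uIcc a b) :=
    hc.comp (f := fun s => (x₀, s)) (by fun_prop) (fun s hs => ⟨hball hx₀, hs⟩)
  refine (intervalIntegral.hasDerivAt_integral_of_dominated_loc_of_deriv_le (F := f) (F' := f')
    (s := Metric.closedBall x₀ ε) (bound := fun _ => C)
    (Metric.closedBall_mem_nhds x₀ hε) ?_ ?_ ?_ ?_ ?_ ?_).2
  · filter_upwards [hU] with x hx
    exact ((hf x hx).mono uIoc_subset_uIcc).aestronglyMeasurable measurableSet_uIoc
  · exact (hf x₀ (hball hx₀)).intervalIntegrable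
  · exact (hcx.mono uIoc_subset_uIcc).aestronglyMeasurable measurableSet_uIoc
  · exact Eventually.of_forall fun s hs x hx => hC (x, s) ⟨hx, uIoc_subset_uIcc hs⟩
  · exact intervalIntegrable_const
  · exact Eventually.of_forall fun s hs x hx => hd x (hball hx) s (uIoc_subset_uIcc hs)

lemma hasStrictFDerivAt_of_partials {f fx ft : ℝ → ℝ → ℝ} {p : ℝ × ℝ} {S : Set (ℝ × ℝ)}
    (hS : S ∈ 𝓝 p) (hx : ∀ q ∈ S, HasDerivAt (fun x => f x q.2) (fx q.1 q.2) q.1)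
    (ht : ∀ q ∈ S, HasDerivAt (fun t => f q.1 t) (ft q.1 q.2) q.2)
    (cx : ContinuousOn (uncurry fx) S) (ct : ContinuousOn (uncurry ft) S) :
    HasStrictFDerivAt (uncurry f) ((ContinuousLinearMap.toSpanSingleton ℝ (fx p.1 p.2)).coprod
      (ContinuousLinearMap.toSpanSingleton ℝ (ft p.1 p.2))) p := by
  refine hasStrictFDerivAt_uncurry_coprod (𝕜 := ℝ) (u := p) (f := f)
    (f₁ := fun x t => ContinuousLinearMap.toSpanSingleton ℝ (fx x t))
    (f₂ := fun x t => ContinuousLinearMap.toSpanSingleton ℝ (ft x t)) ?_ ?_ ?_ ?_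
  · filter_upwards [hS] with q hq
    exact (hx q hq).hasFDerivAt
  · filter_upwards [hS] with q hq
    exact (ht q hq).hasFDerivAt
  · exact (ContinuousLinearMap.toSpanSingletonCLE (𝕜 := ℝ) (E := ℝ)).continuous.continuousAt.comp
      (cx.continuousAt hS)
  · exact (ContinuousLinearMap.toSpanSingletonCLE (𝕜 := ℝ) (E := ℝ)).continuous.continuousAt.comp
      (ct.continuousAt hS)

/-- The chain rule along a curve `s ↦ (y s, s)`, for a function with continuous partial
derivatives. -/
lemma hasDerivAt_along {f fx ft : ℝ → ℝ → ℝ} {y : ℝ → ℝ} {y' t : ℝ} {S : Set (ℝ × ℝ)}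
    (hS : S ∈ 𝓝 (y t, t)) (hx : ∀ q ∈ S, HasDerivAt (fun x => f x q.2) (fx q.1 q.2) q.1)
    (ht : ∀ q ∈ S, HasDerivAt (fun t => f q.1 t) (ft q.1 q.2) q.2)
    (cx : ContinuousOn (uncurry fx) S) (ct : ContinuousOn (uncurry ft) S)
    (hy : HasDerivAt y y' t) :
    HasDerivAt (fun s => f (y s) s) (fx (y t) t * y' + ft (y t) t) t := by
  have h := (hasStrictFDerivAt_of_partials hS hx ht cx ct).hasFDerivAt
  have h2 := h.comp_hasDerivAt (f := fun s => (y s, s)) t (hy.prodMk (hasDerivAt_id t))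
  refine h2.congr_deriv ?_
  simp [mul_comm]

/-! ### Functions with jointly continuous space derivatives -/

/-- `f` has space derivatives up to order `j` on `ℝ × I`, and these are jointly continuous. The
recursion on `j` passes to the first derivative; closure under the usual operations
then follows by induction. -/
def SpaceC (I : Set ℝ) : ℕ → (ℝ → ℝ → ℝ) → Prop
  | 0, f => ContinuousOn (uncurry f) (univ ×ˢ I)
  | j + 1, f => ContinuousOn (uncurry f) (univ ×ˢ I) ∧
      ∃ g, SpaceC I j g ∧ ∀ t ∈ I, ∀ x, HasDerivAt (fun y => f y t) (g x t) x

namespace SpaceC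

variable {I : Set ℝ} {j k : ℕ} {f g : ℝ → ℝ → ℝ}

lemma continuousOn (hf : SpaceC I j f) : ContinuousOn (uncurry f) (univ ×ˢ I) := by
  cases j with
  | zero => exact hf
  | succ j => exact hf.1

lemma congr (hf : SpaceC I j f) (h : ∀ t ∈ I, ∀ x, g x t = f x t) : SpaceC I j g := by
  cases j with
  | zero => exact ContinuousOn.congr hf fun q hq => h q.2 hq.2 q.1
  | succ j =>
    obtain ⟨hc, f', hf', hd⟩ := hf
    refine ⟨hc.congr fun q hq => h q.2 hq.2 q.1, f', hf', fun t ht x => ?_⟩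
    rw [show (fun y => g y t) = fun y => f y t from funext fun y => h t ht y]
    exact hd t ht x

/-- Any derivative of `f` may be used. -/
lemma of_deriv (hf : SpaceC I (j + 1) f) (h : ∀ t ∈ I, ∀ x, HasDerivAt (fun y => f y t) (g x t) x) :
    SpaceC I j g := by
  obtain ⟨-, f', hf', hd⟩ := hf
  exact hf'.congr fun t ht x => (h t ht x).unique (hd t ht x)

lemma pred (hf : SpaceC I (j + 1) f) : SpaceC I j f := by
  induction j generalizing f with
  | zero => exact hf.1
  | succ j ih =>
    obtain ⟨hc, f', hf', hd⟩ := hf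
    exact ⟨hc, f', ih hf', hd⟩

lemma mono (hf : SpaceC I k f) (h : j ≤ k) : SpaceC I j f := by
  induction k, h using Nat.le_induction with
  | base => exact hf
  | succ k _ ih => exact ih hf.pred

lemma mono_set {J : Set ℝ} (hf : SpaceC I j f) (h : J ⊆ I) : SpaceC J j f := by
  induction j generalizing f with
  | zero => exact ContinuousOn.mono hf (prod_mono_right h)
  | succ j ih =>
    obtain ⟨hc, f', hf', hd⟩ := hf
    exact ⟨hc.mono (prod_mono_right h), f', ih hf', fun t ht => hd t (h ht)⟩

lemma const (c : ℝ) : SpaceC I j (fun _ _ => c) := by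
  induction j generalizing c with
  | zero => exact continuousOn_const
  | succ j ih => exact ⟨continuousOn_const, _, ih 0, fun t _ x => hasDerivAt_const x c⟩

lemma add (hf : SpaceC I j f) (hg : SpaceC I j g) : SpaceC I j (fun x t => f x t + g x t) := by
  induction j generalizing f g with
  | zero => exact ContinuousOn.add hf hg
  | succ j ih =>
    obtain ⟨hc, f', hf', hd⟩ := hf
    obtain ⟨hc2, g', hg', hd2⟩ := hg
    exact ⟨hc.add hc2, _, ih hf' hg', fun t ht x => (hd t ht x).add (hd2 t ht x)⟩

lemma mul (hf : SpaceC I j f) (hg : SpaceC I j g) : SpaceC I j (fun x t => f x t * g x t) := by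
  induction j generalizing f g with
  | zero => exact ContinuousOn.mul hf hg
  | succ j ih =>
    have hf0 := hf.pred
    have hg0 := hg.pred
    obtain ⟨hc, f', hf', hd⟩ := hf
    obtain ⟨hc2, g', hg', hd2⟩ := hg
    exact ⟨hc.mul hc2, _, (ih hf' hg0).add (ih hf0 hg'), fun t ht x => (hd t ht x).mul (hd2 t ht x)⟩

lemma neg (hf : SpaceC I j f) : SpaceC I j (fun x t => -f x t) :=
  ((const (-1)).mul hf).congr fun _ _ _ => by simp

lemma sub (hf : SpaceC I j f) (hg : SpaceC I j g) : SpaceC I j (fun x t => f x t - g x t) :=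
  (hf.add hg.neg).congr fun _ _ _ => sub_eq_add_neg _ _

lemma of_contDiff {φ : ℝ → ℝ} (hφ : ContDiff ℝ j φ) : SpaceC I j (fun x _ => φ x) := by
  induction j generalizing φ with
  | zero => exact (hφ.continuous.comp continuous_fst).continuousOn
  | succ j ih =>
    have hφ' : ContDiff ℝ j (deriv φ) := (contDiff_succ_iff_deriv.1 hφ).2.2
    exact ⟨(hφ.continuous.comp continuous_fst).continuousOn, _, ih hφ', fun t _ x =>
      ((hφ.differentiable (by simp)) x).hasDerivAt⟩

lemma comp_left {φ : ℝ → ℝ} (hφ : ContDiff ℝ j φ) (hf : SpaceC I j f) :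
    SpaceC I j (fun x t => φ (f x t)) := by
  induction j generalizing φ with
  | zero => exact hφ.continuous.comp_continuousOn hf
  | succ j ih =>
    have hf0 := hf.pred
    obtain ⟨hc, f', hf', hd⟩ := hf
    have hφ' : ContDiff ℝ j (deriv φ) := (contDiff_succ_iff_deriv.1 hφ).2.2
    exact ⟨hφ.continuous.comp_continuousOn hc, _, (ih hφ' hf0).mul hf', fun t ht x =>
      (((hφ.differentiable (by simp)) _).hasDerivAt).comp x (hd t ht x)⟩

lemma inv (hf : SpaceC I j f) (h : ∀ t ∈ I, ∀ x, f x t ≠ 0) :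
    SpaceC I j (fun x t => (f x t)⁻¹) := by
  have hc : ContinuousOn (uncurry fun x t => (f x t)⁻¹) (univ ×ˢ I) :=
    hf.continuousOn.inv₀ fun q hq => h q.2 hq.2 q.1
  induction j with
  | zero => exact hc
  | succ j ih =>
    have hi := ih hf.pred
    obtain ⟨-, f', hf', hd⟩ := hf
    refine ⟨hc, _, (hf'.mul (hi.mul hi)).neg, fun t ht x => ?_⟩
    refine ((hd t ht x).inv (h t ht x)).congr_deriv ?_
    have := h t ht x
    field_simp

lemma div (hf : SpaceC I j f) (hg : SpaceC I j g) (h : ∀ t ∈ I, ∀ x, g x t ≠ 0) :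
    SpaceC I j (fun x t => f x t / g x t) :=
  (hf.mul (hg.inv h)).congr fun _ _ _ => div_eq_mul_inv _ _

lemma comp (hf : SpaceC I j f) (hg : SpaceC I j g) : SpaceC I j (fun x t => f (g x t) t) := by
  have hc : ContinuousOn (uncurry fun x t => f (g x t) t) (univ ×ˢ I) :=
    hf.continuousOn.comp (hg.continuousOn.prodMk continuousOn_snd) fun q hq => ⟨mem_univ _, hq.2⟩
  induction j generalizing f with
  | zero => exact hc
  | succ j ih =>
    have hg0 := hg.pred
    obtain ⟨-, f', hf', hd⟩ := hf
    obtain ⟨-, g', hg', hd2⟩ := hg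
    refine ⟨hc, _, (ih hf' hg0 ?_).mul hg', fun t ht x =>
      HasDerivAt.comp (h₂ := fun y => f y t) x (hd t ht (g x t)) (hd2 t ht x)⟩
    exact hf'.continuousOn.comp (hg0.continuousOn.prodMk continuousOn_snd)
      fun q hq => ⟨mem_univ _, hq.2⟩

/-- The primitive in space gains one derivative. -/
lemma primitive (hf : SpaceC univ j f) (a : ℝ) :
    SpaceC univ (j + 1) (fun x t => ∫ y in a..x, f y t) := by
  have hc : Continuous (uncurry f) := by
    have := hf.continuousOn
    rwa [univ_prod_univ, continuousOn_univ] at this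
  have hcs : Continuous (uncurry fun t y => f y t) := hc.comp continuous_swap
  refine ⟨?_, f, hf, fun t _ x => ?_⟩
  · refine Continuous.continuousOn ?_
    exact intervalIntegral.continuous_parametric_intervalIntegral_of_continuous
      (f := fun (q : ℝ × ℝ) y => f y q.2) (by
        exact hc.comp (continuous_snd.prodMk (continuous_snd.comp continuous_fst))) continuous_fst
  · have hct : Continuous fun y => f y t := hc.comp (continuous_id.prodMk continuous_const)
    exact (hct.integral_hasStrictDerivAt a x).hasDerivAt

lemma timeIntegral (hf : SpaceC univ j f) :
    SpaceC univ j (fun x t => ∫ s in (0 : ℝ)..t, f x s) := by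
  induction j generalizing f with
  | zero =>
    have hc : Continuous (uncurry f) := by
      have := hf.continuousOn
      rwa [univ_prod_univ, continuousOn_univ] at this
    refine Continuous.continuousOn ?_
    exact intervalIntegral.continuous_parametric_intervalIntegral_of_continuous
      (f := fun (q : ℝ × ℝ) s => f q.1 s) (by
        exact hc.comp ((continuous_fst.comp continuous_fst).prodMk continuous_snd)) continuous_snd
  | succ j ih =>
    have h0 : SpaceC univ 0 f := hf.mono (Nat.zero_le _)
    have hc : Continuous (uncurry f) := by
      have := hf.continuousOn
      rwa [univ_prod_univ, continuousOn_univ] at this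
    obtain ⟨-, f', hf', hd⟩ := hf
    have hc' : Continuous (uncurry f') := by
      have := hf'.continuousOn
      rwa [univ_prod_univ, continuousOn_univ] at this
    refine ⟨(ih ?_).continuousOn, _, ih hf', fun t _ x => ?_⟩
    · exact SpaceC.pred ⟨hc.continuousOn, f', hf', hd⟩
    · refine hasDerivAt_intervalIntegral_param (f := f) (U := univ) univ_mem ?_ ?_ hc'.continuousOn
      · exact fun x _ => (hc.comp (continuous_const.prodMk continuous_id)).continuousOn
      · exact fun x _ s _ => hd s (mem_univ _) x

lemma contDiff (hf : SpaceC I j f) {t : ℝ} (ht : t ∈ I) : ContDiff ℝ j (fun x => f x t) := by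
  induction j generalizing f with
  | zero =>
    refine contDiff_zero.2 ?_
    rw [← continuousOn_univ]
    exact hf.continuousOn.comp (f := fun x => (x, t)) (by fun_prop) fun x _ => ⟨mem_univ _, ht⟩
  | succ j ih =>
    obtain ⟨-, f', hf', hd⟩ := hf
    have hderiv : deriv (fun x => f x t) = fun x => f' x t := funext fun x => (hd t ht x).deriv
    push_cast
    refine contDiff_succ_iff_deriv.2 ⟨fun x => (hd t ht x).differentiableAt, by simp, ?_⟩
    rw [hderiv]
    exact ih hf'

lemma continuousOn_iteratedDeriv (hf : SpaceC I k f) (hj : j ≤ k) :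
    ContinuousOn (fun q : ℝ × ℝ => iteratedDeriv j (fun x => f x q.2) q.1) (univ ×ˢ I) := by
  induction j generalizing f k with
  | zero => simpa using! hf.continuousOn
  | succ j ih =>
    obtain ⟨k, rfl⟩ : ∃ i, k = i + 1 := ⟨k - 1, by omega⟩
    obtain ⟨-, f', hf', hd⟩ := hf
    refine (ih hf' (by omega)).congr fun q hq => ?_
    simp only [iteratedDeriv_succ']
    congr 1
    exact funext fun x => (hd q.2 hq.2 x).deriv

/-- The conversion to the class `C^k_1(D × I)`, given a jointly continuous time derivative. -/
lemma memC {J D : Set ℝ} {ft : ℝ → ℝ → ℝ} (hf : SpaceC J k f) (hIJ : I ⊆ J)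
    (hD : UniqueDiffOn ℝ D) (hI : UniqueDiffOn ℝ I)
    (ht : ∀ t ∈ J, ∀ x, HasDerivAt (fun s => f x s) (ft x t) t)
    (hft : ContinuousOn (uncurry ft) (univ ×ˢ J)) : MemC k 1 D I f where
  space t ht := (hf.contDiff (hIJ ht)).contDiffOn
  time x hx := by
    have h1 : ∀ t ∈ I, HasDerivWithinAt (fun s => f x s) (ft x t) I t :=
      fun t hti => (ht t (hIJ hti) x).hasDerivWithinAt
    rw [show ((1 : ℕ) : WithTop ℕ∞) = 0 + 1 from by norm_num, contDiffOn_succ_iff_derivWithin hI]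
    refine ⟨fun t hti => (h1 t hti).differentiableWithinAt, by simp, contDiffOn_zero.2 ?_⟩
    refine (hft.comp (f := fun t => (x, t)) (s := I) (by fun_prop)
      fun t hti => ⟨mem_univ _, hIJ hti⟩).congr fun t hti => (h1 t hti).derivWithin (hI t hti)
  space_cont j hj := by
    refine ((hf.continuousOn_iteratedDeriv hj).mono (prod_mono (subset_univ D) hIJ)).congr
      fun q hq => ?_
    exact iteratedDerivWithin_eq_iteratedDeriv hD
      (((hf.contDiff (hIJ hq.2)).of_le (by exact_mod_cast hj)).contDiffAt) hq.1
  time_cont j hj := by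
    interval_cases j
    · simpa using! hf.continuousOn.mono (prod_mono (subset_univ D) hIJ)
    · refine (hft.mono (prod_mono (subset_univ D) hIJ)).congr fun q hq => ?_
      simp only [iteratedDerivWithin_one]
      exact (ht q.2 (hIJ hq.2) q.1).hasDerivWithinAt.derivWithin (hI q.2 hq.2)

end SpaceC

/-! ### A weighted Grönwall inequality -/

/-- If every bound `Q e^{λ s}` for `|D|` on `[0, τ]` can be improved to
`C ∫₀ᵗ Q e^{λ s} ds = (C/λ) Q (e^{λ t} - 1)`, then `D` vanishes: take `λ = 2C` and the best `Q`. -/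
lemma eq_zero_of_weighted_bound {S : Type*} {s : Set S} {D : S → ℝ → ℝ} {τ C : ℝ} (hC : 0 < C)
    (hb : ∃ K, ∀ ξ ∈ s, ∀ t ∈ Icc 0 τ, |D ξ t| ≤ K)
    (h : ∀ Q, 0 ≤ Q → (∀ ξ ∈ s, ∀ t ∈ Icc 0 τ, |D ξ t| ≤ Q * Real.exp (2 * C * t)) →
      ∀ ξ ∈ s, ∀ t ∈ Icc 0 τ, |D ξ t| ≤ Q / 2 * (Real.exp (2 * C * t) - 1)) :
    ∀ ξ ∈ s, ∀ t ∈ Icc 0 τ, D ξ t = 0 := by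
  obtain ⟨K, hK⟩ := hb
  have key : ∀ n : ℕ, ∀ ξ ∈ s, ∀ t ∈ Icc 0 τ,
      |D ξ t| ≤ |K| / 2 ^ n * Real.exp (2 * C * t) := by
    intro n
    induction n with
    | zero =>
      intro ξ hξ t ht
      have h1 : 1 ≤ Real.exp (2 * C * t) := Real.one_le_exp (by have := ht.1; positivity)
      have h2 := (hK ξ hξ t ht).trans (le_abs_self K)
      simp only [pow_zero, div_one]
      nlinarith [abs_nonneg K]
    | succ n ih =>
      intro ξ hξ t ht
      have := h _ (by positivity) ih ξ hξ t ht
      have h3 : 0 ≤ |K| / 2 ^ n := by positivity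
      rw [pow_succ, ← div_div]
      nlinarith
  intro ξ hξ t ht
  have hlim : Tendsto (fun n : ℕ => |K| / 2 ^ n * Real.exp (2 * C * t)) atTop (𝓝 0) := by
    have h1 : Tendsto (fun n : ℕ => (1 / 2 : ℝ) ^ n) atTop (𝓝 0) :=
      tendsto_pow_atTop_nhds_zero_of_lt_one (by norm_num) (by norm_num)
    have h2 := (h1.const_mul |K|).mul_const (Real.exp (2 * C * t))
    simp only [mul_zero, zero_mul] at h2
    refine h2.congr fun n => ?_
    simp [div_eq_mul_inv]
  have h0 : |D ξ t| ≤ 0 := ge_of_tendsto' hlim fun n => key n ξ hξ t ht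
  exact abs_eq_zero.1 (le_antisymm h0 (abs_nonneg _))

/-- A function vanishing at `0` whose derivative on `(0, τ)` is at most `C Q e^{2 C t}` in absolute
value is at most the integral of this bound. -/
lemma abs_le_of_deriv_le_exp {f f' : ℝ → ℝ} {τ C Q : ℝ}
    (hc : ContinuousOn f (Icc 0 τ)) (h0 : f 0 = 0)
    (hd : ∀ t ∈ Ioo 0 τ, HasDerivAt f (f' t) t)
    (hb : ∀ t ∈ Ioo 0 τ, |f' t| ≤ C * (Q * Real.exp (2 * C * t))) :
    ∀ t ∈ Icc 0 τ, |f t| ≤ Q / 2 * (Real.exp (2 * C * t) - 1) := by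
  have hB : ∀ t, HasDerivAt (fun t => Q / 2 * (Real.exp (2 * C * t) - 1))
      (C * (Q * Real.exp (2 * C * t))) t := by
    intro t
    have h1 : HasDerivAt (fun t => 2 * C * t) (2 * C) t := by
      simpa using (hasDerivAt_id t).const_mul (2 * C)
    refine ((h1.exp.sub_const 1).const_mul (Q / 2)).congr_deriv ?_
    ring
  have hBc : Continuous (fun t => Q / 2 * (Real.exp (2 * C * t) - 1)) := by fun_prop
  intro t ht
  have hsub : Icc (0 : ℝ) t ⊆ Icc 0 τ := Icc_subset_Icc_right ht.2
  rw [abs_le]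
  constructor
  · have hm : MonotoneOn (fun t => f t + Q / 2 * (Real.exp (2 * C * t) - 1)) (Icc 0 t) := by
      refine monotoneOn_of_hasDerivWithinAt_nonneg (convex_Icc 0 t)
        ((hc.mono hsub).add hBc.continuousOn)
        (f' := fun t => f' t + C * (Q * Real.exp (2 * C * t))) ?_ ?_
      · intro x hx
        rw [interior_Icc] at hx
        exact ((hd x ⟨hx.1, hx.2.trans_le ht.2⟩).add (hB x)).hasDerivWithinAt
      · intro x hx
        rw [interior_Icc] at hx
        linarith [neg_le_of_abs_le (hb x ⟨hx.1, hx.2.trans_le ht.2⟩)]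
    have := hm (left_mem_Icc.2 ht.1) (right_mem_Icc.2 ht.1) ht.1
    simp [h0] at this
    linarith
  · have hm : MonotoneOn (fun t => Q / 2 * (Real.exp (2 * C * t) - 1) - f t) (Icc 0 t) := by
      refine monotoneOn_of_hasDerivWithinAt_nonneg (convex_Icc 0 t)
        (hBc.continuousOn.sub (hc.mono hsub))
        (f' := fun t => C * (Q * Real.exp (2 * C * t)) - f' t) ?_ ?_
      · intro x hx
        rw [interior_Icc] at hx
        exact ((hB x).sub (hd x ⟨hx.1, hx.2.trans_le ht.2⟩)).hasDerivWithinAt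
      · intro x hx
        rw [interior_Icc] at hx
        linarith [le_of_abs_le (hb x ⟨hx.1, hx.2.trans_le ht.2⟩)]
    have := hm (left_mem_Icc.2 ht.1) (right_mem_Icc.2 ht.1) ht.1
    simp [h0] at this
    linarith

/-! ### Global existence for the Lagrange dynamics with a cut-off exponential -/

/-- The bounded, globally Lipschitz case of the Picard–Lindelöf theorem: as the field is bounded,
the solution exists on every interval `[-n, n]`, and these solutions fit together. -/
theorem exists_global_solution {E : Type*} [NormedAddCommGroup E] [NormedSpace ℝ E]
    [CompleteSpace E] {f : E → E} {K : NNReal} {M : NNReal} (hf : LipschitzWith K f)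
    (hM : ∀ x, ‖f x‖ ≤ M) (x₀ : E) : ∃ α : ℝ → E, α 0 = x₀ ∧ ∀ t, HasDerivAt α (f (α t)) t := by
  have hex : ∀ n : ℕ, ∃ α : ℝ → E, α 0 = x₀ ∧
      ∀ t ∈ Icc (-(n + 1) : ℝ) (n + 1),
        HasDerivWithinAt α (f (α t)) (Icc (-(n + 1)) (n + 1)) t := by
    intro n
    have h0 : (0 : ℝ) ∈ Icc (-(n + 1) : ℝ) (n + 1) := ⟨by linarith, by positivity⟩
    have : IsPicardLindelof (fun _ => f) (⟨0, h0⟩ : Icc (-(n + 1) : ℝ) (n + 1)) x₀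
        (M * (n + 1)) 0 M K :=
      { lipschitzOnWith := fun t _ => hf.lipschitzOnWith
        continuousOn := fun x _ => continuousOn_const
        norm_le := fun t _ x _ => hM x
        mul_max_le := by simp }
    exact this.exists_eq_forall_mem_Icc_hasDerivWithinAt₀
  choose α hα0 hα using hex
  have hint : ∀ n : ℕ, ∀ t ∈ Ioo (-(n + 1) : ℝ) (n + 1), HasDerivAt (α n) (f (α n t)) t :=
    fun n t ht => (hα n t (Ioo_subset_Icc_self ht)).hasDerivAt (Icc_mem_nhds ht.1 ht.2)
  have huniq : ∀ m n : ℕ, m ≤ n → EqOn (α m) (α n) (Ioo (-(m + 1) : ℝ) (m + 1)) := by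
    intro m n hmn
    have hmn' : (m : ℝ) ≤ n := by exact_mod_cast hmn
    have hm0 : (0 : ℝ) ≤ m := m.cast_nonneg
    refine ODE_solution_unique_of_mem_Ioo (v := fun _ => f) (s := fun _ => univ) (K := K) (t₀ := 0)
      (fun t _ => hf.lipschitzOnWith) ⟨by linarith, by positivity⟩
      (fun t ht => ⟨hint m t ht, mem_univ _⟩)
      (fun t ht => ⟨hint n t ⟨by linarith [ht.1], by linarith [ht.2]⟩, mem_univ _⟩) ?_
    rw [hα0, hα0]
  have hmem : ∀ t : ℝ, t ∈ Ioo (-(⌈|t|⌉₊ + 1) : ℝ) (⌈|t|⌉₊ + 1) := fun t => by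
    have h1 := Nat.le_ceil |t|
    have h2 := abs_le.1 h1
    exact ⟨by linarith [h2.1], by linarith [h2.2]⟩
  have heq : ∀ n : ℕ, ∀ t ∈ Ioo (-(n + 1) : ℝ) (n + 1), α ⌈|t|⌉₊ t = α n t := by
    intro n t ht
    rcases le_total ⌈|t|⌉₊ n with h | h
    · exact huniq _ _ h (hmem t)
    · exact (huniq _ _ h ht).symm
  refine ⟨fun t => α ⌈|t|⌉₊ t, by simp [hα0], fun t => ?_⟩
  refine (hint _ t (hmem t)).congr_of_eventuallyEq ?_
  filter_upwards [Ioo_mem_nhds (hmem t).1 (hmem t).2] with s hs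
  exact heq _ s hs

lemma abs_intervalIntegral_le_of_ne_zero {h m₀ : ℝ → ℝ} {a b C : ℝ} (hm : Integrable m₀)
    (hh : ∀ θ, m₀ θ ≠ 0 → |h θ| ≤ C) : |∫ θ in a..b, h θ * m₀ θ| ≤ C * ∫ θ, |m₀ θ| := by
  have key : ∀ θ, |h θ * m₀ θ| ≤ C * |m₀ θ| := fun θ => by
    by_cases h0 : m₀ θ = 0
    · simp [h0]
    · rw [abs_mul]
      exact mul_le_mul_of_nonneg_right (hh θ h0) (abs_nonneg _)
  calc |∫ θ in a..b, h θ * m₀ θ| ≤ ∫ θ in uIoc a b, |h θ * m₀ θ| :=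
        intervalIntegral.norm_integral_le_integral_norm_uIoc (f := fun θ => h θ * m₀ θ)
    _ ≤ ∫ θ in uIoc a b, C * |m₀ θ| :=
        integral_mono_of_nonneg (Eventually.of_forall fun θ => abs_nonneg _)
          (hm.abs.const_mul C).integrableOn (Eventually.of_forall key)
    _ ≤ ∫ θ, C * |m₀ θ| := setIntegral_le_integral (hm.abs.const_mul C)
        (Eventually.of_forall fun θ => (abs_nonneg _).trans (key θ))
    _ = C * ∫ θ, |m₀ θ| := integral_const_mul _ _

lemma abs_intervalIntegral_le {h m₀ : ℝ → ℝ} {a b C : ℝ} (hm : Integrable m₀)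
    (hh : ∀ θ, |h θ| ≤ C) : |∫ θ in a..b, h θ * m₀ θ| ≤ C * ∫ θ, |m₀ θ| :=
  abs_intervalIntegral_le_of_ne_zero hm fun θ _ => hh θ

open BoundedContinuousFunction in
/-- The field `Y ↦ (∫_{-L}^ξ h₁(θ + Y) m₀)(∫_ξ^L h₂(θ + Y) m₀)` on `C_b(ℝ)` is bounded and
Lipschitz. -/
lemma exists_lipschitz_field {h₁ h₂ m₀ : ℝ → ℝ} {K C : ℝ} {a b : ℝ} (hm : Continuous m₀)
    (hmi : Integrable m₀) (hK : 0 ≤ K) (hh₁ : ∀ x, |h₁ x| ≤ C) (hh₂ : ∀ x, |h₂ x| ≤ C)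
    (hl₁ : ∀ x y, |h₁ x - h₁ y| ≤ K * |x - y|) (hl₂ : ∀ x y, |h₂ x - h₂ y| ≤ K * |x - y|)
    (hc₁ : Continuous h₁) (hc₂ : Continuous h₂) :
    ∃ (F : (ℝ →ᵇ ℝ) → (ℝ →ᵇ ℝ)) (K' M : NNReal), LipschitzWith K' F ∧ (∀ Y, ‖F Y‖ ≤ M) ∧
      ∀ Y ξ, F Y ξ = (∫ θ in a..ξ, h₁ (θ + Y θ) * m₀ θ) * ∫ θ in ξ..b, h₂ (θ + Y θ) * m₀ θ := by
  have hC : 0 ≤ C := (abs_nonneg _).trans (hh₁ 0)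
  set M₁ := ∫ θ, |m₀ θ|
  have hM₁ : 0 ≤ M₁ := integral_nonneg fun θ => abs_nonneg _
  have hbound : ∀ (Y : ℝ →ᵇ ℝ) ξ,
      |(∫ θ in a..ξ, h₁ (θ + Y θ) * m₀ θ) * ∫ θ in ξ..b, h₂ (θ + Y θ) * m₀ θ| ≤
        (C * M₁) * (C * M₁) := by
    intro Y ξ
    rw [abs_mul]
    exact mul_le_mul (abs_intervalIntegral_le hmi fun θ => hh₁ _)
      (abs_intervalIntegral_le hmi fun θ => hh₂ _) (abs_nonneg _) (by positivity)
  have hcont : ∀ (h : ℝ → ℝ), Continuous h → ∀ (Y : ℝ →ᵇ ℝ) (c : ℝ),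
      Continuous fun ξ => ∫ θ in c..ξ, h (θ + Y θ) * m₀ θ := by
    intro h hh Y c
    refine intervalIntegral.continuous_primitive (fun x y => ?_) c
    exact Continuous.intervalIntegrable (by fun_prop) _ _
  let F : (ℝ →ᵇ ℝ) → (ℝ →ᵇ ℝ) := fun Y => BoundedContinuousFunction.ofNormedAddCommGroup
    (fun ξ => (∫ θ in a..ξ, h₁ (θ + Y θ) * m₀ θ) * ∫ θ in ξ..b, h₂ (θ + Y θ) * m₀ θ)
    (by
      refine (hcont h₁ hc₁ Y a).mul ?_
      refine (hcont h₂ hc₂ Y b).neg.congr fun ξ => ?_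
      exact (intervalIntegral.integral_symm _ _).symm) ((C * M₁) * (C * M₁)) (hbound Y)
  have hdiff : ∀ (h : ℝ → ℝ), Continuous h → (∀ x y, |h x - h y| ≤ K * |x - y|) →
      ∀ (Y Z : ℝ →ᵇ ℝ) (c d : ℝ),
      |(∫ θ in c..d, h (θ + Y θ) * m₀ θ) - ∫ θ in c..d, h (θ + Z θ) * m₀ θ| ≤
        K * dist Y Z * M₁ := by
    intro h hh hl Y Z c d
    rw [← intervalIntegral.integral_sub (Continuous.intervalIntegrable (by fun_prop) _ _)
      (Continuous.intervalIntegrable (by fun_prop) _ _)]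
    simp_rw [← sub_mul]
    refine abs_intervalIntegral_le hmi fun θ => (hl _ _).trans ?_
    refine mul_le_mul_of_nonneg_left ?_ hK
    rw [add_sub_add_left_eq_sub, ← Real.dist_eq]
    exact BoundedContinuousFunction.dist_coe_le_dist θ
  have h2 : 0 ≤ 2 * C * M₁ * K * M₁ := by positivity
  have h3 : 0 ≤ (C * M₁) * (C * M₁) := by positivity
  refine ⟨F, ⟨2 * C * M₁ * K * M₁, h2⟩, ⟨(C * M₁) * (C * M₁), h3⟩, ?_, ?_,
    fun Y ξ => rfl⟩
  · refine LipschitzWith.of_dist_le_mul fun Y Z => ?_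
    refine (BoundedContinuousFunction.dist_le (by positivity)).2 fun ξ => ?_
    rw [Real.dist_eq]
    change |(∫ θ in a..ξ, h₁ (θ + Y θ) * m₀ θ) * (∫ θ in ξ..b, h₂ (θ + Y θ) * m₀ θ) -
      (∫ θ in a..ξ, h₁ (θ + Z θ) * m₀ θ) * (∫ θ in ξ..b, h₂ (θ + Z θ) * m₀ θ)| ≤
        2 * C * M₁ * K * M₁ * dist Y Z
    set A := ∫ θ in a..ξ, h₁ (θ + Y θ) * m₀ θ
    set B := ∫ θ in ξ..b, h₂ (θ + Y θ) * m₀ θ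
    set A' := ∫ θ in a..ξ, h₁ (θ + Z θ) * m₀ θ
    set B' := ∫ θ in ξ..b, h₂ (θ + Z θ) * m₀ θ
    have e1 : |A - A'| ≤ K * dist Y Z * M₁ := hdiff h₁ hc₁ hl₁ Y Z a ξ
    have e2 : |B - B'| ≤ K * dist Y Z * M₁ := hdiff h₂ hc₂ hl₂ Y Z ξ b
    have e3 : |B| ≤ C * M₁ := abs_intervalIntegral_le hmi fun θ => hh₂ _
    have e4 : |A'| ≤ C * M₁ := abs_intervalIntegral_le hmi fun θ => hh₁ _
    calc |A * B - A' * B'| = |(A - A') * B + A' * (B - B')| := by ring_nf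
      _ ≤ |A - A'| * |B| + |A'| * |B - B'| := by
          refine (abs_add_le _ _).trans ?_
          rw [abs_mul, abs_mul]
      _ ≤ (K * dist Y Z * M₁) * (C * M₁) + (C * M₁) * (K * dist Y Z * M₁) := by gcongr
      _ = 2 * C * M₁ * K * M₁ * dist Y Z := by ring
  · exact fun Y => BoundedContinuousFunction.norm_ofNormedAddCommGroup_le _ (by positivity) _

/-- A compactly supported smooth function is bounded and Lipschitz. -/
lemma exists_bound_lipschitz {h : ℝ → ℝ} (hh : ContDiff ℝ ∞ h) (hs : HasCompactSupport h) :
    ∃ C, 0 ≤ C ∧ (∀ x, |h x| ≤ C) ∧ ∀ x y, |h x - h y| ≤ C * |x - y| := by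
  obtain ⟨C₁, hC₁⟩ := hh.continuous.bounded_above_of_compact_support hs
  obtain ⟨C₂, hC₂⟩ := ContDiff.lipschitzWith_of_hasCompactSupport hs hh (by simp)
  refine ⟨max C₁ C₂, le_max_of_le_right C₂.2, fun x => (hC₁ x).trans (le_max_left _ _),
    fun x y => ?_⟩
  have := hC₂.dist_le_mul x y
  rw [Real.dist_eq, Real.dist_eq] at this
  exact this.trans (mul_le_mul_of_nonneg_right (le_max_right _ _) (abs_nonneg _))

/-- The data of the problem together with the global flow `X` of the Lagrange dynamics in which
`e^{±X}` is replaced by smooth compactly supported functions `Ep`, `Em` that agree with `e^{±x}` on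
`[-L, L]`. As long as `X(·,t)` is increasing, it takes its values in `[-L, L]` on `[-L, L]`, and
the product of the two integrals is the velocity `u² - u_x² = (u - u_x)(u + u_x)` at `X(ξ,t)`. The
label `ξ` and the time `t` range over all of `ℝ`, so that no one-sided derivatives occur. -/
structure CutoffFlow (k : ℕ) (L : ℝ) (m₀ : ℝ → ℝ) where
  one_le : 1 ≤ k
  pos : 0 < L
  smooth : ContDiff ℝ k m₀
  supp : tsupport m₀ ⊆ Ioo (-L) L
  Ep : ℝ → ℝ
  Em : ℝ → ℝ
  smooth_Ep : ContDiff ℝ ∞ Ep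
  smooth_Em : ContDiff ℝ ∞ Em
  compact_Ep : HasCompactSupport Ep
  compact_Em : HasCompactSupport Em
  Ep_eq : ∀ x ∈ Icc (-L) L, Ep x = Real.exp x
  Em_eq : ∀ x ∈ Icc (-L) L, Em x = Real.exp (-x)
  X : ℝ → ℝ → ℝ
  cont : Continuous (uncurry X)
  init : ∀ ξ, X ξ 0 = ξ
  ode : ∀ ξ t, HasDerivAt (fun s => X ξ s)
    ((∫ θ in (-L)..ξ, Ep (X θ t) * m₀ θ) * ∫ θ in ξ..L, Em (X θ t) * m₀ θ) t

theorem exists_cutoffFlow {k : ℕ} {L : ℝ} {m₀ : ℝ → ℝ} (hk : 1 ≤ k) (hL : 0 < L)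
    (hm₀ : ContDiff ℝ k m₀) (hsupp : tsupport m₀ ⊆ Ioo (-L) L) : Nonempty (CutoffFlow k L m₀) := by
  let β : ContDiffBump (0 : ℝ) := ⟨L, L + 1, hL, by linarith⟩
  have hβ : ∀ x ∈ Icc (-L) L, β x = 1 := fun x hx => by
    refine β.one_of_mem_closedBall ?_
    rw [Metric.mem_closedBall, Real.dist_eq, sub_zero]
    exact abs_le.2 hx
  have hp : ContDiff ℝ ∞ fun x => Real.exp x * β x := Real.contDiff_exp.mul β.contDiff
  have hn : ContDiff ℝ ∞ fun x => Real.exp (-x) * β x :=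
    (Real.contDiff_exp.comp contDiff_neg).mul β.contDiff
  have hps : HasCompactSupport fun x => Real.exp x * β x := β.hasCompactSupport.mul_left
  have hns : HasCompactSupport fun x => Real.exp (-x) * β x := β.hasCompactSupport.mul_left
  obtain ⟨C₁, hC₁, hb₁, hl₁⟩ := exists_bound_lipschitz hp hps
  obtain ⟨C₂, hC₂, hb₂, hl₂⟩ := exists_bound_lipschitz hn hns
  have hcs : HasCompactSupport m₀ :=
    HasCompactSupport.of_support_subset_isCompact isCompact_Icc
      ((subset_tsupport _).trans (hsupp.trans Ioo_subset_Icc_self))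
  obtain ⟨F, K, M, hF, hFM, hFe⟩ := exists_lipschitz_field (a := -L) (b := L) (K := max C₁ C₂)
    (C := max C₁ C₂) hm₀.continuous (hm₀.continuous.integrable_of_hasCompactSupport hcs)
    (le_max_of_le_left hC₁) (fun x => (hb₁ x).trans (le_max_left _ _))
    (fun x => (hb₂ x).trans (le_max_right _ _))
    (fun x y => (hl₁ x y).trans (mul_le_mul_of_nonneg_right (le_max_left _ _) (abs_nonneg _)))
    (fun x y => (hl₂ x y).trans (mul_le_mul_of_nonneg_right (le_max_right _ _) (abs_nonneg _)))
    hp.continuous hn.continuous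
  obtain ⟨α, hα0, hα⟩ := exists_global_solution hF hFM 0
  have hαc : Continuous α := continuous_iff_continuousAt.2 fun t => (hα t).continuousAt
  exact ⟨
    { one_le := hk, pos := hL, smooth := hm₀, supp := hsupp
      Ep := _, Em := _, smooth_Ep := hp, smooth_Em := hn, compact_Ep := hps, compact_Em := hns
      Ep_eq := fun x hx => by simp [hβ x hx]
      Em_eq := fun x hx => by simp [hβ x hx]
      X := fun ξ t => ξ + α t ξ
      cont := by
        refine continuous_fst.add ?_
        exact continuous_eval.comp
          ((hαc.comp continuous_snd).prodMk continuous_fst)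
      init := fun ξ => by simp [hα0]
      ode := fun ξ t => by
        have := ((BoundedContinuousFunction.evalCLM ℝ ξ).hasFDerivAt.comp_hasDerivAt t
          (hα t)).const_add ξ
        rw [← hFe]
        exact this }⟩

/-! ### Regularity of the flow -/

lemma SpaceC.continuous {j : ℕ} {f : ℝ → ℝ → ℝ} (hf : SpaceC univ j f) :
    Continuous (uncurry f) := by
  have := hf.continuousOn
  rwa [univ_prod_univ, continuousOn_univ] at this

namespace CutoffFlow

variable {k : ℕ} {L : ℝ} {m₀ : ℝ → ℝ} (F : CutoffFlow k L m₀)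

/-- The label form of `e^x (u - u_x)`, the contribution of the mass to the left. -/
def A (ξ t : ℝ) : ℝ := ∫ θ in (-L)..ξ, F.Ep (F.X θ t) * m₀ θ

/-- The label form of `e^{-x} (u + u_x)`, the contribution of the mass to the right. -/
def B (ξ t : ℝ) : ℝ := ∫ θ in ξ..L, F.Em (F.X θ t) * m₀ θ

/-- The velocity of the label `ξ`. -/
def V (ξ t : ℝ) : ℝ := F.A ξ t * F.B ξ t

/-- The label form of `2 u_x`. -/
def g (ξ t : ℝ) : ℝ := F.Ep (F.X ξ t) * F.B ξ t - F.Em (F.X ξ t) * F.A ξ t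

/-- The derivative `X_ξ`. -/
def Xd (ξ t : ℝ) : ℝ := 1 + ∫ s in (0 : ℝ)..t, m₀ ξ * F.g ξ s

/-- The time derivative of `A`. -/
def At (ξ t : ℝ) : ℝ := ∫ θ in (-L)..ξ, deriv F.Ep (F.X θ t) * F.V θ t * m₀ θ

/-- The time derivative of `B`. -/
def Bt (ξ t : ℝ) : ℝ := ∫ θ in ξ..L, deriv F.Em (F.X θ t) * F.V θ t * m₀ θ

include F in
lemma m₀_eq_zero {ξ : ℝ} (h : ξ ∉ Ioo (-L) L) : m₀ ξ = 0 :=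
  image_eq_zero_of_notMem_tsupport fun h' => h (F.supp h')

include F in
lemma hasCompactSupport : HasCompactSupport m₀ :=
  HasCompactSupport.of_support_subset_isCompact isCompact_Icc
    ((subset_tsupport _).trans (F.supp.trans Ioo_subset_Icc_self))

include F in
lemma continuous_m₀ : Continuous m₀ := F.smooth.continuous

include F in
lemma integrable_m₀ : Integrable m₀ :=
  F.continuous_m₀.integrable_of_hasCompactSupport F.hasCompactSupport

lemma spaceC_A_of {j : ℕ} (hj : j ≤ k) (hX : SpaceC univ j F.X) : SpaceC univ (j + 1) F.A :=
  ((hX.comp_left (F.smooth_Ep.of_le (by exact_mod_cast le_top))).mul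
    (SpaceC.of_contDiff (F.smooth.of_le (by exact_mod_cast hj)))).primitive (-L)

lemma spaceC_B_of {j : ℕ} (hj : j ≤ k) (hX : SpaceC univ j F.X) : SpaceC univ (j + 1) F.B :=
  (((hX.comp_left (F.smooth_Em.of_le (by exact_mod_cast le_top))).mul
    (SpaceC.of_contDiff (F.smooth.of_le (by exact_mod_cast hj)))).primitive L).neg.congr
      fun _ _ _ => intervalIntegral.integral_symm _ _

lemma hasDerivAt_X_time (ξ t : ℝ) : HasDerivAt (fun s => F.X ξ s) (F.V ξ t) t := F.ode ξ t

lemma continuous_X : Continuous (uncurry F.X) := F.cont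

lemma continuous_V : Continuous (uncurry F.V) := by
  have h : SpaceC univ 0 F.X := F.continuous_X.continuousOn
  exact ((F.spaceC_A_of (Nat.zero_le k) h).mul (F.spaceC_B_of (Nat.zero_le k) h)).continuous

lemma X_eq (ξ t : ℝ) : F.X ξ t = ξ + ∫ s in (0 : ℝ)..t, F.V ξ s := by
  have hc : Continuous (F.V ξ) := F.continuous_V.comp (continuous_const.prodMk continuous_id)
  rw [intervalIntegral.integral_eq_sub_of_hasDerivAt (fun s _ => F.hasDerivAt_X_time ξ s)
    (hc.intervalIntegrable _ _), F.init]
  ring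

/-- The flow gains a derivative over its own regularity, up to the limit that `m₀ ∈ C^k` sets. -/
lemma spaceC_X : SpaceC univ (k + 1) F.X := by
  have key : ∀ j ≤ k + 1, SpaceC univ j F.X := by
    intro j
    induction j with
    | zero => exact fun _ => F.continuous_X.continuousOn
    | succ j ih =>
      intro hj
      have hX := ih (by omega)
      have hV : SpaceC univ (j + 1) F.V :=
        (F.spaceC_A_of (by omega) hX).mul (F.spaceC_B_of (by omega) hX)
      exact ((SpaceC.of_contDiff (φ := fun x => x) contDiff_id).add hV.timeIntegral).congr
        fun t _ x => F.X_eq x t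
  exact key _ le_rfl

lemma spaceC_A : SpaceC univ (k + 1) F.A := F.spaceC_A_of le_rfl F.spaceC_X.pred

lemma spaceC_B : SpaceC univ (k + 1) F.B := F.spaceC_B_of le_rfl F.spaceC_X.pred

lemma spaceC_g : SpaceC univ (k + 1) F.g :=
  ((F.spaceC_X.comp_left (F.smooth_Ep.of_le (by exact_mod_cast le_top))).mul F.spaceC_B).sub
    ((F.spaceC_X.comp_left (F.smooth_Em.of_le (by exact_mod_cast le_top))).mul F.spaceC_A)

lemma continuous_g : Continuous (uncurry F.g) := F.spaceC_g.continuous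

lemma continuous_left {f : ℝ → ℝ → ℝ} (hf : Continuous (uncurry f)) (t : ℝ) :
    Continuous fun ξ => f ξ t := hf.comp (continuous_id.prodMk continuous_const)

lemma continuous_right {f : ℝ → ℝ → ℝ} (hf : Continuous (uncurry f)) (ξ : ℝ) :
    Continuous fun t => f ξ t := hf.comp (continuous_const.prodMk continuous_id)

lemma hasDerivAt_A (ξ t : ℝ) :
    HasDerivAt (fun η => F.A η t) (F.Ep (F.X ξ t) * m₀ ξ) ξ := by
  have hc : Continuous fun θ => F.Ep (F.X θ t) * m₀ θ :=
    (F.smooth_Ep.continuous.comp (continuous_left F.continuous_X t)).mul F.continuous_m₀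
  exact (hc.integral_hasStrictDerivAt (-L) ξ).hasDerivAt

lemma hasDerivAt_B (ξ t : ℝ) :
    HasDerivAt (fun η => F.B η t) (-(F.Em (F.X ξ t) * m₀ ξ)) ξ := by
  have hc : Continuous fun θ => F.Em (F.X θ t) * m₀ θ :=
    (F.smooth_Em.continuous.comp (continuous_left F.continuous_X t)).mul F.continuous_m₀
  refine (hc.integral_hasStrictDerivAt L ξ).hasDerivAt.neg.congr_of_eventuallyEq ?_
  exact Eventually.of_forall fun η => intervalIntegral.integral_symm _ _

lemma hasDerivAt_V (ξ t : ℝ) : HasDerivAt (fun η => F.V η t) (m₀ ξ * F.g ξ t) ξ := by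
  refine ((F.hasDerivAt_A ξ t).mul (F.hasDerivAt_B ξ t)).congr_deriv ?_
  simp only [g]
  ring

lemma continuous_m₀_mul_g : Continuous (uncurry fun ξ t => m₀ ξ * F.g ξ t) :=
  (F.continuous_m₀.comp continuous_fst).mul F.continuous_g

lemma hasDerivAt_X (ξ t : ℝ) : HasDerivAt (fun η => F.X η t) (F.Xd ξ t) ξ := by
  have h := hasDerivAt_intervalIntegral_param (f := F.V) (a := 0) (b := t) (x₀ := ξ) (U := univ)
    univ_mem (fun x _ => (continuous_right F.continuous_V x).continuousOn)
    (fun x _ s _ => F.hasDerivAt_V x s) F.continuous_m₀_mul_g.continuousOn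
  refine ((hasDerivAt_id ξ).add h).congr_of_eventuallyEq ?_
  exact Eventually.of_forall fun η => F.X_eq η t

lemma spaceC_Xd : SpaceC univ k F.Xd := F.spaceC_X.of_deriv fun t _ x => F.hasDerivAt_X x t

lemma continuous_Xd : Continuous (uncurry F.Xd) := F.spaceC_Xd.continuous

lemma hasDerivAt_Xd_time (ξ t : ℝ) : HasDerivAt (fun s => F.Xd ξ s) (m₀ ξ * F.g ξ t) t := by
  have hc : Continuous fun s => m₀ ξ * F.g ξ s := continuous_right F.continuous_m₀_mul_g ξ
  exact (hc.integral_hasStrictDerivAt 0 t).hasDerivAt.const_add 1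

lemma continuous_At_integrand : Continuous (uncurry fun θ t =>
    deriv F.Ep (F.X θ t) * F.V θ t * m₀ θ) :=
  (((F.smooth_Ep.continuous_deriv (by simp)).comp F.continuous_X).mul F.continuous_V).mul
    (F.continuous_m₀.comp continuous_fst)

lemma continuous_Bt_integrand : Continuous (uncurry fun θ t =>
    deriv F.Em (F.X θ t) * F.V θ t * m₀ θ) :=
  (((F.smooth_Em.continuous_deriv (by simp)).comp F.continuous_X).mul F.continuous_V).mul
    (F.continuous_m₀.comp continuous_fst)

lemma continuous_At : Continuous (uncurry F.At) := by
  have h : SpaceC univ 0 fun θ t => deriv F.Ep (F.X θ t) * F.V θ t * m₀ θ :=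
    F.continuous_At_integrand.continuousOn
  exact (h.primitive (-L)).continuous

lemma continuous_Bt : Continuous (uncurry F.Bt) := by
  have h : SpaceC univ 0 fun θ t => deriv F.Em (F.X θ t) * F.V θ t * m₀ θ :=
    F.continuous_Bt_integrand.continuousOn
  refine (h.primitive L).continuous.neg.congr fun q => ?_
  exact (intervalIntegral.integral_symm _ _).symm

lemma hasDerivAt_A_time (ξ t : ℝ) : HasDerivAt (fun s => F.A ξ s) (F.At ξ t) t := by
  refine hasDerivAt_intervalIntegral_param (f := fun s θ => F.Ep (F.X θ s) * m₀ θ)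
    (f' := fun s θ => deriv F.Ep (F.X θ s) * F.V θ s * m₀ θ) (U := univ)
    univ_mem (fun s _ => ?_) (fun s _ θ _ => ?_)
    (F.continuous_At_integrand.comp continuous_swap).continuousOn
  · exact ((F.smooth_Ep.continuous.comp (continuous_left F.continuous_X s)).mul
      F.continuous_m₀).continuousOn
  · exact ((((F.smooth_Ep.differentiable (by simp)) _).hasDerivAt).comp s
      (F.hasDerivAt_X_time θ s)).mul_const _

lemma hasDerivAt_B_time (ξ t : ℝ) : HasDerivAt (fun s => F.B ξ s) (F.Bt ξ t) t := by
  refine hasDerivAt_intervalIntegral_param (f := fun s θ => F.Em (F.X θ s) * m₀ θ)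
    (f' := fun s θ => deriv F.Em (F.X θ s) * F.V θ s * m₀ θ) (U := univ)
    univ_mem (fun s _ => ?_) (fun s _ θ _ => ?_)
    (F.continuous_Bt_integrand.comp continuous_swap).continuousOn
  · exact ((F.smooth_Em.continuous.comp (continuous_left F.continuous_X s)).mul
      F.continuous_m₀).continuousOn
  · exact ((((F.smooth_Em.differentiable (by simp)) _).hasDerivAt).comp s
      (F.hasDerivAt_X_time θ s)).mul_const _

include F in
lemma integral_eq_zero_of_le {h : ℝ → ℝ} {ξ : ℝ} (hξ : ξ ≤ -L) :
    ∫ θ in (-L)..ξ, h θ * m₀ θ = 0 := by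
  refine intervalIntegral.integral_zero_ae (Eventually.of_forall fun θ hθ => ?_)
  rw [uIoc_of_ge hξ] at hθ
  rw [F.m₀_eq_zero fun h => absurd h.1 (not_lt.2 hθ.2), mul_zero]

include F in
lemma integral_eq_zero_of_ge {h : ℝ → ℝ} {ξ : ℝ} (hξ : L ≤ ξ) :
    ∫ θ in ξ..L, h θ * m₀ θ = 0 := by
  refine intervalIntegral.integral_zero_ae (Eventually.of_forall fun θ hθ => ?_)
  rw [uIoc_of_ge hξ] at hθ
  rw [F.m₀_eq_zero fun h => absurd h.2 (not_lt.2 hθ.1.le), mul_zero]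

lemma A_eq_zero {ξ : ℝ} (hξ : ξ ≤ -L) (t : ℝ) : F.A ξ t = 0 := F.integral_eq_zero_of_le hξ

lemma B_eq_zero {ξ : ℝ} (hξ : L ≤ ξ) (t : ℝ) : F.B ξ t = 0 := F.integral_eq_zero_of_ge hξ

lemma X_eq_self {ξ : ℝ} (h : ξ ∉ Ioo (-L) L) (t : ℝ) : F.X ξ t = ξ := by
  have hV : ∀ s, F.V ξ s = 0 := fun s => by
    rw [V]
    rcases le_or_gt ξ (-L) with h1 | h1
    · rw [F.A_eq_zero h1, zero_mul]
    · rw [F.B_eq_zero (not_lt.1 fun h2 => h ⟨h1, h2⟩), mul_zero]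
  rw [F.X_eq]
  simp [hV]

lemma X_neg_L (t : ℝ) : F.X (-L) t = -L := F.X_eq_self (by simp) t

lemma X_L (t : ℝ) : F.X L t = L := F.X_eq_self (by simp) t

lemma Xd_eq_one {ξ : ℝ} (h : m₀ ξ = 0) (t : ℝ) : F.Xd ξ t = 1 := by simp [Xd, h]

lemma Xd_zero (ξ : ℝ) : F.Xd ξ 0 = 1 := by simp [Xd]

lemma Xξ_eq {ξ : ℝ} (h : ξ ∈ Icc (-L) L) (t : ℝ) : Xξ L F.X ξ t = F.Xd ξ t :=
  (F.hasDerivAt_X ξ t).hasDerivWithinAt.derivWithin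
    (uniqueDiffOn_Icc (by linarith [F.pos]) ξ h)

/-- The times at which the flow is an increasing diffeomorphism. -/
def J : Set ℝ := {t | ∀ ξ, 0 < F.Xd ξ t}

lemma mem_J {t : ℝ} : t ∈ F.J ↔ ∀ ξ ∈ Icc (-L) L, 0 < F.Xd ξ t := by
  refine ⟨fun h ξ _ => h ξ, fun h ξ => ?_⟩
  by_cases hξ : ξ ∈ Icc (-L) L
  · exact h ξ hξ
  · rw [F.Xd_eq_one (F.m₀_eq_zero fun h => hξ (Ioo_subset_Icc_self h))]
    exact one_pos

lemma isOpen_J : IsOpen F.J := by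
  refine isOpen_iff_mem_nhds.2 fun t ht => ?_
  have h : ∀ᶠ s in 𝓝 t, ∀ ξ ∈ Icc (-L) L, 0 < F.Xd ξ s := by
    refine isCompact_Icc.eventually_forall_of_forall_eventually fun ξ _ => ?_
    exact (F.continuous_Xd.comp continuous_swap).continuousAt.eventually (lt_mem_nhds (ht ξ))
  filter_upwards [h] with s hs
  exact F.mem_J.2 hs

lemma zero_mem_J : (0 : ℝ) ∈ F.J := fun ξ => by simp [F.Xd_zero]

/-- `Tmax` is the first time at which `X_ξ` vanishes somewhere, or `+∞` if there is none. -/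
lemma exists_Tmax : ∃ Tmax : EReal, 0 < Tmax ∧ timeIco Tmax ⊆ F.J ∧
    ∀ T : ℝ, Tmax = T → (∃ ξ ∈ Icc (-L) L, F.Xd ξ T = 0) ∧ ∀ ξ, 0 ≤ F.Xd ξ T := by
  rcases (Ici 0 \ F.J).eq_empty_or_nonempty with h | h
  · refine ⟨⊤, by simp, fun t ht => ?_, fun T hT => absurd hT (by simp)⟩
    by_contra h'
    exact (h ▸ (⟨ht.1, h'⟩ : t ∈ Ici 0 \ F.J) : t ∈ (∅ : Set ℝ))
  · have hcl : IsClosed (Ici 0 \ F.J) := isClosed_Ici.sdiff F.isOpen_J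
    have hbdd : BddBelow (Ici 0 \ F.J) := ⟨0, fun t ht => ht.1⟩
    obtain ⟨h0, hJ⟩ := hcl.csInf_mem h hbdd
    set T₁ := sInf (Ici 0 \ F.J)
    have hlt : ∀ t, 0 ≤ t → t < T₁ → t ∈ F.J := fun t ht htT => by
      by_contra h'
      exact not_lt.2 (csInf_le hbdd ⟨ht, h'⟩) htT
    have hpos : 0 < T₁ := lt_of_le_of_ne h0 fun h' => hJ (h' ▸ F.zero_mem_J)
    refine ⟨T₁, by exact_mod_cast hpos, fun t ht => hlt t ht.1 (by exact_mod_cast ht.2),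
      fun T hT => ?_⟩
    obtain rfl : T₁ = T := by exact_mod_cast hT
    have hnn : ∀ ξ, 0 ≤ F.Xd ξ T₁ := fun ξ => by
      have hlim : Tendsto (fun t => F.Xd ξ t) (𝓝[<] T₁) (𝓝 (F.Xd ξ T₁)) :=
        (continuous_right F.continuous_Xd ξ).continuousAt.tendsto.mono_left nhdsWithin_le_nhds
      refine ge_of_tendsto hlim ?_
      filter_upwards [Ioo_mem_nhdsLT hpos] with t ht
      exact (hlt t ht.1.le ht.2 ξ).le
    refine ⟨?_, hnn⟩
    by_contra! h'
    exact hJ (F.mem_J.2 fun ξ hξ => lt_of_le_of_ne (hnn ξ) (h' ξ hξ).symm)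

end CutoffFlow

/-! ### The kernels `G`, `G'` along an increasing configuration -/

lemma continuous_G : Continuous G := by unfold G; fun_prop

lemma abs_G_le (x : ℝ) : |G x| ≤ 1 / 2 := by
  rw [G, abs_of_pos (by positivity)]
  have : Real.exp (-|x|) ≤ 1 := Real.exp_le_one_iff.2 (by simp)
  linarith

lemma G_of_nonneg {x : ℝ} (h : 0 ≤ x) : G x = Real.exp (-x) / 2 := by rw [G, abs_of_nonneg h]

lemma G_of_nonpos {x : ℝ} (h : x ≤ 0) : G x = Real.exp x / 2 := by
  rw [G, abs_of_nonpos h, neg_neg]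

lemma G'_of_pos {x : ℝ} (h : 0 < x) : G' x = -G x := by simp [G', sign_pos h]

lemma G'_of_neg {x : ℝ} (h : x < 0) : G' x = G x := by simp [G', sign_neg h]

/-- If the positions `Y θ` are to the left of `x` for `θ < ξ` and to the right for `θ > ξ`, then
`∫ G(x - Y) m₀` and `∫ G'(x - Y) m₀` are combinations of two exponential moments, and the velocity
is their product: the factors `e^{±x}` cancel in `(u - u_x)(u + u_x)`. -/
lemma integral_kernel_split {Y m₀ : ℝ → ℝ} {L ξ x : ℝ}
    (hG : IntervalIntegrable (fun θ => G (x - Y θ) * m₀ θ) volume (-L) ξ)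
    (hG₂ : IntervalIntegrable (fun θ => G (x - Y θ) * m₀ θ) volume ξ L)
    (h : ∀ θ ∈ uIoc (-L) ξ, θ ≠ ξ → m₀ θ ≠ 0 → Y θ < x)
    (h₂ : ∀ θ ∈ uIoc ξ L, θ ≠ ξ → m₀ θ ≠ 0 → x < Y θ) :
    (∫ θ in (-L)..L, G (x - Y θ) * m₀ θ = (Real.exp x * (∫ θ in ξ..L, Real.exp (-Y θ) * m₀ θ) +
      Real.exp (-x) * ∫ θ in (-L)..ξ, Real.exp (Y θ) * m₀ θ) / 2) ∧
    (∫ θ in (-L)..L, G' (x - Y θ) * m₀ θ = (Real.exp x * (∫ θ in ξ..L, Real.exp (-Y θ) * m₀ θ) -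
      Real.exp (-x) * ∫ θ in (-L)..ξ, Real.exp (Y θ) * m₀ θ) / 2) ∧
    (∫ θ in (-L)..L, G (x - Y θ) * m₀ θ) ^ 2 - (∫ θ in (-L)..L, G' (x - Y θ) * m₀ θ) ^ 2 =
      (∫ θ in (-L)..ξ, Real.exp (Y θ) * m₀ θ) * ∫ θ in ξ..L, Real.exp (-Y θ) * m₀ θ := by
  have hne : ∀ᵐ θ : ℝ, θ ≠ ξ := by simp [ae_iff]
  have eG : ∀ᵐ θ : ℝ, θ ∈ uIoc (-L) ξ →
      G (x - Y θ) * m₀ θ = Real.exp (-x) / 2 * (Real.exp (Y θ) * m₀ θ) := by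
    filter_upwards [hne] with θ hθ hmem
    by_cases hm : m₀ θ = 0
    · simp [hm]
    · rw [G_of_nonneg (by linarith [h θ hmem hθ hm]), neg_sub, sub_eq_neg_add, Real.exp_add]
      ring
  have eG₂ : ∀ᵐ θ : ℝ, θ ∈ uIoc ξ L →
      G (x - Y θ) * m₀ θ = Real.exp x / 2 * (Real.exp (-Y θ) * m₀ θ) := by
    filter_upwards [hne] with θ hθ hmem
    by_cases hm : m₀ θ = 0
    · simp [hm]
    · rw [G_of_nonpos (by linarith [h₂ θ hmem hθ hm]), sub_eq_add_neg, Real.exp_add]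
      ring
  have eG' : ∀ᵐ θ : ℝ, θ ∈ uIoc (-L) ξ → G' (x - Y θ) * m₀ θ = -(G (x - Y θ) * m₀ θ) := by
    filter_upwards [hne] with θ hθ hmem
    by_cases hm : m₀ θ = 0
    · simp [hm]
    · rw [G'_of_pos (by linarith [h θ hmem hθ hm]), neg_mul]
  have eG'₂ : ∀ᵐ θ : ℝ, θ ∈ uIoc ξ L → G' (x - Y θ) * m₀ θ = G (x - Y θ) * m₀ θ := by
    filter_upwards [hne] with θ hθ hmem
    by_cases hm : m₀ θ = 0
    · simp [hm]
    · rw [G'_of_neg (by linarith [h₂ θ hmem hθ hm])]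
  have hG' : IntervalIntegrable (fun θ => G' (x - Y θ) * m₀ θ) volume (-L) ξ :=
    hG.neg.congr_ae ((ae_restrict_iff' measurableSet_uIoc).2
      (eG'.mono fun θ hθ hm => (hθ hm).symm))
  have hG'₂ : IntervalIntegrable (fun θ => G' (x - Y θ) * m₀ θ) volume ξ L :=
    hG₂.congr_ae ((ae_restrict_iff' measurableSet_uIoc).2
      (eG'₂.mono fun θ hθ hm => (hθ hm).symm))
  have i1 : ∫ θ in (-L)..L, G (x - Y θ) * m₀ θ =
      (Real.exp x * (∫ θ in ξ..L, Real.exp (-Y θ) * m₀ θ) +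
      Real.exp (-x) * ∫ θ in (-L)..ξ, Real.exp (Y θ) * m₀ θ) / 2 := by
    rw [← intervalIntegral.integral_add_adjacent_intervals hG hG₂,
      intervalIntegral.integral_congr_ae eG, intervalIntegral.integral_congr_ae eG₂,
      intervalIntegral.integral_const_mul, intervalIntegral.integral_const_mul]
    ring
  have i2 : ∫ θ in (-L)..L, G' (x - Y θ) * m₀ θ =
      (Real.exp x * (∫ θ in ξ..L, Real.exp (-Y θ) * m₀ θ) -
      Real.exp (-x) * ∫ θ in (-L)..ξ, Real.exp (Y θ) * m₀ θ) / 2 := by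
    rw [← intervalIntegral.integral_add_adjacent_intervals hG' hG'₂,
      intervalIntegral.integral_congr_ae eG', intervalIntegral.integral_congr_ae eG'₂,
      intervalIntegral.integral_neg,
      intervalIntegral.integral_congr_ae eG, intervalIntegral.integral_congr_ae eG₂,
      intervalIntegral.integral_const_mul, intervalIntegral.integral_const_mul]
    ring
  refine ⟨i1, i2, ?_⟩
  rw [i1, i2]
  have : Real.exp x * Real.exp (-x) = 1 := by rw [← Real.exp_add]; simp
  linear_combination (∫ θ in (-L)..ξ, Real.exp (Y θ) * m₀ θ) *
    (∫ θ in ξ..L, Real.exp (-Y θ) * m₀ θ) * this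

lemma uniqueDiffOn_timeIco (T : EReal) : UniqueDiffOn ℝ (timeIco T) := by
  have h : IsOpen {t : ℝ | (t : EReal) < T} :=
    isOpen_Iio.preimage continuous_coe_real_ereal
  exact (uniqueDiffOn_Ici 0).inter h

namespace CutoffFlow

variable {k : ℕ} {L : ℝ} {m₀ : ℝ → ℝ} (F : CutoffFlow k L m₀)

/-! ### The inverse of the flow map -/

lemma strictMono_X {t : ℝ} (ht : t ∈ F.J) : StrictMono fun ξ => F.X ξ t :=
  strictMono_of_hasDerivAt_pos (fun ξ => F.hasDerivAt_X ξ t) ht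

lemma monotone_X {t : ℝ} (ht : ∀ ξ, 0 ≤ F.Xd ξ t) : Monotone fun ξ => F.X ξ t :=
  monotone_of_hasDerivAt_nonneg (fun ξ => F.hasDerivAt_X ξ t) ht

lemma surjective_X (t : ℝ) : Function.Surjective fun ξ => F.X ξ t := by
  intro x
  by_cases hx : x ∈ Ioo (-L) L
  · have hL : -L ≤ L := by linarith [F.pos]
    obtain ⟨ξ, -, hξ⟩ := intermediate_value_Icc hL (continuous_left F.continuous_X t).continuousOn
      (show x ∈ Icc (F.X (-L) t) (F.X L t) by
        rw [F.X_neg_L, F.X_L]; exact Ioo_subset_Icc_self hx)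
    exact ⟨ξ, hξ⟩
  · exact ⟨x, F.X_eq_self hx t⟩

/-- The label of the particle that is at `x` at time `t`, the inverse of `X(·,t)` for `t ∈ J`. -/
def Ξ (x t : ℝ) : ℝ := Function.invFun (fun ξ => F.X ξ t) x

lemma X_Ξ (x t : ℝ) : F.X (F.Ξ x t) t = x := Function.rightInverse_invFun (F.surjective_X t) x

lemma Ξ_X {t : ℝ} (ht : t ∈ F.J) (ξ : ℝ) : F.Ξ (F.X ξ t) t = ξ :=
  Function.leftInverse_invFun (F.strictMono_X ht).injective ξ

lemma lt_Ξ_iff {t : ℝ} (ht : t ∈ F.J) {ξ x : ℝ} : ξ < F.Ξ x t ↔ F.X ξ t < x := by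
  rw [← (F.strictMono_X ht).lt_iff_lt]
  simp only [X_Ξ]

lemma Ξ_lt_iff {t : ℝ} (ht : t ∈ F.J) {ξ x : ℝ} : F.Ξ x t < ξ ↔ x < F.X ξ t := by
  rw [← (F.strictMono_X ht).lt_iff_lt]
  simp only [X_Ξ]

lemma Ξ_mem_Ioo_iff {t : ℝ} (ht : t ∈ F.J) {x : ℝ} : F.Ξ x t ∈ Ioo (-L) L ↔ x ∈ Ioo (-L) L := by
  rw [mem_Ioo, F.lt_Ξ_iff ht, F.Ξ_lt_iff ht, F.X_neg_L, F.X_L, mem_Ioo]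

lemma continuousOn_Ξ : ContinuousOn (uncurry F.Ξ) (univ ×ˢ F.J) := by
  rintro ⟨x, t⟩ ⟨-, ht⟩
  refine ContinuousAt.continuousWithinAt ?_
  refine tendsto_order.2 ⟨fun ξ hξ => ?_, fun ξ hξ => ?_⟩
  · have h1 : F.X ξ t < x := (F.lt_Ξ_iff ht).1 hξ
    have h2 : ContinuousAt (fun q : ℝ × ℝ => F.X ξ q.2) (x, t) :=
      ((continuous_right F.continuous_X ξ).comp continuous_snd).continuousAt
    filter_upwards [h2.eventually_lt continuousAt_fst h1,
      continuousAt_snd.preimage_mem_nhds (F.isOpen_J.mem_nhds ht)] with q hq hq2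
    exact (F.lt_Ξ_iff hq2).2 hq
  · have h1 : x < F.X ξ t := (F.Ξ_lt_iff ht).1 hξ
    have h2 : ContinuousAt (fun q : ℝ × ℝ => F.X ξ q.2) (x, t) :=
      ((continuous_right F.continuous_X ξ).comp continuous_snd).continuousAt
    filter_upwards [continuousAt_fst.eventually_lt h2 h1,
      continuousAt_snd.preimage_mem_nhds (F.isOpen_J.mem_nhds ht)] with q hq hq2
    exact (F.Ξ_lt_iff hq2).2 hq

lemma isOpen_univ_prod_J : IsOpen ((univ : Set ℝ) ×ˢ F.J) := isOpen_univ.prod F.isOpen_J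

lemma continuousAt_Ξ {x t : ℝ} (ht : t ∈ F.J) : ContinuousAt (uncurry F.Ξ) (x, t) :=
  F.continuousOn_Ξ.continuousAt (F.isOpen_univ_prod_J.mem_nhds ⟨mem_univ _, ht⟩)

lemma continuous_Ξ_left {t : ℝ} (ht : t ∈ F.J) : Continuous fun x => F.Ξ x t :=
  continuous_iff_continuousAt.2 fun x =>
    (F.continuousAt_Ξ ht).comp (f := fun y => (y, t)) (by fun_prop)

lemma hasDerivAt_Ξ {x t : ℝ} (ht : t ∈ F.J) :
    HasDerivAt (fun y => F.Ξ y t) (F.Xd (F.Ξ x t) t)⁻¹ x :=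
  HasDerivAt.of_local_left_inverse (F.continuous_Ξ_left ht).continuousAt
    (F.hasDerivAt_X (F.Ξ x t) t) (ht _).ne' (Eventually.of_forall fun y => F.X_Ξ y t)

lemma spaceC_Ξ : SpaceC F.J (k + 1) F.Ξ := by
  have key : ∀ j ≤ k + 1, SpaceC F.J j F.Ξ := by
    intro j
    induction j with
    | zero => exact fun _ => F.continuousOn_Ξ
    | succ j ih =>
      intro hj
      refine ⟨F.continuousOn_Ξ, _, ?_, fun t ht x => F.hasDerivAt_Ξ ht⟩
      exact (((F.spaceC_Xd.mono_set (subset_univ _)).mono (by omega)).comp (ih (by omega))).inv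
        fun t ht x => (ht _).ne'
  exact key _ le_rfl

/-- The time derivative of `Ξ`. -/
def Ξt (x t : ℝ) : ℝ := -F.V (F.Ξ x t) t / F.Xd (F.Ξ x t) t

lemma continuousOn_comp_Ξ {f : ℝ → ℝ → ℝ} (hf : Continuous (uncurry f)) :
    ContinuousOn (uncurry fun x t => f (F.Ξ x t) t) (univ ×ˢ F.J) :=
  hf.comp_continuousOn (F.continuousOn_Ξ.prodMk continuousOn_snd)

lemma continuousOn_Ξt : ContinuousOn (uncurry F.Ξt) (univ ×ˢ F.J) :=
  (F.continuousOn_comp_Ξ F.continuous_V).neg.div (F.continuousOn_comp_Ξ F.continuous_Xd)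
    fun _ hq => (hq.2 _).ne'

/-- The inverse of `(ξ, t) ↦ (X(ξ,t), t)` is differentiable, as the derivative
`(a, b) ↦ (X_ξ a + V b, b)` is invertible. -/
lemma hasDerivAt_Ξ_time {x t : ℝ} (ht : t ∈ F.J) :
    HasDerivAt (fun s => F.Ξ x s) (F.Ξt x t) t := by
  set ξ := F.Ξ x t with hξ
  set p := F.Xd ξ t with hp
  set v := F.V ξ t with hv
  have hp0 : p ≠ 0 := (ht ξ).ne'
  have hX := (hasStrictFDerivAt_of_partials (f := F.X) (p := (ξ, t)) univ_mem
    (fun q _ => F.hasDerivAt_X q.1 q.2) (fun q _ => F.hasDerivAt_X_time q.1 q.2)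
    F.continuous_Xd.continuousOn F.continuous_V.continuousOn).hasFDerivAt
  have hΦ := hX.prodMk (hasFDerivAt_snd (𝕜 := ℝ) (p := (ξ, t)))
  let e : (ℝ × ℝ) ≃L[ℝ] ℝ × ℝ := ContinuousLinearEquiv.equivOfInverse
    (((ContinuousLinearMap.toSpanSingleton ℝ p).coprod
      (ContinuousLinearMap.toSpanSingleton ℝ v)).prod (ContinuousLinearMap.snd ℝ ℝ ℝ))
    (((ContinuousLinearMap.toSpanSingleton ℝ p⁻¹).coprod
      (ContinuousLinearMap.toSpanSingleton ℝ (-v / p))).prod (ContinuousLinearMap.snd ℝ ℝ ℝ))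
    (fun q => by
      ext <;> simp
      field_simp
      ring)
    (fun q => by
      ext <;> simp
      field_simp
      ring)
  have hΨc : ContinuousAt (fun q : ℝ × ℝ => (F.Ξ q.1 q.2, q.2)) (x, t) :=
    (F.continuousAt_Ξ ht).prodMk continuousAt_snd
  have hΨ : HasFDerivAt (fun q : ℝ × ℝ => (F.Ξ q.1 q.2, q.2)) (e.symm : ℝ × ℝ →L[ℝ] ℝ × ℝ) (x, t) :=
    HasFDerivAt.of_local_left_inverse (f := fun q : ℝ × ℝ => (F.X q.1 q.2, q.2)) (f' := e) hΨc hΦ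
      (Eventually.of_forall fun q => by simp only [X_Ξ])
  have h2 := hΨ.comp_hasDerivAt (f := fun s => (x, s)) t
    ((hasDerivAt_const t x).prodMk (hasDerivAt_id t))
  have h3 := (hasFDerivAt_fst (𝕜 := ℝ) (p := (F.Ξ x t, t))).comp_hasDerivAt
    (f := fun s => (F.Ξ x s, s)) t h2
  refine h3.congr_deriv ?_
  simp [e, Ξt, ← hξ, ← hp, ← hv]

/-- The time derivative of `f(Ξ(x,t),t)`. -/
lemma hasDerivAt_comp_Ξ_time {f fx ft : ℝ → ℝ → ℝ} {x t : ℝ} (ht : t ∈ F.J)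
    (hx : ∀ s ∈ F.J, ∀ ξ, HasDerivAt (fun η => f η s) (fx ξ s) ξ)
    (hft : ∀ s ∈ F.J, ∀ ξ, HasDerivAt (fun s => f ξ s) (ft ξ s) s)
    (cx : ContinuousOn (uncurry fx) (univ ×ˢ F.J))
    (ct : ContinuousOn (uncurry ft) (univ ×ˢ F.J)) :
    HasDerivAt (fun s => f (F.Ξ x s) s)
      (fx (F.Ξ x t) t * F.Ξt x t + ft (F.Ξ x t) t) t :=
  hasDerivAt_along (S := univ ×ˢ F.J) (F.isOpen_univ_prod_J.mem_nhds ⟨mem_univ _, ht⟩)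
    (fun q hq => hx q.2 hq.2 q.1) (fun q hq => hft q.2 hq.2 q.1) cx ct (F.hasDerivAt_Ξ_time ht)

/-! ### The solution in Eulerian coordinates -/

/-- The density `m(x,t)`, in label form `m₀ / X_ξ`. -/
def m (x t : ℝ) : ℝ := m₀ (F.Ξ x t) / F.Xd (F.Ξ x t) t

/-- The solution `u(x,t)`. -/
def u (x t : ℝ) : ℝ :=
  (Real.exp x * F.B (F.Ξ x t) t + Real.exp (-x) * F.A (F.Ξ x t) t) / 2

/-- The derivative `u_x(x,t)`. -/
def ux (x t : ℝ) : ℝ :=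
  (Real.exp x * F.B (F.Ξ x t) t - Real.exp (-x) * F.A (F.Ξ x t) t) / 2

lemma X_mem_Icc {t : ℝ} (ht : Monotone fun ξ => F.X ξ t) {ξ : ℝ} (hξ : ξ ∈ Icc (-L) L) :
    F.X ξ t ∈ Icc (-L) L := by
  have h1 := ht hξ.1
  have h2 := ht hξ.2
  simp only [X_neg_L, X_L] at h1 h2
  exact ⟨h1, h2⟩

lemma Ep_mul {t : ℝ} (ht : Monotone fun ξ => F.X ξ t) (ξ : ℝ) :
    F.Ep (F.X ξ t) * m₀ ξ = Real.exp (F.X ξ t) * m₀ ξ := by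
  by_cases h : ξ ∈ Ioo (-L) L
  · rw [F.Ep_eq _ (F.X_mem_Icc ht (Ioo_subset_Icc_self h))]
  · simp [F.m₀_eq_zero h]

lemma Em_mul {t : ℝ} (ht : Monotone fun ξ => F.X ξ t) (ξ : ℝ) :
    F.Em (F.X ξ t) * m₀ ξ = Real.exp (-F.X ξ t) * m₀ ξ := by
  by_cases h : ξ ∈ Ioo (-L) L
  · rw [F.Em_eq _ (F.X_mem_Icc ht (Ioo_subset_Icc_self h))]
  · simp [F.m₀_eq_zero h]

lemma A_eq {t : ℝ} (ht : Monotone fun ξ => F.X ξ t) (ξ : ℝ) :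
    F.A ξ t = ∫ θ in (-L)..ξ, Real.exp (F.X θ t) * m₀ θ := by
  simp only [A, F.Ep_mul ht]

lemma B_eq {t : ℝ} (ht : Monotone fun ξ => F.X ξ t) (ξ : ℝ) :
    F.B ξ t = ∫ θ in ξ..L, Real.exp (-F.X θ t) * m₀ θ := by
  simp only [B, F.Em_mul ht]

lemma intervalIntegrable_G (x t a b : ℝ) :
    IntervalIntegrable (fun θ => G (x - F.X θ t) * m₀ θ) volume a b := by
  refine Continuous.intervalIntegrable ?_ a b
  exact (continuous_G.comp (continuous_const.sub (continuous_left F.continuous_X t))).mul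
    F.continuous_m₀

/-- The integrals defining `u`, `u_x` and the velocity, evaluated at an arbitrary point. -/
lemma kernel_split {t : ℝ} (ht : t ∈ F.J) (x : ℝ) :
    (∫ θ in (-L)..L, G (x - F.X θ t) * m₀ θ = F.u x t) ∧
    (∫ θ in (-L)..L, G' (x - F.X θ t) * m₀ θ = F.ux x t) ∧
    velocity L m₀ F.X x t = F.V (F.Ξ x t) t := by
  have hmono := (F.strictMono_X ht).monotone
  have h := integral_kernel_split (Y := fun θ => F.X θ t) (ξ := F.Ξ x t) (x := x)
    (F.intervalIntegrable_G x t _ _) (F.intervalIntegrable_G x t _ _)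
    (fun θ hθ hne hm => by
      have h1 : θ ∈ Ioo (-L) L := by by_contra h; exact hm (F.m₀_eq_zero h)
      rw [← F.lt_Ξ_iff ht]
      rcases mem_uIoc.1 hθ with h2 | h2
      · exact lt_of_le_of_ne h2.2 hne
      · exact absurd h1.1 (not_lt.2 h2.2))
    (fun θ hθ hne hm => by
      have h1 : θ ∈ Ioo (-L) L := by by_contra h; exact hm (F.m₀_eq_zero h)
      rw [← F.Ξ_lt_iff ht]
      rcases mem_uIoc.1 hθ with h2 | h2
      · exact h2.1
      · exact absurd h1.2 (not_lt.2 h2.1.le))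
  rw [← F.A_eq hmono, ← F.B_eq hmono] at h
  exact h

lemma u_eq_integral {t : ℝ} (ht : t ∈ F.J) (x : ℝ) :
    F.u x t = ∫ θ in (-L)..L, G (x - F.X θ t) * m₀ θ := (F.kernel_split ht x).1.symm

lemma ux_eq_integral {t : ℝ} (ht : t ∈ F.J) (x : ℝ) :
    F.ux x t = ∫ θ in (-L)..L, G' (x - F.X θ t) * m₀ θ := (F.kernel_split ht x).2.1.symm

lemma velocity_eq {t : ℝ} (ht : t ∈ F.J) (ξ : ℝ) :
    velocity L m₀ F.X (F.X ξ t) t = F.V ξ t := by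
  rw [(F.kernel_split ht _).2.2, F.Ξ_X ht]

lemma u_sq_sub {t : ℝ} (x : ℝ) : F.u x t ^ 2 - F.ux x t ^ 2 = F.V (F.Ξ x t) t := by
  have : Real.exp x * Real.exp (-x) = 1 := by rw [← Real.exp_add]; simp
  simp only [u, ux, V]
  linear_combination F.A (F.Ξ x t) t * F.B (F.Ξ x t) t * this

lemma m_X {t : ℝ} (ht : t ∈ F.J) (ξ : ℝ) : F.m (F.X ξ t) t = m₀ ξ / F.Xd ξ t := by
  rw [m, F.Ξ_X ht]

lemma hasDerivAt_A_comp_Ξ {t : ℝ} (ht : t ∈ F.J) (x : ℝ) :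
    HasDerivAt (fun y => F.A (F.Ξ y t) t) (Real.exp x * F.m x t) x := by
  have h := HasDerivAt.comp (h₂ := fun ξ => F.A ξ t) x (F.hasDerivAt_A (F.Ξ x t) t)
    (F.hasDerivAt_Ξ (x := x) ht)
  refine h.congr_deriv ?_
  rw [F.Ep_mul (F.strictMono_X ht).monotone, X_Ξ, m]
  ring

lemma hasDerivAt_B_comp_Ξ {t : ℝ} (ht : t ∈ F.J) (x : ℝ) :
    HasDerivAt (fun y => F.B (F.Ξ y t) t) (-(Real.exp (-x) * F.m x t)) x := by
  have h := HasDerivAt.comp (h₂ := fun ξ => F.B ξ t) x (F.hasDerivAt_B (F.Ξ x t) t)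
    (F.hasDerivAt_Ξ (x := x) ht)
  refine h.congr_deriv ?_
  rw [F.Em_mul (F.strictMono_X ht).monotone, X_Ξ, m]
  ring

lemma hasDerivAt_exp_neg (x : ℝ) : HasDerivAt (fun y => Real.exp (-y)) (-Real.exp (-x)) x := by
  simpa using (hasDerivAt_neg x).exp

lemma hasDerivAt_u {t : ℝ} (ht : t ∈ F.J) (x : ℝ) :
    HasDerivAt (fun y => F.u y t) (F.ux x t) x := by
  have h := (((Real.hasDerivAt_exp x).mul (F.hasDerivAt_B_comp_Ξ ht x)).add
    ((hasDerivAt_exp_neg x).mul (F.hasDerivAt_A_comp_Ξ ht x))).div_const 2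
  refine h.congr_deriv ?_
  simp only [ux]
  ring

lemma hasDerivAt_ux {t : ℝ} (ht : t ∈ F.J) (x : ℝ) :
    HasDerivAt (fun y => F.ux y t) (F.u x t - F.m x t) x := by
  have h := (((Real.hasDerivAt_exp x).mul (F.hasDerivAt_B_comp_Ξ ht x)).sub
    ((hasDerivAt_exp_neg x).mul (F.hasDerivAt_A_comp_Ξ ht x))).div_const 2
  refine h.congr_deriv ?_
  have : Real.exp x * Real.exp (-x) = 1 := by rw [← Real.exp_add]; simp
  simp only [u]
  linear_combination -F.m x t * this

lemma dx_u {t : ℝ} (ht : t ∈ F.J) (x : ℝ) : dx F.u x t = F.ux x t := (F.hasDerivAt_u ht x).deriv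

/-- `2 u_x(X(ξ,t),t) = g(ξ,t)` for the labels in `[-L, L]`. -/
lemma ux_X {t : ℝ} (ht : t ∈ F.J) {ξ : ℝ} (hξ : ξ ∈ Icc (-L) L) :
    F.ux (F.X ξ t) t = F.g ξ t / 2 := by
  have hm := F.X_mem_Icc (F.strictMono_X ht).monotone hξ
  rw [ux, F.Ξ_X ht, g, F.Ep_eq _ hm, F.Em_eq _ hm]

lemma spaceC_comp_Ξ {j : ℕ} {f : ℝ → ℝ → ℝ} (hf : SpaceC univ j f) (hj : j ≤ k + 1) :
    SpaceC F.J j fun x t => f (F.Ξ x t) t :=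
  (hf.mono_set (subset_univ _)).comp (F.spaceC_Ξ.mono hj)

lemma spaceC_m : SpaceC F.J k F.m :=
  (F.spaceC_comp_Ξ (SpaceC.of_contDiff F.smooth) k.le_succ).div
    (F.spaceC_comp_Ξ F.spaceC_Xd k.le_succ) fun _ ht _ => (ht _).ne'

lemma spaceC_exp (I : Set ℝ) (j : ℕ) : SpaceC I j fun x _ => Real.exp x :=
  SpaceC.of_contDiff Real.contDiff_exp

lemma spaceC_exp_neg (I : Set ℝ) (j : ℕ) : SpaceC I j fun x _ => Real.exp (-x) :=
  SpaceC.of_contDiff (Real.contDiff_exp.comp contDiff_neg)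

lemma spaceC_half (I : Set ℝ) {j : ℕ} {f : ℝ → ℝ → ℝ} (hf : SpaceC I j f) :
    SpaceC I j fun x t => f x t / 2 :=
  ((SpaceC.const (1 / 2)).mul hf).congr fun _ _ _ => by ring

lemma spaceC_ux : SpaceC F.J (k + 1) F.ux :=
  spaceC_half _ (((spaceC_exp _ _).mul (F.spaceC_comp_Ξ F.spaceC_B le_rfl)).sub
    ((spaceC_exp_neg _ _).mul (F.spaceC_comp_Ξ F.spaceC_A le_rfl)))

lemma continuousOn_u : ContinuousOn (uncurry F.u) (univ ×ˢ F.J) :=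
  SpaceC.continuousOn (j := k + 1) (spaceC_half _
    (((spaceC_exp _ _).mul (F.spaceC_comp_Ξ F.spaceC_B le_rfl)).add
    ((spaceC_exp_neg _ _).mul (F.spaceC_comp_Ξ F.spaceC_A le_rfl))))

lemma spaceC_u : SpaceC F.J (k + 2) F.u :=
  ⟨F.continuousOn_u, _, F.spaceC_ux, fun _ ht x => F.hasDerivAt_u ht x⟩

/-- The time derivative of `A(Ξ(x,t),t)`. -/
def dA (x t : ℝ) : ℝ :=
  F.Ep (F.X (F.Ξ x t) t) * m₀ (F.Ξ x t) * F.Ξt x t + F.At (F.Ξ x t) t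

/-- The time derivative of `B(Ξ(x,t),t)`. -/
def dB (x t : ℝ) : ℝ :=
  -(F.Em (F.X (F.Ξ x t) t) * m₀ (F.Ξ x t)) * F.Ξt x t + F.Bt (F.Ξ x t) t

lemma continuous_Ep_mul : Continuous (uncurry fun ξ t => F.Ep (F.X ξ t) * m₀ ξ) :=
  (F.smooth_Ep.continuous.comp F.continuous_X).mul (F.continuous_m₀.comp continuous_fst)

lemma continuous_Em_mul : Continuous (uncurry fun ξ t => -(F.Em (F.X ξ t) * m₀ ξ)) :=
  ((F.smooth_Em.continuous.comp F.continuous_X).mul (F.continuous_m₀.comp continuous_fst)).neg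

/-- The time derivative of `u`. -/
def ut (x t : ℝ) : ℝ := (Real.exp x * F.dB x t + Real.exp (-x) * F.dA x t) / 2

lemma continuousOn_ut : ContinuousOn (uncurry F.ut) (univ ×ˢ F.J) := by
  have ha : ContinuousOn (uncurry F.dA) (univ ×ˢ F.J) :=
    ((F.continuousOn_comp_Ξ F.continuous_Ep_mul).mul F.continuousOn_Ξt).add
      (F.continuousOn_comp_Ξ F.continuous_At)
  have hb : ContinuousOn (uncurry F.dB) (univ ×ˢ F.J) :=
    ((F.continuousOn_comp_Ξ F.continuous_Em_mul).mul F.continuousOn_Ξt).add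
      (F.continuousOn_comp_Ξ F.continuous_Bt)
  exact ((((Real.continuous_exp.comp continuous_fst).continuousOn).mul hb).add
    (((Real.continuous_exp.comp continuous_neg).comp continuous_fst).continuousOn.mul
      ha)).div_const 2

lemma hasDerivAt_u_time {t : ℝ} (ht : t ∈ F.J) (x : ℝ) :
    HasDerivAt (fun s => F.u x s) (F.ut x t) t := by
  have ha : HasDerivAt (fun s => F.A (F.Ξ x s) s) (F.dA x t) t :=
    F.hasDerivAt_comp_Ξ_time ht (fun s _ ξ => F.hasDerivAt_A ξ s)
      (fun s _ ξ => F.hasDerivAt_A_time ξ s) F.continuous_Ep_mul.continuousOn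
      F.continuous_At.continuousOn
  have hb : HasDerivAt (fun s => F.B (F.Ξ x s) s) (F.dB x t) t :=
    F.hasDerivAt_comp_Ξ_time ht (fun s _ ξ => F.hasDerivAt_B ξ s)
      (fun s _ ξ => F.hasDerivAt_B_time ξ s) F.continuous_Em_mul.continuousOn
      F.continuous_Bt.continuousOn
  exact ((hb.const_mul (Real.exp x)).add (ha.const_mul (Real.exp (-x)))).div_const 2

/-- The label form `m₀ / X_ξ` of `m`. -/
def N (ξ t : ℝ) : ℝ := m₀ ξ / F.Xd ξ t

/-- The label derivative of `N`. -/
def Nξ (ξ t : ℝ) : ℝ := deriv (fun η => F.N η t) ξ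

/-- The time derivative of `N`. -/
def Nt (ξ t : ℝ) : ℝ := -(m₀ ξ * (m₀ ξ * F.g ξ t)) / F.Xd ξ t ^ 2

lemma spaceC_N : SpaceC F.J k F.N :=
  (SpaceC.of_contDiff F.smooth).div (F.spaceC_Xd.mono_set (subset_univ _)) fun _ ht _ => (ht _).ne'

lemma hasDerivAt_N {t : ℝ} (ht : t ∈ F.J) (ξ : ℝ) :
    HasDerivAt (fun η => F.N η t) (F.Nξ ξ t) ξ :=
  (((F.spaceC_N.mono F.one_le).contDiff ht).differentiable (by simp) ξ).hasDerivAt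

lemma continuousOn_Nξ : ContinuousOn (uncurry F.Nξ) (univ ×ˢ F.J) :=
  SpaceC.continuousOn (j := 0) ((F.spaceC_N.mono F.one_le).of_deriv
    fun _ ht ξ => F.hasDerivAt_N ht ξ)

lemma hasDerivAt_N_time {t : ℝ} (ht : t ∈ F.J) (ξ : ℝ) :
    HasDerivAt (fun s => F.N ξ s) (F.Nt ξ t) t := by
  refine ((hasDerivAt_const t (m₀ ξ)).div (F.hasDerivAt_Xd_time ξ t) (ht ξ).ne').congr_deriv ?_
  simp [Nt]

lemma continuousOn_Nt : ContinuousOn (uncurry F.Nt) (univ ×ˢ F.J) :=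
  (((F.continuous_m₀.comp continuous_fst).mul F.continuous_m₀_mul_g).neg.continuousOn).div
    (F.continuous_Xd.continuousOn.pow 2) fun _ hq => pow_ne_zero 2 (hq.2 _).ne'

/-- The time derivative of `m`. -/
def mt (x t : ℝ) : ℝ := F.Nξ (F.Ξ x t) t * F.Ξt x t + F.Nt (F.Ξ x t) t

lemma continuousOn_mt : ContinuousOn (uncurry F.mt) (univ ×ˢ F.J) := by
  have hΞ : ContinuousOn (fun q : ℝ × ℝ => (F.Ξ q.1 q.2, q.2)) (univ ×ˢ F.J) :=
    F.continuousOn_Ξ.prodMk continuousOn_snd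
  have hmaps : MapsTo (fun q : ℝ × ℝ => (F.Ξ q.1 q.2, q.2)) (univ ×ˢ F.J) (univ ×ˢ F.J) :=
    fun q hq => ⟨mem_univ _, hq.2⟩
  exact ((F.continuousOn_Nξ.comp hΞ hmaps).mul F.continuousOn_Ξt).add
    (F.continuousOn_Nt.comp hΞ hmaps)

lemma hasDerivAt_m_time {t : ℝ} (ht : t ∈ F.J) (x : ℝ) :
    HasDerivAt (fun s => F.m x s) (F.mt x t) t :=
  F.hasDerivAt_comp_Ξ_time ht (fun _ hs ξ => F.hasDerivAt_N hs ξ)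
    (fun _ hs ξ => F.hasDerivAt_N_time hs ξ) F.continuousOn_Nξ F.continuousOn_Nt

/-- The conservation law `m_t + [(u² - u_x²) m]_x = 0`; in label form it is `(m X_ξ)_t = 0`. -/
lemma hasDerivAt_flux {t : ℝ} (ht : t ∈ F.J) (x : ℝ) :
    HasDerivAt (fun y => (F.u y t ^ 2 - F.ux y t ^ 2) * F.m y t) (-F.mt x t) x := by
  have h := ((F.hasDerivAt_V (F.Ξ x t) t).mul (F.hasDerivAt_N ht (F.Ξ x t)))
  have h2 := HasDerivAt.comp (h₂ := fun ξ => F.V ξ t * F.N ξ t) x h (F.hasDerivAt_Ξ (x := x) ht)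
  have h3 : (fun y => (F.u y t ^ 2 - F.ux y t ^ 2) * F.m y t) =
      (fun ξ => F.V ξ t * F.N ξ t) ∘ fun y => F.Ξ y t := by
    funext y
    simp only [u_sq_sub, Function.comp_apply, m, N]
  rw [h3]
  refine h2.congr_deriv ?_
  have := (ht (F.Ξ x t)).ne'
  simp only [mt, Ξt, Nt, N]
  field_simp
  ring

lemma abs_u_le {t : ℝ} (ht : t ∈ F.J) (x : ℝ) :
    |F.u x t| ≤ (∫ θ, |m₀ θ|) / 2 := by
  rw [F.u_eq_integral ht]
  refine (abs_intervalIntegral_le F.integrable_m₀ fun θ => abs_G_le _).trans (le_of_eq ?_)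
  ring

lemma abs_G'_le (x : ℝ) : |G' x| ≤ 1 / 2 := by
  rcases lt_trichotomy x 0 with h | h | h
  · rw [G'_of_neg h]; exact abs_G_le x
  · simp [h, G']
  · rw [G'_of_pos h, abs_neg]; exact abs_G_le x

lemma abs_ux_le {t : ℝ} (ht : t ∈ F.J) (x : ℝ) :
    |F.ux x t| ≤ (∫ θ, |m₀ θ|) / 2 := by
  rw [F.ux_eq_integral ht]
  refine (abs_intervalIntegral_le F.integrable_m₀ fun θ => abs_G'_le _).trans (le_of_eq ?_)
  ring

lemma isClassicalSolution {T : EReal} (hJ : timeIco T ⊆ F.J) :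
    IsClassicalSolution k m₀ T F.u F.m where
  regular_u := F.spaceC_u.memC hJ uniqueDiffOn_univ (uniqueDiffOn_timeIco T)
    (fun _ ht x => F.hasDerivAt_u_time ht x) F.continuousOn_ut
  regular_m := F.spaceC_m.memC hJ uniqueDiffOn_univ (uniqueDiffOn_timeIco T)
    (fun _ ht x => F.hasDerivAt_m_time ht x) F.continuousOn_mt
  helmholtz x t ht := by
    have h : dx (dx F.u) x t = F.u x t - F.m x t := by
      have h1 : (fun y => dx F.u y t) = fun y => F.ux y t := funext fun y => F.dx_u (hJ ht) y
      rw [dx, h1]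
      exact (F.hasDerivAt_ux (hJ ht) x).deriv
    rw [h]
    ring
  bounded T' hT' := by
    refine ⟨(∫ θ, |m₀ θ|) / 2, fun x t ht => ?_⟩
    have hJt : t ∈ F.J := hJ ⟨ht.1, lt_of_le_of_lt (by exact_mod_cast ht.2) hT'.2⟩
    exact ⟨F.abs_u_le hJt x, by rw [F.dx_u hJt]; exact F.abs_ux_le hJt x⟩
  pde x t ht _ := by
    have h1 : (fun y => (F.u y t ^ 2 - dx F.u y t ^ 2) * F.m y t) =
        fun y => (F.u y t ^ 2 - F.ux y t ^ 2) * F.m y t :=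
      funext fun y => by rw [F.dx_u (hJ ht)]
    rw [(F.hasDerivAt_m_time (hJ ht) x).deriv, dx, h1, (F.hasDerivAt_flux (hJ ht) x).deriv]
    ring
  initial x := by
    have h : F.Ξ x 0 = x := by
      have := F.X_Ξ x 0
      rwa [F.init] at this
    rw [m, h, F.Xd_zero, div_one]

lemma isLagrangeSolution {T : EReal} (hJ : timeIco T ⊆ F.J) :
    IsLagrangeSolution k L m₀ T F.X where
  regular := F.spaceC_X.memC (subset_univ _) (uniqueDiffOn_Icc (by linarith [F.pos]))
    (uniqueDiffOn_timeIco T) (fun t _ ξ => F.hasDerivAt_X_time ξ t) F.continuous_V.continuousOn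
  initial ξ _ := F.init ξ
  ode ξ _ t ht := by
    rw [F.velocity_eq (hJ ht)]
    exact (F.hasDerivAt_X_time ξ t).hasDerivWithinAt

lemma memC_Icc {T : ℝ} (hT : 0 < T) : MemC (k + 1) 1 (Icc (-L) L) (Icc 0 T) F.X :=
  F.spaceC_X.memC (subset_univ _) (uniqueDiffOn_Icc (by linarith [F.pos]))
    (uniqueDiffOn_Icc hT) (fun t _ ξ => F.hasDerivAt_X_time ξ t) F.continuous_V.continuousOn

lemma tsupport_m {t : ℝ} (ht : t ∈ F.J) : tsupport (fun x => F.m x t) ⊆ Ioo (-L) L := by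
  have h1 : tsupport (fun x => F.m x t) ⊆ (fun x => F.Ξ x t) ⁻¹' tsupport m₀ := by
    refine closure_minimal (fun x hx => subset_tsupport m₀ fun h => hx ?_)
      ((isClosed_tsupport m₀).preimage (F.continuous_Ξ_left ht))
    simp [m, h]
  exact fun x hx => (F.Ξ_mem_Ioo_iff ht).1 (F.supp (h1 hx))

include F in
lemma integral_mul_m₀ (f : ℝ → ℝ) : ∫ θ, f θ * m₀ θ = ∫ θ in (-L)..L, f θ * m₀ θ := by
  rw [intervalIntegral.integral_of_le (by linarith [F.pos])]
  refine (setIntegral_eq_integral_of_forall_compl_eq_zero fun θ hθ => ?_).symm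
  rw [F.m₀_eq_zero fun h => hθ (Ioo_subset_Ioc_self h), mul_zero]

/-- The representation `m = ∫ δ(x - X(θ,t)) m₀(θ) dθ`, by the change of variables `x = X(ξ,t)`. -/
lemma integral_mul_m {t : ℝ} (ht : t ∈ F.J) (φ : ℝ → ℝ) :
    ∫ x, φ x * F.m x t = ∫ θ in (-L)..L, φ (F.X θ t) * m₀ θ := by
  have h := integral_image_eq_integral_abs_deriv_smul (s := univ) MeasurableSet.univ
    (fun ξ _ => (F.hasDerivAt_X ξ t).hasDerivWithinAt) (F.strictMono_X ht).injective.injOn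
    (fun x => φ x * F.m x t)
  rw [image_univ, (F.surjective_X t).range_eq, setIntegral_univ, setIntegral_univ] at h
  rw [h, ← F.integral_mul_m₀]
  refine integral_congr_ae (Eventually.of_forall fun ξ => ?_)
  have := ht ξ
  simp only [smul_eq_mul, abs_of_pos this, F.m_X ht]
  field_simp

end CutoffFlow

/-! ### Uniqueness for the Lagrange dynamics -/

namespace MemC

variable {k n : ℕ} {D I : Set ℝ} {f : ℝ → ℝ → ℝ}

lemma continuousOn (hf : MemC k n D I f) : ContinuousOn (uncurry f) (D ×ˢ I) := by
  simpa using! hf.space_cont 0 (Nat.zero_le _)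

lemma continuousOn_derivWithin (hf : MemC k n D I f) (hk : 1 ≤ k) :
    ContinuousOn (fun q : ℝ × ℝ => derivWithin (fun x => f x q.2) D q.1) (D ×ˢ I) := by
  simpa only [iteratedDerivWithin_one] using! hf.space_cont 1 hk

end MemC

lemma timeIco_mem_nhds {T : EReal} {s t : ℝ} (ht : t ∈ timeIco T) (hs : s ∈ Ioc 0 t) :
    timeIco T ∈ 𝓝 s := by
  have h : IsOpen {t : ℝ | (t : EReal) < T} := isOpen_Iio.preimage continuous_coe_real_ereal
  filter_upwards [Ioi_mem_nhds hs.1,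
    h.mem_nhds (show (s : EReal) < T from lt_of_le_of_lt (by exact_mod_cast hs.2) ht.2)]
    with r h1 h2
  exact ⟨le_of_lt h1, h2⟩

lemma Icc_subset_timeIco {T : EReal} {t : ℝ} (ht : t ∈ timeIco T) : Icc 0 t ⊆ timeIco T :=
  fun _ hs => ⟨hs.1, lt_of_le_of_lt (by exact_mod_cast hs.2) ht.2⟩

namespace CutoffFlow

variable {k : ℕ} {L : ℝ} {m₀ : ℝ → ℝ} (F : CutoffFlow k L m₀)

/-- The velocity of a label, for an arbitrary increasing configuration. -/
lemma velocity_of_strictMonoOn {Y : ℝ → ℝ → ℝ} {t : ℝ} (hm : Continuous m₀)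
    (hm₀ : ∀ θ, m₀ θ ≠ 0 → θ ∈ Icc (-L) L) (hY : ContinuousOn (fun ξ => Y ξ t) (Icc (-L) L))
    (hmono : StrictMonoOn (fun ξ => Y ξ t) (Icc (-L) L)) {ξ : ℝ} (hξ : ξ ∈ Icc (-L) L) :
    velocity L m₀ Y (Y ξ t) t =
      (∫ θ in (-L)..ξ, Real.exp (Y θ t) * m₀ θ) * ∫ θ in ξ..L, Real.exp (-Y θ t) * m₀ θ := by
  have hc : ContinuousOn (fun θ => G (Y ξ t - Y θ t) * m₀ θ) (Icc (-L) L) :=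
    (continuous_G.comp_continuousOn (continuousOn_const.sub hY)).mul hm.continuousOn
  refine (integral_kernel_split (ContinuousOn.intervalIntegrable (hc.mono ?_))
    (ContinuousOn.intervalIntegrable (hc.mono ?_)) (fun θ hθ hne hmθ => ?_)
    (fun θ hθ hne hmθ => ?_)).2.2
  · rw [uIcc_of_le hξ.1]; exact Icc_subset_Icc_right hξ.2
  · rw [uIcc_of_le hξ.2]; exact Icc_subset_Icc_left hξ.1
  · rw [uIoc_of_le hξ.1] at hθ
    exact hmono (hm₀ θ hmθ) hξ (lt_of_le_of_ne hθ.2 hne)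
  · rw [uIoc_of_le hξ.2] at hθ
    exact hmono hξ (hm₀ θ hmθ) hθ.1

include F in
lemma mem_Icc_of_ne_zero {θ : ℝ} (h : m₀ θ ≠ 0) : θ ∈ Icc (-L) L := by
  by_contra h'
  exact h (F.m₀_eq_zero fun h2 => h' (Ioo_subset_Icc_self h2))

/-- As long as a solution of the Lagrange dynamics is increasing in the label, it solves the
cut-off dynamics, whose solution is unique. -/
lemma eq_of_strictMonoOn {Y : ℝ → ℝ → ℝ} {τ : ℝ}
    (hc : ContinuousOn (uncurry Y) (Icc (-L) L ×ˢ Icc 0 τ))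
    (hmono : ∀ t ∈ Icc 0 τ, StrictMonoOn (fun ξ => Y ξ t) (Icc (-L) L))
    (h0 : ∀ ξ ∈ Icc (-L) L, Y ξ 0 = ξ)
    (hd : ∀ ξ ∈ Icc (-L) L, ∀ t ∈ Ioo 0 τ,
      HasDerivAt (fun s => Y ξ s) (velocity L m₀ Y (Y ξ t) t) t) :
    ∀ ξ ∈ Icc (-L) L, ∀ t ∈ Icc 0 τ, Y ξ t = F.X ξ t := by
  have hLL : -L ≤ L := by linarith [F.pos]
  have hcs : ∀ t ∈ Icc 0 τ, ContinuousOn (fun ξ => Y ξ t) (Icc (-L) L) := fun t ht =>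
    hc.comp (f := fun ξ => (ξ, t)) (by fun_prop) fun ξ hξ => ⟨hξ, ht⟩
  have hct : ∀ ξ ∈ Icc (-L) L, ContinuousOn (fun t => Y ξ t) (Icc 0 τ) := fun ξ hξ =>
    hc.comp (f := fun t => (ξ, t)) (by fun_prop) fun t ht => ⟨hξ, ht⟩
  have hvel : ∀ ξ ∈ Icc (-L) L, ∀ t ∈ Icc 0 τ, velocity L m₀ Y (Y ξ t) t =
      (∫ θ in (-L)..ξ, Real.exp (Y θ t) * m₀ θ) * ∫ θ in ξ..L, Real.exp (-Y θ t) * m₀ θ :=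
    fun ξ hξ t ht => velocity_of_strictMonoOn F.continuous_m₀
      (fun θ hθ => F.mem_Icc_of_ne_zero hθ) (hcs t ht) (hmono t ht) hξ
  -- The end points do not move, so that `Y` stays in `[-L, L]`.
  have hend : ∀ ξ ∈ Icc (-L) L, (ξ = -L ∨ ξ = L) → ∀ t ∈ Icc 0 τ, Y ξ t = ξ := by
    intro ξ hξ hor t ht
    have := abs_le_of_deriv_le_exp (f := fun t => Y ξ t - ξ) (C := 0) (Q := 0)
      ((hct ξ hξ).sub continuousOn_const) (by simp [h0 ξ hξ])
      (fun t ht => (hd ξ hξ t ht).sub_const ξ)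
      (fun t ht => by
        rw [hvel ξ hξ t (Ioo_subset_Icc_self ht)]
        rcases hor with rfl | rfl <;> simp) t ht
    simp only [zero_div, zero_mul] at this
    linarith [abs_eq_zero.1 (le_antisymm this (abs_nonneg _))]
  have hmem : ∀ ξ ∈ Icc (-L) L, ∀ t ∈ Icc 0 τ, Y ξ t ∈ Icc (-L) L := by
    intro ξ hξ t ht
    have h1 := (hmono t ht).monotoneOn (left_mem_Icc.2 hLL) hξ hξ.1
    have h2 := (hmono t ht).monotoneOn hξ (right_mem_Icc.2 hLL) hξ.2
    simp only [hend _ (left_mem_Icc.2 hLL) (Or.inl rfl) t ht,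
      hend _ (right_mem_Icc.2 hLL) (Or.inr rfl) t ht] at h1 h2
    exact ⟨h1, h2⟩
  obtain ⟨C₁, hC₁, hb₁, hl₁⟩ := exists_bound_lipschitz F.smooth_Ep F.compact_Ep
  obtain ⟨C₂, hC₂, hb₂, hl₂⟩ := exists_bound_lipschitz F.smooth_Em F.compact_Em
  set M₁ := ∫ θ, |m₀ θ|
  have hM₁ : 0 ≤ M₁ := integral_nonneg fun θ => abs_nonneg _
  have hvel' : ∀ ξ ∈ Icc (-L) L, ∀ t ∈ Icc 0 τ, velocity L m₀ Y (Y ξ t) t =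
      (∫ θ in (-L)..ξ, F.Ep (Y θ t) * m₀ θ) * ∫ θ in ξ..L, F.Em (Y θ t) * m₀ θ := by
    intro ξ hξ t ht
    rw [hvel ξ hξ t ht]
    have e : ∀ θ, Real.exp (Y θ t) * m₀ θ = F.Ep (Y θ t) * m₀ θ ∧
        Real.exp (-Y θ t) * m₀ θ = F.Em (Y θ t) * m₀ θ := fun θ => by
      by_cases hθ : m₀ θ = 0
      · simp [hθ]
      · have := hmem θ (F.mem_Icc_of_ne_zero hθ) t ht
        rw [F.Ep_eq _ this, F.Em_eq _ this]
        exact ⟨rfl, rfl⟩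
    simp only [fun θ => (e θ).1, fun θ => (e θ).2]
  have hdiff : ∀ (h : ℝ → ℝ) (C Q : ℝ), Continuous h → 0 ≤ C → (∀ x y, |h x - h y| ≤ C * |x - y|) →
      ∀ t ∈ Icc 0 τ, (∀ ξ ∈ Icc (-L) L, |Y ξ t - F.X ξ t| ≤ Q) →
      ∀ a ∈ Icc (-L) L, ∀ b ∈ Icc (-L) L,
      |(∫ θ in a..b, h (Y θ t) * m₀ θ) - ∫ θ in a..b, h (F.X θ t) * m₀ θ| ≤ C * Q * M₁ := by
    intro h C Q hh hC hl t ht hQ a ha b hb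
    rw [← intervalIntegral.integral_sub]
    · simp_rw [← sub_mul]
      refine abs_intervalIntegral_le_of_ne_zero F.integrable_m₀ fun θ hθ => (hl _ _).trans ?_
      exact mul_le_mul_of_nonneg_left (hQ θ (F.mem_Icc_of_ne_zero hθ)) hC
    · refine ContinuousOn.intervalIntegrable ?_
      exact ((hh.comp_continuousOn (hcs t ht)).mul F.continuous_m₀.continuousOn).mono
        (uIcc_subset_Icc ha hb)
    · exact ((hh.comp (continuous_left F.continuous_X t)).mul
        F.continuous_m₀).intervalIntegrable _ _
  have hbdd : ∃ K, ∀ ξ ∈ Icc (-L) L, ∀ t ∈ Icc 0 τ, |Y ξ t - F.X ξ t| ≤ K := by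
    obtain ⟨K, hK⟩ := (isCompact_Icc.prod isCompact_Icc).exists_bound_of_continuousOn
      (hc.sub F.continuous_X.continuousOn)
    exact ⟨K, fun ξ hξ t ht => hK (ξ, t) ⟨hξ, ht⟩⟩
  have hzero := eq_zero_of_weighted_bound (C := 2 * C₁ * C₂ * M₁ ^ 2 + 1) (s := Icc (-L) L)
    (D := fun ξ t => Y ξ t - F.X ξ t) (τ := τ) (by positivity) hbdd ?_
  · exact fun ξ hξ t ht => sub_eq_zero.1 (hzero ξ hξ t ht)
  intro Q hQ hQb ξ hξ
  refine abs_le_of_deriv_le_exp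
    ((hct ξ hξ).sub (continuous_right F.continuous_X ξ).continuousOn)
    (by simp [h0 ξ hξ, F.init]) (fun t ht => (hd ξ hξ t ht).sub (F.hasDerivAt_X_time ξ t))
    fun t ht => ?_
  have ht' := Ioo_subset_Icc_self ht
  rw [hvel' ξ hξ t ht', V, A, B]
  set q := Q * Real.exp (2 * (2 * C₁ * C₂ * M₁ ^ 2 + 1) * t)
  have hq : 0 ≤ q := by positivity
  have hqb : ∀ ξ ∈ Icc (-L) L, |Y ξ t - F.X ξ t| ≤ q := fun ξ hξ => hQb ξ hξ t ht'
  have e1 := hdiff F.Ep C₁ q F.smooth_Ep.continuous hC₁ hl₁ t ht' hqb (-L) (left_mem_Icc.2 hLL) ξ hξ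
  have e2 := hdiff F.Em C₂ q F.smooth_Em.continuous hC₂ hl₂ t ht' hqb ξ hξ L (right_mem_Icc.2 hLL)
  have e3 : |∫ θ in ξ..L, F.Em (Y θ t) * m₀ θ| ≤ C₂ * M₁ :=
    abs_intervalIntegral_le F.integrable_m₀ fun θ => hb₂ _
  have e4 : |∫ θ in (-L)..ξ, F.Ep (F.X θ t) * m₀ θ| ≤ C₁ * M₁ :=
    abs_intervalIntegral_le F.integrable_m₀ fun θ => hb₁ _
  set a := ∫ θ in (-L)..ξ, F.Ep (Y θ t) * m₀ θ
  set b := ∫ θ in ξ..L, F.Em (Y θ t) * m₀ θ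
  set a' := ∫ θ in (-L)..ξ, F.Ep (F.X θ t) * m₀ θ
  set b' := ∫ θ in ξ..L, F.Em (F.X θ t) * m₀ θ
  calc |a * b - a' * b'| = |(a - a') * b + a' * (b - b')| := by ring_nf
    _ ≤ |a - a'| * |b| + |a'| * |b - b'| := by
        refine (abs_add_le _ _).trans ?_
        rw [abs_mul, abs_mul]
    _ ≤ (C₁ * q * M₁) * (C₂ * M₁) + (C₁ * M₁) * (C₂ * q * M₁) := by gcongr
    _ = 2 * C₁ * C₂ * M₁ ^ 2 * q := by ring
    _ ≤ (2 * C₁ * C₂ * M₁ ^ 2 + 1) * q := by nlinarith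

/-- Every solution of the Lagrange dynamics agrees with `X` as long as `X_ξ > 0`. At the first
time at which `Y_ξ` is not positive, `Y` would still agree with `X`. -/
theorem lagrange_unique {T : EReal} {Y : ℝ → ℝ → ℝ} (hY : IsLagrangeSolution k L m₀ T Y) {t : ℝ}
    (ht : t ∈ timeIco T) (hJ : ∀ s ∈ Ico 0 t, s ∈ F.J) :
    ∀ ξ ∈ Icc (-L) L, Y ξ t = F.X ξ t := by
  have hLL : -L < L := by linarith [F.pos]
  have hsub := Icc_subset_timeIco ht
  have hc : ContinuousOn (uncurry Y) (Icc (-L) L ×ˢ Icc 0 t) :=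
    hY.regular.continuousOn.mono (prod_mono_right hsub)
  have hct : ∀ ξ ∈ Icc (-L) L, ContinuousOn (fun t => Y ξ t) (Icc 0 t) := fun ξ hξ =>
    hc.comp (f := fun t => (ξ, t)) (by fun_prop) fun t ht => ⟨hξ, ht⟩
  have hstep : ∀ τ ∈ Icc 0 t, (∀ s ∈ Icc 0 τ, ∀ ξ ∈ Icc (-L) L, 0 < Xξ L Y ξ s) →
      ∀ ξ ∈ Icc (-L) L, ∀ s ∈ Icc 0 τ, Y ξ s = F.X ξ s := by
    intro τ hτ hpos
    have hsτ : Icc 0 τ ⊆ Icc 0 t := Icc_subset_Icc_right hτ.2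
    refine F.eq_of_strictMonoOn (hc.mono (prod_mono_right hsτ)) (fun s hs => ?_) hY.initial
      (fun ξ hξ s hs => (hY.ode ξ hξ s (hsub (hsτ (Ioo_subset_Icc_self hs)))).hasDerivAt
        (timeIco_mem_nhds ht ⟨hs.1, hs.2.le.trans hτ.2⟩))
    have hcd := hY.regular.space s (hsub (hsτ hs))
    refine strictMonoOn_of_hasDerivWithinAt_pos (convex_Icc _ _) hcd.continuousOn
      (f' := fun ξ => Xξ L Y ξ s) (fun ξ hξ => ?_) (fun ξ hξ => hpos s hs ξ (interior_subset hξ))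
    exact ((hcd.differentiableOn (by simp)) ξ (interior_subset hξ)).hasDerivWithinAt.mono
      interior_subset
  -- the times at which `Y_ξ` is not positive everywhere
  set E := {q : ℝ × ℝ | q ∈ Icc (-L) L ×ˢ Icc 0 t ∧ Xξ L Y q.1 q.2 ≤ 0} with hE
  have hcξ : ContinuousOn (fun q : ℝ × ℝ => Xξ L Y q.1 q.2) (Icc (-L) L ×ˢ Icc 0 t) :=
    (hY.regular.continuousOn_derivWithin (by omega)).mono (prod_mono_right hsub)
  have hEc : IsCompact E :=
    (isCompact_Icc.prod isCompact_Icc).of_isClosed_subset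
      (hcξ.preimage_isClosed_of_isClosed (isClosed_Icc.prod isClosed_Icc) isClosed_Iic)
      fun q hq => hq.1
  have hlim : ∀ τ ∈ Icc 0 t, (∀ s ∈ Ico 0 τ, ∀ ξ ∈ Icc (-L) L, 0 < Xξ L Y ξ s) →
      ∀ ξ ∈ Icc (-L) L, Y ξ τ = F.X ξ τ := by
    intro τ hτ hpos ξ hξ
    rcases hτ.1.eq_or_lt with h0 | h0
    · rw [← h0, hY.initial ξ hξ, F.init]
    · have h1 : Tendsto (fun s => Y ξ s) (𝓝[<] τ) (𝓝 (Y ξ τ)) := by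
        refine ((hct ξ hξ) τ hτ).mono_left ?_
        rw [← nhdsWithin_Ioo_eq_nhdsLT h0]
        exact nhdsWithin_mono _ fun s hs => ⟨hs.1.le, hs.2.le.trans hτ.2⟩
      have h2 : Tendsto (fun s => F.X ξ s) (𝓝[<] τ) (𝓝 (F.X ξ τ)) :=
        ((continuous_right F.continuous_X ξ).tendsto τ).mono_left nhdsWithin_le_nhds
      refine tendsto_nhds_unique_of_eventuallyEq h1 h2 ?_
      filter_upwards [Ioo_mem_nhdsLT h0] with s hs
      exact hstep s ⟨hs.1.le, hs.2.le.trans hτ.2⟩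
        (fun r hr => hpos r ⟨hr.1, hr.2.trans_lt hs.2⟩) ξ hξ s ⟨hs.1.le, le_rfl⟩
  refine hlim t ⟨ht.1, le_rfl⟩ ?_
  by_contra! hcon
  obtain ⟨s₀, hs₀, ξ₀, hξ₀, hle⟩ := hcon
  have hne : (Prod.snd '' E).Nonempty :=
    ⟨s₀, (ξ₀, s₀), ⟨⟨hξ₀, Ico_subset_Icc_self hs₀⟩, hle⟩, rfl⟩
  obtain ⟨τ, ⟨⟨ξ, τ'⟩, hq, rfl⟩, hmin⟩ := (hEc.image continuous_snd).exists_isLeast hne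
  have hξ : ξ ∈ Icc (-L) L := hq.1.1
  have hτ : τ' ∈ Icc 0 t := hq.1.2
  have hτt : τ' < t := lt_of_le_of_lt
    (hmin ⟨(ξ₀, s₀), ⟨⟨hξ₀, Ico_subset_Icc_self hs₀⟩, hle⟩, rfl⟩) hs₀.2
  have heq := hlim τ' hτ fun s hs η hη => by
    by_contra! h
    exact not_lt.2 (hmin ⟨(η, s), ⟨⟨hη, hs.1, hs.2.le.trans hτ.2⟩, h⟩, rfl⟩) hs.2
  have hd : Xξ L Y ξ τ' = Xξ L F.X ξ τ' := derivWithin_congr heq (heq ξ hξ)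
  have := hJ τ' ⟨hτ.1, hτt⟩ ξ
  rw [← F.Xξ_eq hξ, ← hd] at this
  exact absurd hq.2 (not_le.2 this)

/-- The Lagrange dynamics has no solution with `X_ξ > 0` beyond a time at which the flow
degenerates. -/
theorem lagrange_maximal {T : EReal} {T₁ : ℝ} {Y : ℝ → ℝ → ℝ} (h₁ : 0 < T₁)
    (hJ : ∀ s ∈ Ico 0 T₁, s ∈ F.J) (hX : ∃ ξ ∈ Icc (-L) L, F.Xd ξ T₁ = 0)
    (hY : IsLagrangeSolution k L m₀ T Y)
    (hpos : ∀ ξ ∈ Icc (-L) L, ∀ t ∈ timeIco T, 0 < Xξ L Y ξ t) : T ≤ T₁ := by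
  by_contra! hlt
  have hmem : T₁ ∈ timeIco T := ⟨h₁.le, hlt⟩
  obtain ⟨ξ, hξ, h0⟩ := hX
  have heq := F.lagrange_unique hY hmem hJ
  have hd : Xξ L Y ξ T₁ = Xξ L F.X ξ T₁ := derivWithin_congr heq (heq ξ hξ)
  have := hpos ξ hξ T₁ hmem
  rw [hd, F.Xξ_eq hξ, h0] at this
  exact lt_irrefl _ this

end CutoffFlow

/-! ### Uniqueness of classical solutions -/

/-- What the uniqueness proof uses of a classical solution on `[0, τ]`: the first space
derivatives `vx`, `nx`, the equations, and the bound `c` on `v` and `v_x`. The equation for `n` is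
written as a formula for `n_t`, with `(v² - v_x²)_x = 2 v_x n`. -/
structure SmoothSolution (τ c : ℝ) (m₀ : ℝ → ℝ) (v vx n nx : ℝ → ℝ → ℝ) : Prop where
  cont_v : ContinuousOn (uncurry v) (univ ×ˢ Icc 0 τ)
  cont_vx : ContinuousOn (uncurry vx) (univ ×ˢ Icc 0 τ)
  cont_n : ContinuousOn (uncurry n) (univ ×ˢ Icc 0 τ)
  cont_nx : ContinuousOn (uncurry nx) (univ ×ˢ Icc 0 τ)
  deriv_v : ∀ t ∈ Icc 0 τ, ∀ x, HasDerivAt (fun y => v y t) (vx x t) x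
  deriv_vx : ∀ t ∈ Icc 0 τ, ∀ x, HasDerivAt (fun y => vx y t) (v x t - n x t) x
  deriv_n : ∀ t ∈ Icc 0 τ, ∀ x, HasDerivAt (fun y => n y t) (nx x t) x
  deriv_n_time : ∀ t ∈ Ioc 0 τ, ∀ x, HasDerivAt (fun s => n x s)
    (-(2 * vx x t * n x t * n x t + (v x t ^ 2 - vx x t ^ 2) * nx x t)) t
  initial : ∀ x, n x 0 = m₀ x
  bound : ∀ t ∈ Icc 0 τ, ∀ x, |v x t| ≤ c ∧ |vx x t| ≤ c

lemma IsClassicalSolution.exists_smoothSolution {k : ℕ} {m₀ : ℝ → ℝ} {T : EReal}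
    {v n : ℝ → ℝ → ℝ} (h : IsClassicalSolution k m₀ T v n) (hk : 1 ≤ k) {τ : ℝ}
    (hτ : τ ∈ timeIco T) : ∃ c, SmoothSolution τ c m₀ v (dx v) n (dx n) := by
  have hsub := Icc_subset_timeIco hτ
  obtain ⟨c, hc⟩ := h.bounded τ hτ
  have hdv : ∀ t ∈ Icc 0 τ, ContDiff ℝ 2 fun x => v x t := fun t ht =>
    (contDiffOn_univ.1 (h.regular_u.space t (hsub ht))).of_le (by norm_cast; omega)
  have hdn : ∀ t ∈ Icc 0 τ, ContDiff ℝ 1 fun x => n x t := fun t ht =>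
    (contDiffOn_univ.1 (h.regular_m.space t (hsub ht))).of_le (by exact_mod_cast hk)
  have d1 : ∀ t ∈ Icc 0 τ, ∀ x, HasDerivAt (fun y => v y t) (dx v x t) x := fun t ht x =>
    ((hdv t ht).differentiable (by simp) x).hasDerivAt
  have d2 : ∀ t ∈ Icc 0 τ, ∀ x, HasDerivAt (fun y => dx v y t) (v x t - n x t) x := by
    intro t ht x
    have h2 : ContDiff ℝ 1 (deriv fun x => v x t) :=
      (contDiff_succ_iff_deriv (n := 1).1 (by
        rw [one_add_one_eq_two]
        exact hdv t ht)).2.2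
    have h3 := (h2.differentiable (by simp) x).hasDerivAt
    refine h3.congr_deriv ?_
    have := h.helmholtz x t (hsub ht)
    change dx (dx v) x t = _
    linarith
  have d3 : ∀ t ∈ Icc 0 τ, ∀ x, HasDerivAt (fun y => n y t) (dx n x t) x := fun t ht x =>
    ((hdn t ht).differentiable (by simp) x).hasDerivAt
  refine ⟨c,
    { cont_v := h.regular_u.continuousOn.mono (prod_mono_right hsub)
      cont_vx := ((h.regular_u.continuousOn_derivWithin (by omega)).mono
        (prod_mono_right hsub)).congr fun q _ => by simp [dx, uncurry]
      cont_n := h.regular_m.continuousOn.mono (prod_mono_right hsub)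
      cont_nx := ((h.regular_m.continuousOn_derivWithin hk).mono
        (prod_mono_right hsub)).congr fun q _ => by simp [dx, uncurry]
      deriv_v := d1
      deriv_vx := d2
      deriv_n := d3
      deriv_n_time := fun t ht x => ?_
      initial := h.initial
      bound := fun t ht x => hc x t ht }⟩
  have ht' : t ∈ Icc 0 τ := Ioc_subset_Icc_self ht
  have hnt := ((h.regular_m.time x (mem_univ _)).differentiableOn (by simp) t (hsub ht'))
    |>.hasDerivWithinAt.hasDerivAt (timeIco_mem_nhds hτ ht)
  have hpde := h.pde x t (hsub ht') ht.1
  rw [hnt.deriv] at hpde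
  have hflux : HasDerivAt (fun y => (v y t ^ 2 - dx v y t ^ 2) * n y t)
      (2 * dx v x t * n x t * n x t + (v x t ^ 2 - dx v x t ^ 2) * dx n x t) x := by
    refine ((((d1 t ht' x).pow 2).sub ((d2 t ht' x).pow 2)).mul (d3 t ht' x)).congr_deriv ?_
    simp only [Pi.pow_apply, Pi.sub_apply, Nat.cast_ofNat, Nat.add_one_sub_one, pow_one]
    ring
  rw [dx, hflux.deriv] at hpde
  exact hnt.congr_deriv (by linarith)

/-- The bounded solution of `z - z_xx = q_x` satisfies `|z|, |z_x| ≤ 2 sup |q|`: the function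
`e^{-x}(z + z_x + q)` has the derivative `-e^{-x} q` and vanishes at `+∞`. -/
lemma abs_add_deriv_le {z zx q r : ℝ → ℝ} {K Q : ℝ} (hz : ∀ x, HasDerivAt z (zx x) x)
    (hzx : ∀ x, HasDerivAt zx (z x - r x) x) (hq : ∀ x, HasDerivAt q (r x) x)
    (hK : ∀ x, |z x| ≤ K ∧ |zx x| ≤ K) (hQ : ∀ x, |q x| ≤ Q) (x : ℝ) :
    |z x + zx x| ≤ 2 * Q := by
  have hQ0 : 0 ≤ Q := (abs_nonneg _).trans (hQ 0)
  have hexp : ∀ y : ℝ, HasDerivAt (fun y => Real.exp (-y)) (-Real.exp (-y)) y := fun y => by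
    simpa using (hasDerivAt_neg y).exp
  have hf : ∀ y, HasDerivAt (fun y => Real.exp (-y) * (z y + zx y + q y))
      (-(Real.exp (-y) * q y)) y := fun y => by
    refine ((hexp y).mul (((hz y).add (hzx y)).add (hq y))).congr_deriv ?_
    simp only [Pi.add_apply]
    ring
  have hlim : ∀ c : ℝ, Tendsto (fun y => Real.exp (-y) * (z y + zx y + q y) + c * Real.exp (-y))
      atTop (𝓝 0) := by
    intro c
    have he : Tendsto (fun y => Real.exp (-y)) atTop (𝓝 0) :=
      Real.tendsto_exp_atBot.comp tendsto_neg_atTop_atBot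
    have h1 : Tendsto (fun y => (2 * K + Q + |c|) * Real.exp (-y)) atTop (𝓝 0) := by
      simpa using he.const_mul (2 * K + Q + |c|)
    refine squeeze_zero_norm (fun y => ?_) h1
    rw [Real.norm_eq_abs, mul_comm (Real.exp (-y)), ← add_mul, abs_mul, abs_of_pos (Real.exp_pos _)]
    refine mul_le_mul_of_nonneg_right ?_ (Real.exp_pos _).le
    have := abs_add_le (z y + zx y + q y) c
    have := abs_add_le (z y + zx y) (q y)
    have := abs_add_le (z y) (zx y)
    linarith [(hK y).1, (hK y).2, hQ y]
  have hanti : Antitone fun y => Real.exp (-y) * (z y + zx y + q y) + Q * Real.exp (-y) := by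
    refine antitone_of_hasDerivAt_nonpos (fun y => (hf y).add ((hexp y).const_mul Q)) fun y => ?_
    have := neg_le_of_abs_le (hQ y)
    change _ ≤ (0 : ℝ)
    nlinarith [Real.exp_pos (-y)]
  have hmono : Monotone fun y => Real.exp (-y) * (z y + zx y + q y) + (-Q) * Real.exp (-y) := by
    refine monotone_of_hasDerivAt_nonneg (fun y => (hf y).add ((hexp y).const_mul (-Q))) fun y => ?_
    have := le_of_abs_le (hQ y)
    change (0 : ℝ) ≤ _
    nlinarith [Real.exp_pos (-y)]
  have h1 := hanti.le_of_tendsto (hlim Q) x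
  have h2 := hmono.ge_of_tendsto (hlim (-Q)) x
  have hpos := Real.exp_pos (-x)
  have h3 : 0 ≤ z x + zx x + q x + Q := by
    by_contra! h
    nlinarith
  have h4 : z x + zx x + q x - Q ≤ 0 := by
    by_contra! h
    nlinarith
  have h5 := abs_le.1 (hQ x)
  rw [abs_le]
  constructor <;> linarith [h5.1, h5.2]

lemma abs_le_of_helmholtz {z zx q r : ℝ → ℝ} {K Q : ℝ} (hz : ∀ x, HasDerivAt z (zx x) x)
    (hzx : ∀ x, HasDerivAt zx (z x - r x) x) (hq : ∀ x, HasDerivAt q (r x) x)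
    (hK : ∀ x, |z x| ≤ K ∧ |zx x| ≤ K) (hQ : ∀ x, |q x| ≤ Q) (x : ℝ) :
    |z x| ≤ 2 * Q ∧ |zx x| ≤ 2 * Q := by
  have h1 := abs_add_deriv_le hz hzx hq hK hQ x
  -- the same estimate after the reflection `x ↦ -x`
  have h2 := abs_add_deriv_le (z := fun x => z (-x)) (zx := fun x => -zx (-x))
    (q := fun x => -q (-x)) (r := fun x => r (-x)) (K := K) (Q := Q)
    (fun y => ((hz (-y)).scomp y (hasDerivAt_neg y)).congr_deriv (by simp))
    (fun y => ((hzx (-y)).scomp y (hasDerivAt_neg y)).neg.congr_deriv (by simp))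
    (fun y => ((hq (-y)).scomp y (hasDerivAt_neg y)).neg.congr_deriv (by simp))
    (fun y => by simpa using hK (-y)) (fun y => by simpa using hQ (-y)) (-x)
  simp only [neg_neg] at h2
  rw [abs_le] at h1 h2
  constructor <;> rw [abs_le] <;> constructor <;> linarith [h1.1, h1.2, h2.1, h2.2]

namespace SmoothSolution

variable {τ c : ℝ} {m₀ : ℝ → ℝ} {v vx n nx : ℝ → ℝ → ℝ}

lemma abs_sq_sub_le {a b c : ℝ} (ha : |a| ≤ c) (hb : |b| ≤ c) : |a ^ 2 - b ^ 2| ≤ c ^ 2 := by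
  have h1 : a ^ 2 ≤ c ^ 2 := sq_le_sq' (neg_le_of_abs_le ha) (le_of_abs_le ha)
  have h2 : b ^ 2 ≤ c ^ 2 := sq_le_sq' (neg_le_of_abs_le hb) (le_of_abs_le hb)
  rw [abs_le]
  constructor <;> nlinarith [sq_nonneg a, sq_nonneg b]

lemma deriv_W (h : SmoothSolution τ c m₀ v vx n nx) {t : ℝ} (ht : t ∈ Icc 0 τ) (x : ℝ) :
    HasDerivAt (fun y => v y t ^ 2 - vx y t ^ 2) (2 * vx x t * n x t) x := by
  refine (((h.deriv_v t ht x).pow 2).sub ((h.deriv_vx t ht x).pow 2)).congr_deriv ?_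
  simp
  ring

lemma cont_W (h : SmoothSolution τ c m₀ v vx n nx) :
    ContinuousOn (uncurry fun x t => v x t ^ 2 - vx x t ^ 2) (univ ×ˢ Icc 0 τ) :=
  (h.cont_v.pow 2).sub (h.cont_vx.pow 2)

/-- The characteristic of `v² - v_x²` that ends at `(x, t)`. -/
lemma exists_characteristic (h : SmoothSolution τ c m₀ v vx n nx) {t : ℝ} (ht : t ∈ Icc 0 τ)
    (x : ℝ) : ∃ y : ℝ → ℝ, y t = x ∧ ∀ s ∈ Icc 0 t,
      HasDerivWithinAt y (v (y s) s ^ 2 - vx (y s) s ^ 2) (Icc 0 t) s := by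
  have hsub : Icc 0 t ⊆ Icc 0 τ := Icc_subset_Icc_right ht.2
  have hcomp : IsCompact (Metric.closedBall x (c ^ 2 * t) ×ˢ Icc 0 t) :=
    (isCompact_closedBall _ _).prod isCompact_Icc
  obtain ⟨K, hK⟩ := hcomp.exists_bound_of_continuousOn
    (((continuousOn_const.mul h.cont_vx).mul h.cont_n).mono
      (prod_mono (subset_univ _) hsub) : ContinuousOn
      (fun q : ℝ × ℝ => 2 * uncurry vx q * uncurry n q) _)
  have hpl : IsPicardLindelof (fun s y => v y s ^ 2 - vx y s ^ 2)
      (⟨t, right_mem_Icc.2 ht.1⟩ : Icc 0 t) x (⟨c ^ 2 * t, mul_nonneg (sq_nonneg c) ht.1⟩) 0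
      ⟨c ^ 2, sq_nonneg c⟩ K.toNNReal :=
    { lipschitzOnWith := fun s hs => by
        refine (convex_closedBall _ _).lipschitzOnWith_of_nnnorm_hasDerivWithin_le
          (f' := fun y => 2 * vx y s * n y s)
          (fun y _ => (h.deriv_W (hsub hs) y).hasDerivWithinAt) fun y hy => ?_
        rw [← NNReal.coe_le_coe, coe_nnnorm]
        exact (hK (y, s) ⟨hy, hs⟩).trans (Real.le_coe_toNNReal K)
      continuousOn := fun y _ =>
        h.cont_W.comp (f := fun s => (y, s)) (by fun_prop) fun s hs => ⟨mem_univ _, hsub hs⟩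
      norm_le := fun s hs y _ =>
        abs_sq_sub_le (h.bound s (hsub hs) y).1 (h.bound s (hsub hs) y).2
      mul_max_le := by
        change c ^ 2 * max (t - t) (t - 0) ≤ c ^ 2 * t - 0
        simp [max_eq_right ht.1] }
  exact hpl.exists_eq_forall_mem_Icc_hasDerivWithinAt₀

/-- Finite speed of propagation. -/
lemma eq_zero_of_le_abs (h : SmoothSolution τ c m₀ v vx n nx) {L : ℝ}
    (hm₀ : ∀ x, L ≤ |x| → m₀ x = 0) {t : ℝ} (ht : t ∈ Icc 0 τ) {x : ℝ}
    (hx : L + c ^ 2 * τ ≤ |x|) : n x t = 0 := by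
  obtain ⟨y, hyt, hy⟩ := h.exists_characteristic ht x
  have hsub : Icc 0 t ⊆ Icc 0 τ := Icc_subset_Icc_right ht.2
  have hyc : ContinuousOn y (Icc 0 t) := fun s hs => (hy s hs).continuousWithinAt
  have h0 : n (y 0) 0 = 0 := by
    rw [h.initial]
    refine hm₀ _ ?_
    have h1 := (convex_Icc 0 t).norm_image_sub_le_of_norm_hasDerivWithin_le (C := c ^ 2) hy
      (fun s hs => abs_sq_sub_le (h.bound s (hsub hs) _).1 (h.bound s (hsub hs) _).2)
      (left_mem_Icc.2 ht.1) (right_mem_Icc.2 ht.1)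
    rw [hyt, Real.norm_eq_abs, Real.norm_eq_abs, sub_zero, abs_of_nonneg ht.1] at h1
    have h2 : c ^ 2 * t ≤ c ^ 2 * τ := mul_le_mul_of_nonneg_left ht.2 (sq_nonneg c)
    have h3 := abs_sub_abs_le_abs_sub x (y 0)
    linarith
  have hpath : ContinuousOn (fun s => (y s, s)) (Icc 0 t) := hyc.prodMk continuousOn_id
  have hmaps : MapsTo (fun s => (y s, s)) (Icc 0 t) ((univ : Set ℝ) ×ˢ Icc 0 τ) :=
    fun s hs => ⟨mem_univ _, hsub hs⟩
  have hnc : ContinuousOn (fun s => n (y s) s) (Icc 0 t) := h.cont_n.comp hpath hmaps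
  have hgc : ContinuousOn (fun s => -(2 * vx (y s) s * n (y s) s)) (Icc 0 t) :=
    ((continuousOn_const.mul (h.cont_vx.comp hpath hmaps)).mul hnc).neg
  obtain ⟨K, hK⟩ := isCompact_Icc.exists_bound_of_continuousOn hgc
  obtain ⟨K₂, hK₂⟩ := isCompact_Icc.exists_bound_of_continuousOn hnc
  have hder : ∀ s ∈ Ioo 0 t, HasDerivAt (fun s => n (y s) s)
      (-(2 * vx (y s) s * n (y s) s) * n (y s) s) s := by
    intro s hs
    have hS : (univ : Set ℝ) ×ˢ Ioo 0 t ∈ 𝓝 (y s, s) :=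
      prod_mem_nhds univ_mem (Ioo_mem_nhds hs.1 hs.2)
    have hSsub : (univ : Set ℝ) ×ˢ Ioo 0 t ⊆ univ ×ˢ Icc 0 τ :=
      prod_mono_right (Ioo_subset_Icc_self.trans hsub)
    have hct : ContinuousOn (uncurry fun x t =>
        -(2 * vx x t * n x t * n x t + (v x t ^ 2 - vx x t ^ 2) * nx x t)) (univ ×ˢ Icc 0 τ) :=
      ((((continuousOn_const.mul h.cont_vx).mul h.cont_n).mul h.cont_n).add
        (h.cont_W.mul h.cont_nx)).neg
    refine (hasDerivAt_along hS (fun q hq => h.deriv_n q.2 (hSsub hq).2 q.1)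
      (fun q hq => h.deriv_n_time q.2 ⟨hq.2.1, (hSsub hq).2.2⟩ q.1)
      (h.cont_nx.mono hSsub) (hct.mono hSsub)
      ((hy s (Ioo_subset_Icc_self hs)).hasDerivAt (Icc_mem_nhds hs.1 hs.2))).congr_deriv ?_
    ring
  have := eq_zero_of_weighted_bound (s := (univ : Set Unit)) (D := fun _ s => n (y s) s) (τ := t)
    (C := |K| + 1) (by positivity) ⟨K₂, fun _ _ s hs => hK₂ s hs⟩ ?_ () (mem_univ _) t
    (right_mem_Icc.2 ht.1)
  · rwa [hyt] at this
  intro Q hQ hb _ _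
  refine abs_le_of_deriv_le_exp hnc h0 hder fun s hs => ?_
  have hs' := Ioo_subset_Icc_self hs
  rw [abs_mul]
  refine mul_le_mul ?_ (hb () (mem_univ _) s hs') (abs_nonneg _) (by positivity)
  exact (hK s hs').trans ((le_abs_self K).trans (by linarith))

end SmoothSolution

/-! ### The potential of the difference of two solutions -/

lemma SmoothSolution.hasDerivAt_flux {τ c : ℝ} {m₀ : ℝ → ℝ} {v vx n nx : ℝ → ℝ → ℝ}
    (h : SmoothSolution τ c m₀ v vx n nx) {t : ℝ} (ht : t ∈ Icc 0 τ) (x : ℝ) :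
    HasDerivAt (fun y => (v y t ^ 2 - vx y t ^ 2) * n y t)
      (2 * vx x t * n x t * n x t + (v x t ^ 2 - vx x t ^ 2) * nx x t) x :=
  (h.deriv_W ht x).mul (h.deriv_n t ht x)

lemma SmoothSolution.continuousOn_flux_deriv {τ c : ℝ} {m₀ : ℝ → ℝ} {v vx n nx : ℝ → ℝ → ℝ}
    (h : SmoothSolution τ c m₀ v vx n nx) : ContinuousOn (uncurry fun x t =>
      2 * vx x t * n x t * n x t + (v x t ^ 2 - vx x t ^ 2) * nx x t) (univ ×ˢ Icc 0 τ) :=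
  (((continuousOn_const.mul h.cont_vx).mul h.cont_n).mul h.cont_n).add (h.cont_W.mul h.cont_nx)

/-- The potential `q = ∫_{-∞}^x (m - n)` of the difference of two solutions whose densities vanish
for `|x| ≥ R`: it is bounded, and `q_t` is the difference of the fluxes. -/
lemma exists_potential {τ c c' R : ℝ} {m₀ : ℝ → ℝ} {u ux m mx v vx n nx : ℝ → ℝ → ℝ} (hτ : 0 ≤ τ)
    (h : SmoothSolution τ c m₀ u ux m mx) (h' : SmoothSolution τ c' m₀ v vx n nx)
    (hm : ∀ t ∈ Icc 0 τ, ∀ x, R ≤ |x| → m x t = 0) (hn : ∀ t ∈ Icc 0 τ, ∀ x, R ≤ |x| → n x t = 0) :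
    ∃ q : ℝ → ℝ → ℝ, Continuous (uncurry q) ∧ (∀ x, q x 0 = 0) ∧
      (∃ K, ∀ t ∈ Icc 0 τ, ∀ x, |q x t| ≤ K) ∧
      (∀ t ∈ Icc 0 τ, ∀ x, HasDerivAt (fun y => q y t) (m x t - n x t) x) ∧
      ∀ t ∈ Ioo 0 τ, ∀ x, HasDerivAt (fun s => q x s)
        ((v x t ^ 2 - vx x t ^ 2) * n x t - (u x t ^ 2 - ux x t ^ 2) * m x t) t := by
  -- Freezing the time outside `[0, τ]` makes the difference continuous on the whole plane.
  set cl : ℝ → ℝ := fun t => (projIcc 0 τ hτ t : ℝ) with hcl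
  have hclc : Continuous cl := continuous_subtype_val.comp continuous_projIcc
  have hclm : ∀ t, cl t ∈ Icc 0 τ := fun t => (projIcc 0 τ hτ t).2
  have hcle : ∀ t ∈ Icc 0 τ, cl t = t := fun t ht => by simp [hcl, projIcc_of_mem hτ ht]
  set r : ℝ → ℝ → ℝ := fun x t => m x (cl t) - n x (cl t) with hr
  have hrc : Continuous (uncurry r) := by
    have h1 : Continuous fun q : ℝ × ℝ => (q.1, cl q.2) :=
      continuous_fst.prodMk (hclc.comp continuous_snd)
    exact (h.cont_n.comp_continuous h1 fun q => ⟨mem_univ _, hclm _⟩).sub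
      (h'.cont_n.comp_continuous h1 fun q => ⟨mem_univ _, hclm _⟩)
  have hr0 : ∀ x t, R ≤ |x| → r x t = 0 := fun x t hx => by
    simp only [hr]
    rw [hm _ (hclm t) x hx, hn _ (hclm t) x hx, sub_zero]
  have hqS : SpaceC univ 1 fun x t => ∫ y in (-R)..x, r y t :=
    SpaceC.primitive (j := 0) hrc.continuousOn (-R)
  have hrt : ∀ t, Continuous fun x => r x t := fun t =>
    hrc.comp (by fun_prop : Continuous fun x => (x, t))
  have hqx : ∀ t x, HasDerivAt (fun y => ∫ z in (-R)..y, r z t) (r x t) x := fun t x =>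
    ((hrt t).integral_hasStrictDerivAt (-R) x).hasDerivAt
  refine ⟨fun x t => ∫ y in (-R)..x, r y t, hqS.continuous, fun x => ?_, ?_, fun t ht x => ?_,
    fun t ht x => ?_⟩
  · have : ∀ y, r y 0 = 0 := fun y => by
      simp only [hr]
      rw [hcle 0 ⟨le_rfl, hτ⟩, h.initial, h'.initial, sub_self]
    simp [this]
  · obtain ⟨K, hK⟩ := (isCompact_Icc.prod isCompact_Icc).exists_bound_of_continuousOn
      (hqS.continuous.continuousOn (s := Icc (-|R|) |R| ×ˢ Icc 0 τ))
    refine ⟨K, fun t ht x => ?_⟩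
    have hsplit : ∀ a b : ℝ, (∀ y ∈ uIcc a b, R ≤ |y|) →
        ∫ y in (-R)..b, r y t = ∫ y in (-R)..a, r y t := by
      intro a b hab
      rw [← intervalIntegral.integral_add_adjacent_intervals ((hrt t).intervalIntegrable (-R) a)
        ((hrt t).intervalIntegrable a b)]
      rw [intervalIntegral.integral_congr (g := fun _ => (0 : ℝ)) fun y hy => hr0 y t (hab y hy)]
      simp
    have hRR := abs_nonneg R
    change |∫ y in (-R)..x, r y t| ≤ K
    rcases le_or_gt x (-|R|) with h1 | h1
    · rw [hsplit (-|R|) x fun y hy => ?_]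
      · exact hK (-|R|, t) ⟨⟨le_rfl, by linarith⟩, ht⟩
      · rw [uIcc_of_ge h1] at hy
        have : y ≤ 0 := by linarith [hy.2]
        rw [abs_of_nonpos this]
        linarith [le_abs_self R, hy.2]
    · rcases le_or_gt x |R| with h2 | h2
      · exact hK (x, t) ⟨⟨h1.le, h2⟩, ht⟩
      · rw [hsplit |R| x fun y hy => ?_]
        · exact hK (|R|, t) ⟨⟨by linarith, le_rfl⟩, ht⟩
        · rw [uIcc_of_le h2.le] at hy
          exact (le_abs_self R).trans (hy.1.trans (le_abs_self y))
  · have := hqx t x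
    simp only [hr, hcle t ht] at this ⊢
    exact this
  · have ht' := Ioo_subset_Icc_self ht
    have hflux : ∀ {c : ℝ} {u ux m mx : ℝ → ℝ → ℝ}, SmoothSolution τ c m₀ u ux m mx →
        (∀ t ∈ Icc 0 τ, ∀ x, R ≤ |x| → m x t = 0) →
        IntervalIntegrable (fun y => 2 * ux y t * m y t * m y t +
          (u y t ^ 2 - ux y t ^ 2) * mx y t) volume (-R) x ∧
        ∫ y in (-R)..x, (2 * ux y t * m y t * m y t + (u y t ^ 2 - ux y t ^ 2) * mx y t) =
          (u x t ^ 2 - ux x t ^ 2) * m x t := by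
      intro c u ux m mx h hm
      have hint : IntervalIntegrable (fun y => 2 * ux y t * m y t * m y t +
          (u y t ^ 2 - ux y t ^ 2) * mx y t) volume (-R) x := by
        refine ContinuousOn.intervalIntegrable ?_
        exact h.continuousOn_flux_deriv.comp (f := fun y => (y, t)) (by fun_prop)
          fun y _ => ⟨mem_univ _, ht'⟩
      refine ⟨hint, ?_⟩
      rw [intervalIntegral.integral_eq_sub_of_hasDerivAt (fun y _ => h.hasDerivAt_flux ht' y) hint]
      rw [hm t ht' (-R) (by rw [abs_neg]; exact le_abs_self R)]
      ring
    have hd := hasDerivAt_intervalIntegral_param (f := fun s y => r y s)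
      (f' := fun s y => -(2 * ux y s * m y s * m y s + (u y s ^ 2 - ux y s ^ 2) * mx y s) -
        -(2 * vx y s * n y s * n y s + (v y s ^ 2 - vx y s ^ 2) * nx y s))
      (a := -R) (b := x) (x₀ := t) (U := Ioo 0 τ) (Ioo_mem_nhds ht.1 ht.2)
      (fun s _ => (hrt s).continuousOn)
      (fun s hs y _ => by
        have h1 := (h.deriv_n_time s ⟨hs.1, hs.2.le⟩ y).sub (h'.deriv_n_time s ⟨hs.1, hs.2.le⟩ y)
        refine h1.congr_of_eventuallyEq ?_
        filter_upwards [Ioo_mem_nhds hs.1 hs.2] with s' hs'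
        simp only [hr, hcle s' (Ioo_subset_Icc_self hs')]
        rfl)
      (by
        have hmaps : MapsTo (Prod.swap : ℝ × ℝ → ℝ × ℝ) (Ioo 0 τ ×ˢ uIcc (-R) x)
            (univ ×ˢ Icc 0 τ) := fun q hq => ⟨mem_univ _, Ioo_subset_Icc_self hq.1⟩
        exact (h.continuousOn_flux_deriv.comp continuous_swap.continuousOn hmaps).neg.sub
          (h'.continuousOn_flux_deriv.comp continuous_swap.continuousOn hmaps).neg)
    refine hd.congr_deriv ?_
    obtain ⟨i1, e1⟩ := hflux h hm
    obtain ⟨i2, e2⟩ := hflux h' hn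
    simp only [neg_sub_neg]
    rw [intervalIntegral.integral_sub i2 i1, e1, e2]

namespace CutoffFlow

variable {k : ℕ} {L : ℝ} {m₀ : ℝ → ℝ} (F : CutoffFlow k L m₀)

/-- Every classical solution agrees with `(u, m)` as long as `X_ξ > 0`: the potential `q` of the
difference of the densities satisfies `d/dt q(X(ξ,t),t) = (W_v - W_u) n` with `W = u² - u_x²`, and
`|W_v - W_u|` is controlled by `sup |q|`. -/
theorem classical_unique {T T₁ : EReal} {v n : ℝ → ℝ → ℝ} (hJ : timeIco T₁ ⊆ F.J)
    (hv : IsClassicalSolution k m₀ T v n) {τ : ℝ} (hτ : τ ∈ timeIco T) (hτ₁ : τ ∈ timeIco T₁)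
    (x : ℝ) : v x τ = F.u x τ ∧ n x τ = F.m x τ := by
  obtain ⟨c, h⟩ := (F.isClassicalSolution hJ).exists_smoothSolution F.one_le hτ₁
  obtain ⟨c', h'⟩ := hv.exists_smoothSolution F.one_le hτ
  have hτ0 : 0 ≤ τ := hτ.1
  have hJτ : ∀ t ∈ Icc 0 τ, t ∈ F.J := fun t ht => hJ (Icc_subset_timeIco hτ₁ ht)
  have hm₀ : ∀ x, L ≤ |x| → m₀ x = 0 := fun x hx =>
    F.m₀_eq_zero fun hx' => absurd (abs_lt.2 hx') (not_lt.2 hx)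
  set R := max (L + c ^ 2 * τ) (L + c' ^ 2 * τ)
  have hmR : ∀ t ∈ Icc 0 τ, ∀ x, R ≤ |x| → F.m x t = 0 := fun t ht x hx =>
    h.eq_zero_of_le_abs hm₀ ht ((le_max_left _ _).trans hx)
  have hnR : ∀ t ∈ Icc 0 τ, ∀ x, R ≤ |x| → n x t = 0 := fun t ht x hx =>
    h'.eq_zero_of_le_abs hm₀ ht ((le_max_right _ _).trans hx)
  obtain ⟨q, hqc, hq0, ⟨K, hK⟩, hqx, hqt⟩ := exists_potential hτ0 h h' hmR hnR
  obtain ⟨N, hN⟩ : ∃ N, ∀ t ∈ Icc 0 τ, ∀ x, |n x t| ≤ N := by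
    obtain ⟨N, hN⟩ := ((isCompact_Icc (a := -R) (b := R)).prod
      (isCompact_Icc (a := 0) (b := τ))).exists_bound_of_continuousOn
      (h'.cont_n.mono (prod_mono_left (subset_univ _)))
    refine ⟨max N 0, fun t ht x => ?_⟩
    rcases le_or_gt R |x| with hx | hx
    · simp [hnR t ht x hx]
    · exact (hN (x, t) ⟨abs_le.1 hx.le, ht⟩).trans (le_max_left _ _)
  have hN0 : 0 ≤ N := (abs_nonneg _).trans (hN 0 ⟨le_rfl, hτ0⟩ 0)
  have hc0 : 0 ≤ c := (abs_nonneg _).trans (h.bound 0 ⟨le_rfl, hτ0⟩ 0).1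
  have hc'0 : 0 ≤ c' := (abs_nonneg _).trans (h'.bound 0 ⟨le_rfl, hτ0⟩ 0).1
  -- `u - v` and its derivative are controlled by the potential
  have hz : ∀ t ∈ Icc 0 τ, ∀ Q, (∀ x, |q x t| ≤ Q) → ∀ x,
      |F.u x t - v x t| ≤ 2 * Q ∧ |dx F.u x t - dx v x t| ≤ 2 * Q := by
    intro t ht Q hQ
    refine abs_le_of_helmholtz (z := fun x => F.u x t - v x t)
      (zx := fun x => dx F.u x t - dx v x t) (K := c + c')
      (fun x => (h.deriv_v t ht x).sub (h'.deriv_v t ht x))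
      (fun x => ((h.deriv_vx t ht x).sub (h'.deriv_vx t ht x)).congr_deriv (by ring))
      (hqx t ht) (fun x => ?_) hQ
    exact ⟨(abs_sub _ _).trans (add_le_add (h.bound t ht x).1 (h'.bound t ht x).1),
      (abs_sub _ _).trans (add_le_add (h.bound t ht x).2 (h'.bound t ht x).2)⟩
  have hsurj : ∀ (t : ℝ) (Q : ℝ), (∀ ξ, |q (F.X ξ t) t| ≤ Q) → ∀ x, |q x t| ≤ Q :=
    fun t Q hQ x => by simpa only [X_Ξ] using hQ (F.Ξ x t)
  have hcX : ∀ ξ, Continuous fun t => (F.X ξ t, t) := fun ξ =>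
    (continuous_right F.continuous_X ξ).prodMk continuous_id
  have hzero := eq_zero_of_weighted_bound (C := 4 * (c + c') * N + 1) (s := (univ : Set ℝ))
    (D := fun ξ t => q (F.X ξ t) t) (τ := τ) (by positivity)
    ⟨K, fun ξ _ t ht => hK t ht _⟩ ?_
  · have hqτ : ∀ x, |q x τ| ≤ 0 := hsurj τ 0 fun ξ => by
      rw [hzero ξ (mem_univ _) τ ⟨hτ0, le_rfl⟩, abs_zero]
    have hττ : τ ∈ Icc 0 τ := ⟨hτ0, le_rfl⟩
    constructor
    · have := (hz τ hττ 0 hqτ x).1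
      rw [mul_zero] at this
      linarith [abs_eq_zero.1 (le_antisymm this (abs_nonneg _))]
    · have hq : (fun y => q y τ) = fun _ => 0 := funext fun y =>
        abs_eq_zero.1 (le_antisymm (hqτ y) (abs_nonneg _))
      have h1 := hqx τ hττ x
      rw [hq] at h1
      linarith [h1.unique (hasDerivAt_const x (0 : ℝ))]
  intro Q hQ hQb ξ _
  refine abs_le_of_deriv_le_exp (f := fun t => q (F.X ξ t) t)
    (f' := fun t => ((v (F.X ξ t) t ^ 2 - dx v (F.X ξ t) t ^ 2) -
      (F.u (F.X ξ t) t ^ 2 - dx F.u (F.X ξ t) t ^ 2)) * n (F.X ξ t) t)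
    (hqc.comp (hcX ξ)).continuousOn (hq0 _) (fun t ht => ?_) fun t ht => ?_
  · have ht' := Ioo_subset_Icc_self ht
    have hS : (univ : Set ℝ) ×ˢ Ioo 0 τ ∈ 𝓝 (F.X ξ t, t) :=
      prod_mem_nhds univ_mem (Ioo_mem_nhds ht.1 ht.2)
    have hsub : (univ : Set ℝ) ×ˢ Ioo 0 τ ⊆ univ ×ˢ Icc 0 τ := prod_mono_right Ioo_subset_Icc_self
    have hV : F.V ξ t = F.u (F.X ξ t) t ^ 2 - dx F.u (F.X ξ t) t ^ 2 := by
      rw [F.dx_u (hJτ t ht'), F.u_sq_sub, F.Ξ_X (hJτ t ht')]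
    refine (hasDerivAt_along (fx := fun x t => F.m x t - n x t)
      (ft := fun x t => (v x t ^ 2 - dx v x t ^ 2) * n x t -
        (F.u x t ^ 2 - dx F.u x t ^ 2) * F.m x t) hS (fun p hp => hqx p.2 (hsub hp).2 p.1)
      (fun p hp => hqt p.2 hp.2 p.1)
      ((h.cont_n.sub h'.cont_n).mono hsub)
      (((h'.cont_W.mul h'.cont_n).sub (h.cont_W.mul h.cont_n)).mono hsub)
      (F.hasDerivAt_X_time ξ t)).congr_deriv ?_
    rw [hV]
    ring
  · have ht' := Ioo_subset_Icc_self ht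
    set E := Q * Real.exp (2 * (4 * (c + c') * N + 1) * t)
    have hE : 0 ≤ E := by positivity
    obtain ⟨z1, z2⟩ := hz t ht' E (hsurj t E fun η => hQb η (mem_univ _) t ht') (F.X ξ t)
    obtain ⟨b1, b2⟩ := h.bound t ht' (F.X ξ t)
    obtain ⟨b3, b4⟩ := h'.bound t ht' (F.X ξ t)
    have b5 := hN t ht' (F.X ξ t)
    set a := F.u (F.X ξ t) t
    set a' := dx F.u (F.X ξ t) t
    set b := v (F.X ξ t) t
    set b' := dx v (F.X ξ t) t
    have e1 : |(b ^ 2 - b' ^ 2) - (a ^ 2 - a' ^ 2)| ≤ 2 * E * (c + c') + 2 * E * (c + c') := by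
      calc |(b ^ 2 - b' ^ 2) - (a ^ 2 - a' ^ 2)| = |(a' - b') * (a' + b') - (a - b) * (a + b)| := by
            ring_nf
        _ ≤ |a' - b'| * |a' + b'| + |a - b| * |a + b| := by
            refine (abs_sub _ _).trans ?_
            rw [abs_mul, abs_mul]
        _ ≤ 2 * E * (c + c') + 2 * E * (c + c') := by
            gcongr
            · exact (abs_add_le _ _).trans (add_le_add b2 b4)
            · exact (abs_add_le _ _).trans (add_le_add b1 b3)
    rw [abs_mul]
    calc _ ≤ (2 * E * (c + c') + 2 * E * (c + c')) * N := by gcongr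
      _ = 4 * (c + c') * N * E := by ring
      _ ≤ (4 * (c + c') * N + 1) * E := by nlinarith

/-- There is no classical solution beyond a time at which the flow degenerates, as `m` would be
finite at the point where `m(X,t) X_ξ = m₀` with `X_ξ = 0` and `m₀ ≠ 0`. -/
theorem classical_maximal {T : EReal} {T₁ : ℝ} {v n : ℝ → ℝ → ℝ} (h₁ : 0 < T₁)
    (hJ : timeIco T₁ ⊆ F.J) (hX : ∃ ξ ∈ Icc (-L) L, F.Xd ξ T₁ = 0)
    (hv : IsClassicalSolution k m₀ T v n) : T ≤ T₁ := by
  by_contra! hlt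
  have hmem : T₁ ∈ timeIco T := ⟨h₁.le, hlt⟩
  obtain ⟨ξ, hξ, h0⟩ := hX
  have hm0 : m₀ ξ ≠ 0 := fun h => by
    rw [F.Xd_eq_one h] at h0
    exact one_ne_zero h0
  have hpath : Continuous fun t => (F.X ξ t, t) :=
    (continuous_right F.continuous_X ξ).prodMk continuous_id
  have hnc : ContinuousOn (fun t => n (F.X ξ t) t * F.Xd ξ t) (Icc 0 T₁) := by
    refine ContinuousOn.mul ?_ (continuous_right F.continuous_Xd ξ).continuousOn
    exact hv.regular_m.continuousOn.comp hpath.continuousOn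
      fun t ht => ⟨mem_univ _, Icc_subset_timeIco hmem ht⟩
  have h1 : Tendsto (fun t => n (F.X ξ t) t * F.Xd ξ t) (𝓝[<] T₁) (𝓝 0) := by
    have := (hnc T₁ ⟨h₁.le, le_rfl⟩).mono_left (nhdsWithin_mono T₁ Ioo_subset_Icc_self)
    rw [nhdsWithin_Ioo_eq_nhdsLT h₁] at this
    simpa [h0] using this
  have h2 : Tendsto (fun t => n (F.X ξ t) t * F.Xd ξ t) (𝓝[<] T₁) (𝓝 (m₀ ξ)) := by
    refine tendsto_const_nhds.congr' ?_
    filter_upwards [Ioo_mem_nhdsLT h₁] with t ht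
    have ht₁ : t ∈ timeIco T₁ := ⟨ht.1.le, by exact_mod_cast ht.2⟩
    rw [(F.classical_unique hJ hv (Icc_subset_timeIco hmem (Ioo_subset_Icc_self ht)) ht₁ _).2,
      F.m_X (hJ ht₁)]
    have := (hJ ht₁ ξ).ne'
    field_simp
  exact hm0 (tendsto_nhds_unique h2 h1)

end CutoffFlow

/-! ### The blow-up criteria -/

lemma enorm_le_eLpNorm_top {f : ℝ → ℝ} (hf : Continuous f) (x : ℝ) :
    ‖f x‖ₑ ≤ eLpNorm f ⊤ volume := by
  have h1 : {y | ‖f y‖ₑ ≤ eLpNorm f ⊤ volume} =ᵐ[volume] univ := by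
    refine eventuallyEq_univ.2 ?_
    change ∀ᵐ y, ‖f y‖ₑ ≤ eLpNorm f ⊤ volume
    rw [eLpNorm_exponent_top]
    exact enorm_ae_le_eLpNormEssSup f volume
  have h2 : IsClosed {y | ‖f y‖ₑ ≤ eLpNorm f ⊤ volume} := isClosed_le hf.enorm continuous_const
  have h3 := h2.ae_eq_univ_iff_eq.1 h1
  exact (h3 ▸ mem_univ x : x ∈ {y | ‖f y‖ₑ ≤ eLpNorm f ⊤ volume})

/-- A `C¹` function that vanishes at `a` is controlled on `[a, b]` by the `L^p` norm of its
derivative. -/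
lemma exists_enorm_le_eLpNorm_deriv {a b : ℝ} {p : ℝ≥0∞} (hp : 1 ≤ p) :
    ∃ C : ℝ≥0∞, C ≠ ⊤ ∧ ∀ f f' : ℝ → ℝ, (∀ x, HasDerivAt f (f' x) x) → Continuous f' →
      f a = 0 → ∀ x ∈ Icc a b, ‖f x‖ₑ ≤ eLpNorm f' p volume * C := by
  refine ⟨(volume.restrict (Icc a b)) univ ^ (1 / (1 : ℝ≥0∞).toReal - 1 / p.toReal), ?_,
    fun f f' hf hf' ha x hx => ?_⟩
  · refine ENNReal.rpow_ne_top_of_nonneg ?_ (measure_ne_top _ _)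
    rcases eq_or_ne p ⊤ with rfl | hpt
    · simp
    · have h1 : 1 ≤ p.toReal := by
        have := ENNReal.toReal_mono hpt hp
        simpa using this
      rw [ENNReal.toReal_one, div_one, sub_nonneg]
      exact div_le_one_of_le₀ h1 (by linarith)
  · have e : f x = ∫ y in a..x, f' y := by
      rw [intervalIntegral.integral_eq_sub_of_hasDerivAt (fun y _ => hf y)
        (hf'.intervalIntegrable _ _), ha, sub_zero]
    calc ‖f x‖ₑ = ‖∫ y in Ioc a x, f' y‖ₑ := by rw [e, intervalIntegral.integral_of_le hx.1]
      _ ≤ ∫⁻ y in Ioc a x, ‖f' y‖ₑ := enorm_integral_le_lintegral_enorm _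
      _ ≤ ∫⁻ y in Icc a b, ‖f' y‖ₑ :=
          lintegral_mono_set (Ioc_subset_Icc_self.trans (Icc_subset_Icc_right hx.2))
      _ = eLpNorm f' 1 (volume.restrict (Icc a b)) := eLpNorm_one_eq_lintegral_enorm.symm
      _ ≤ eLpNorm f' p (volume.restrict (Icc a b)) *
          (volume.restrict (Icc a b)) univ ^ (1 / (1 : ℝ≥0∞).toReal - 1 / p.toReal) :=
          eLpNorm_le_eLpNorm_mul_rpow_measure_univ hp hf'.aestronglyMeasurable
      _ ≤ _ := by gcongr; exact Measure.restrict_le_self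

namespace CutoffFlow

variable {k : ℕ} {L : ℝ} {m₀ : ℝ → ℝ} (F : CutoffFlow k L m₀)

lemma hasDerivAt_m {t : ℝ} (ht : t ∈ F.J) (x : ℝ) :
    HasDerivAt (fun y => F.m y t) (dx F.m x t) x :=
  (((F.spaceC_m.mono F.one_le).contDiff ht).differentiable (by simp) x).hasDerivAt

lemma continuousOn_dx_m : ContinuousOn (uncurry (dx F.m)) (univ ×ˢ F.J) :=
  SpaceC.continuousOn (j := 0) ((F.spaceC_m.mono F.one_le).of_deriv
    fun _ ht x => F.hasDerivAt_m ht x)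

lemma continuous_m {t : ℝ} (ht : t ∈ F.J) : Continuous fun x => F.m x t :=
  (F.spaceC_m.contDiff ht).continuous

lemma continuous_dx_m {t : ℝ} (ht : t ∈ F.J) : Continuous fun x => dx F.m x t :=
  ((F.spaceC_m.mono F.one_le).contDiff ht).continuous_deriv (by simp)

lemma m_eq_zero {t : ℝ} (ht : t ∈ F.J) {x : ℝ} (hx : x ∉ Icc (-L) L) : F.m x t = 0 :=
  image_eq_zero_of_notMem_tsupport (f := fun y => F.m y t) fun h =>
    hx (Ioo_subset_Icc_self (F.tsupport_m ht h))

lemma dx_m_eq_zero {t : ℝ} (ht : t ∈ F.J) {x : ℝ} (hx : x ∉ Icc (-L) L) : dx F.m x t = 0 := by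
  have h : (fun y => F.m y t) =ᶠ[𝓝 x] fun _ => 0 := by
    filter_upwards [isClosed_Icc.isOpen_compl.mem_nhds hx] with y hy
    exact F.m_eq_zero ht hy
  rw [dx, h.deriv_eq, deriv_const]

/-- Before the flow degenerates, `m` and `m_x` are bounded. -/
lemma exists_bound_m {T : ℝ} (hT : Icc 0 T ⊆ F.J) :
    ∃ K, 0 ≤ K ∧ ∀ t ∈ Icc 0 T, ∀ x, |F.m x t| ≤ K ∧ |dx F.m x t| ≤ K := by
  have hc : IsCompact (Icc (-L) L ×ˢ Icc 0 T) := isCompact_Icc.prod isCompact_Icc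
  have hsub : Icc (-L) L ×ˢ Icc 0 T ⊆ univ ×ˢ F.J := prod_mono (subset_univ _) hT
  obtain ⟨K₁, hK₁⟩ := hc.exists_bound_of_continuousOn (F.spaceC_m.continuousOn.mono hsub)
  obtain ⟨K₂, hK₂⟩ := hc.exists_bound_of_continuousOn (F.continuousOn_dx_m.mono hsub)
  refine ⟨max 0 (max K₁ K₂), le_max_left _ _, fun t ht x => ?_⟩
  by_cases hx : x ∈ Icc (-L) L
  · exact ⟨(hK₁ (x, t) ⟨hx, ht⟩).trans ((le_max_left _ _).trans (le_max_right _ _)),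
      (hK₂ (x, t) ⟨hx, ht⟩).trans ((le_max_right _ _).trans (le_max_right _ _))⟩
  · rw [F.m_eq_zero (hT ht) hx, F.dx_m_eq_zero (hT ht) hx]
    simp

/-- None of the criteria holds at a time at which the flow is still a diffeomorphism. -/
lemma not_blowUpCriteria {T : ℝ} (hT0 : 0 < T) (hT : Icc 0 T ⊆ F.J) (p : ℝ≥0∞) :
    ∀ P ∈ blowUpCriteria L F.X F.u F.m p T, ¬P := by
  obtain ⟨K, hK0, hK⟩ := F.exists_bound_m hT
  have hev : ∀ᶠ t in 𝓝[<] T, t ∈ Icc 0 T := by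
    filter_upwards [Ioo_mem_nhdsLT hT0] with t ht using Ioo_subset_Icc_self ht
  have hnorm : ∀ (q : ℝ≥0∞) (f : ℝ → ℝ), (∀ x, |f x| ≤ K) → (∀ x, x ∉ Icc (-L) L → f x = 0) →
      eLpNorm f q volume ≤ (volume.restrict (Icc (-L) L)) univ ^ q.toReal⁻¹ * ENNReal.ofReal K := by
    intro q f hf hf0
    rw [← eLpNorm_restrict_eq_of_support_subset (s := Icc (-L) L)
      (fun x hx => by by_contra h; exact hx (hf0 x h))]
    exact eLpNorm_le_of_ae_bound (Eventually.of_forall hf)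
  have hCq : ∀ q : ℝ≥0∞,
      (volume.restrict (Icc (-L) L)) univ ^ q.toReal⁻¹ * ENNReal.ofReal K < ⊤ := fun q =>
    ENNReal.mul_lt_top (ENNReal.rpow_lt_top_of_nonneg (by positivity) (measure_ne_top _ _))
      ENNReal.ofReal_lt_top
  have hm : ∀ (q : ℝ≥0∞), ∀ t ∈ Icc 0 T, eLpNorm (fun x => F.m x t) q volume ≤
      (volume.restrict (Icc (-L) L)) univ ^ q.toReal⁻¹ * ENNReal.ofReal K := fun q t ht =>
    hnorm q _ (fun x => (hK t ht x).1) fun x hx => F.m_eq_zero (hT ht) hx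
  have hmx : ∀ (q : ℝ≥0∞), ∀ t ∈ Icc 0 T, eLpNorm (fun x => dx F.m x t) q volume ≤
      (volume.restrict (Icc (-L) L)) univ ^ q.toReal⁻¹ * ENNReal.ofReal K := fun q t ht =>
    hnorm q _ (fun x => (hK t ht x).2) fun x hx => F.dx_m_eq_zero (hT ht) hx
  set M := (∫ θ, |m₀ θ|) / 2
  have hM : 0 ≤ M := div_nonneg (integral_nonneg fun θ => abs_nonneg _) (by norm_num)
  have hmu : ∀ t ∈ Icc 0 T, ∀ x, |F.m x t * dx F.u x t| ≤ K * M := fun t ht x => by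
    rw [abs_mul, F.dx_u (hT ht)]
    exact mul_le_mul (hK t ht x).1 (F.abs_ux_le (hT ht) x) (abs_nonneg _) hK0
  simp only [blowUpCriteria, List.mem_cons, List.not_mem_nil, or_false, forall_eq_or_imp,
    forall_eq]
  refine ⟨fun h => ?_, fun h => ?_, fun h => ?_, fun h => ?_, fun h => ?_, fun h => ?_⟩
  · have : limsup (fun t => eLpNorm (fun x => F.m x t) ⊤ volume) (𝓝[<] T) ≤ _ :=
      limsup_le_of_le (by isBoundedDefault) (hev.mono fun t ht => hm ⊤ t ht)
    rw [h] at this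
    exact absurd (hCq ⊤) (not_lt.2 this)
  · obtain ⟨ξ, hξ, h0⟩ := h.2.1
    simp only [F.Xξ_eq hξ] at h0
    exact (hT ⟨hT0.le, le_rfl⟩ ξ).ne' h0
  · have : ((-(K * M * T) : ℝ) : EReal) ≤ liminf (fun t => ⨅ ξ ∈ Icc (-L) L,
        ((∫ s in (0 : ℝ)..t, F.m (F.X ξ s) s * dx F.u (F.X ξ s) s : ℝ) : EReal)) (𝓝[<] T) := by
      refine le_liminf_of_le (by isBoundedDefault) (hev.mono fun t ht => ?_)
      refine le_iInf₂ fun ξ hξ => EReal.coe_le_coe_iff.2 ?_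
      have h1 := intervalIntegral.norm_integral_le_of_norm_le_const (a := 0) (b := t)
        (f := fun s => F.m (F.X ξ s) s * dx F.u (F.X ξ s) s) (C := K * M) fun s hs => by
          rw [uIoc_of_le ht.1] at hs
          exact hmu s ⟨hs.1.le, hs.2.trans ht.2⟩ _
      rw [sub_zero, abs_of_nonneg ht.1, Real.norm_eq_abs] at h1
      have h2 : K * M * t ≤ K * M * T := mul_le_mul_of_nonneg_left ht.2 (by positivity)
      linarith [neg_le_of_abs_le h1]
    rw [h] at this
    exact absurd (EReal.bot_lt_coe _) (not_lt.2 this)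
  · have : ((-(K * M) : ℝ) : EReal) ≤ liminf (fun t => ⨅ x : ℝ,
        ((F.m x t * dx F.u x t : ℝ) : EReal)) (𝓝[<] T) := by
      refine le_liminf_of_le (by isBoundedDefault) (hev.mono fun t ht => ?_)
      exact le_iInf fun x => EReal.coe_le_coe_iff.2 (neg_le_of_abs_le (hmu t ht x))
    rw [h] at this
    exact absurd (EReal.bot_lt_coe _) (not_lt.2 this)
  · have : limsup (fun t => eLpNorm (fun x => F.m x t) p volume +
        eLpNorm (fun x => dx F.m x t) p volume) (𝓝[<] T) ≤ _ :=
      limsup_le_of_le (by isBoundedDefault)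
        (hev.mono fun t ht => add_le_add (hm p t ht) (hmx p t ht))
    rw [h] at this
    exact absurd (ENNReal.add_lt_top.2 ⟨hCq p, hCq p⟩) (not_lt.2 this)
  · have : ∫⁻ t in Ioo 0 T, eLpNorm (fun x => F.m x t) ⊤ volume ≤
        ∫⁻ _ in Ioo 0 T, (volume.restrict (Icc (-L) L)) univ ^ (⊤ : ℝ≥0∞).toReal⁻¹ *
          ENNReal.ofReal K :=
      setLIntegral_mono measurable_const fun t ht => hm ⊤ t (Ioo_subset_Icc_self ht)
    rw [h, setLIntegral_const] at this
    refine absurd (ENNReal.mul_lt_top (hCq ⊤) ?_) (not_lt.2 this)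
    simp

/-- Along the characteristic `X(ξ,·)`, `∫₀ᵗ m u_x ds = ½ log X_ξ`. -/
lemma integral_m_ux {T : ℝ} (hJ : ∀ t ∈ Ico 0 T, t ∈ F.J) {ξ : ℝ} (hξ : ξ ∈ Icc (-L) L) {t : ℝ}
    (ht : t ∈ Ico 0 T) :
    ∫ s in (0 : ℝ)..t, F.m (F.X ξ s) s * dx F.u (F.X ξ s) s = Real.log (F.Xd ξ t) / 2 := by
  have hsub : ∀ s ∈ uIcc 0 t, s ∈ F.J := fun s hs => by
    rw [uIcc_of_le ht.1] at hs
    exact hJ s ⟨hs.1, hs.2.trans_lt ht.2⟩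
  have hd : ∀ s ∈ uIcc 0 t, HasDerivAt (fun s => Real.log (F.Xd ξ s) / 2)
      (F.m (F.X ξ s) s * dx F.u (F.X ξ s) s) s := fun s hs => by
    have hs' := hsub s hs
    refine (((F.hasDerivAt_Xd_time ξ s).log (hs' ξ).ne').div_const 2).congr_deriv ?_
    rw [F.m_X hs', F.dx_u hs', F.ux_X hs' hξ]
    ring
  have hc : ContinuousOn (fun s => F.m (F.X ξ s) s * dx F.u (F.X ξ s) s) (uIcc 0 t) := by
    have h1 : ContinuousOn (fun s => m₀ ξ / F.Xd ξ s * (F.g ξ s / 2)) (uIcc 0 t) :=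
      (continuousOn_const.div (continuous_right F.continuous_Xd ξ).continuousOn
        fun s hs => (hsub s hs ξ).ne').mul
        ((continuous_right F.continuous_g ξ).div_const 2).continuousOn
    refine h1.congr fun s hs => ?_
    have hs' := hsub s hs
    simp only
    rw [F.m_X hs', F.dx_u hs', F.ux_X hs' hξ]
  rw [intervalIntegral.integral_eq_sub_of_hasDerivAt hd hc.intervalIntegrable, F.Xd_zero]
  simp

/-- All the criteria hold at the time at which the flow degenerates. -/
lemma blowUpCriteria_of_degenerate {T : ℝ} (hT0 : 0 < T) (hJ : ∀ t ∈ Ico 0 T, t ∈ F.J)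
    (hX : ∃ ξ ∈ Icc (-L) L, F.Xd ξ T = 0) (hnn : ∀ ξ, 0 ≤ F.Xd ξ T) {p : ℝ≥0∞} (hp : 1 ≤ p) :
    ∀ P ∈ blowUpCriteria L F.X F.u F.m p T, P := by
  obtain ⟨ξ, hξ, h0⟩ := hX
  have hm0 : m₀ ξ ≠ 0 := fun h => by
    rw [F.Xd_eq_one h] at h0
    exact one_ne_zero h0
  have hev : ∀ᶠ t in 𝓝[<] T, t ∈ Ico 0 T := by
    filter_upwards [Ioo_mem_nhdsLT hT0] with t ht using Ioo_subset_Ico_self ht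
  have hXd : Tendsto (fun t => F.Xd ξ t) (𝓝[<] T) (𝓝[>] 0) := by
    refine tendsto_nhdsWithin_iff.2 ⟨?_, hev.mono fun t ht => hJ t ht ξ⟩
    have := ((continuous_right F.continuous_Xd ξ).tendsto T).mono_left
      (nhdsWithin_le_nhds (s := Iio T))
    rwa [h0] at this
  have hlog : Tendsto (fun t => Real.log (F.Xd ξ t) / 2) (𝓝[<] T) atBot :=
    (Real.tendsto_log_nhdsGT_zero.comp hXd).atBot_div_const (by norm_num)
  have hmX : Tendsto (fun t => ‖F.m (F.X ξ t) t‖ₑ) (𝓝[<] T) (𝓝 ⊤) := by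
    have h1 : Tendsto (fun t => |m₀ ξ| * (F.Xd ξ t)⁻¹) (𝓝[<] T) atTop :=
      (tendsto_inv_nhdsGT_zero.comp hXd).const_mul_atTop (abs_pos.2 hm0)
    refine (ENNReal.tendsto_ofReal_atTop.comp h1).congr' (hev.mono fun t ht => ?_)
    change ENNReal.ofReal (|m₀ ξ| * (F.Xd ξ t)⁻¹) = ‖F.m (F.X ξ t) t‖ₑ
    rw [F.m_X (hJ t ht), Real.enorm_eq_ofReal_abs, abs_div, abs_of_pos (hJ t ht ξ)]
    simp [div_eq_mul_inv]
  have hsup : Tendsto (fun t => eLpNorm (fun x => F.m x t) ⊤ volume) (𝓝[<] T) (𝓝 ⊤) :=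
    tendsto_nhds_top_mono hmX (hev.mono fun t ht =>
      enorm_le_eLpNorm_top (F.continuous_m (hJ t ht)) _)
  simp only [blowUpCriteria, List.mem_cons, List.not_mem_nil, or_false, forall_eq_or_imp,
    forall_eq]
  refine ⟨hsup.limsup_eq, ⟨fun η hη t ht => ?_, ⟨ξ, hξ, ?_⟩, ?_⟩, ?_, ?_, ?_, ?_⟩
  · rw [F.Xξ_eq hη]
    exact hJ t ht η
  · simp only [F.Xξ_eq hξ, h0]
  · rintro _ ⟨η, hη, rfl⟩
    simp only [F.Xξ_eq hη]
    exact hnn η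
  · refine Tendsto.liminf_eq (tendsto_nhds_bot_mono (EReal.tendsto_coe_nhds_bot_iff.2 hlog)
      (hev.mono fun t ht => ?_))
    refine (iInf₂_le ξ hξ).trans_eq ?_
    rw [F.integral_m_ux hJ hξ ht]
  · -- A lower bound `c` for `m u_x` near `T` makes `½ log X_ξ - c t` increasing.
    by_contra hne
    obtain ⟨c, -, hc⟩ := EReal.lt_iff_exists_real_btwn.1 (bot_lt_iff_ne_bot.2 hne)
    have hev2 := eventually_lt_of_lt_liminf hc
    obtain ⟨T', hT', hsub⟩ := (mem_nhdsLT_iff_exists_Ioo_subset).1 (hev2.and hev)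
    have hmono : MonotoneOn (fun t => Real.log (F.Xd ξ t) / 2 - c * t) (Ioo T' T) := by
      have hd : ∀ t ∈ Ioo T' T, HasDerivAt (fun t => Real.log (F.Xd ξ t) / 2 - c * t)
          (F.m (F.X ξ t) t * dx F.u (F.X ξ t) t - c) t := fun t ht => by
        have ht' := hJ t (hsub ht).2
        refine ((((F.hasDerivAt_Xd_time ξ t).log (ht' ξ).ne').div_const 2).sub
          ((hasDerivAt_id t).const_mul c)).congr_deriv ?_
        rw [F.m_X ht', F.dx_u ht', F.ux_X ht' hξ]
        ring
      refine monotoneOn_of_hasDerivWithinAt_nonneg (convex_Ioo _ _)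
        (fun t ht => (hd t ht).continuousAt.continuousWithinAt)
        (f' := fun t => F.m (F.X ξ t) t * dx F.u (F.X ξ t) t - c)
        (fun t ht => (hd t (interior_subset ht)).hasDerivWithinAt) fun t ht => ?_
      have h1 : (c : EReal) < _ := (hsub (interior_subset ht)).1
      have h2 := h1.trans_le (iInf_le (fun x : ℝ => ((F.m x t * dx F.u x t : ℝ) : EReal)) (F.X ξ t))
      have h3 : c < F.m (F.X ξ t) t * dx F.u (F.X ξ t) t := EReal.coe_lt_coe_iff.1 h2
      linarith
    have hT'T : T' < T := hT'
    obtain ⟨s, hs⟩ := exists_between hT'T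
    set D := Real.log (F.Xd ξ s) / 2 - c * s
    have h4 := hlog.eventually_lt_atBot (D - |c| * (|T'| + |T|))
    have h5 : ∀ᶠ t in 𝓝[<] T, t ∈ Ioo s T := Ioo_mem_nhdsLT hs.2
    obtain ⟨t, ht4, ht5⟩ := (h4.and h5).exists
    have h6 : D ≤ Real.log (F.Xd ξ t) / 2 - c * t :=
      hmono hs ⟨hs.1.trans ht5.1, ht5.2⟩ ht5.1.le
    have h7 : -(|c| * (|T'| + |T|)) ≤ c * t := by
      have h8 : |t| ≤ |T'| + |T| := abs_le.2
        ⟨by linarith [neg_abs_le T', abs_nonneg T, hs.1, ht5.1],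
          by linarith [le_abs_self T, abs_nonneg T', ht5.2]⟩
      have h9 := neg_abs_le (c * t)
      rw [abs_mul] at h9
      have := mul_le_mul_of_nonneg_left h8 (abs_nonneg c)
      linarith
    linarith
  · obtain ⟨C, hC, hbound⟩ := exists_enorm_le_eLpNorm_deriv (a := -L) (b := L) hp
    have h1 : Tendsto (fun t => ‖F.m (F.X ξ t) t‖ₑ / C) (𝓝[<] T) (𝓝 ⊤) := by
      have := ENNReal.Tendsto.div_const hmX (b := C) (Or.inl ENNReal.top_ne_zero)
      rwa [ENNReal.top_div_of_ne_top hC] at this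
    refine Tendsto.limsup_eq (tendsto_nhds_top_mono h1 (hev.mono fun t ht => ?_))
    have ht' := hJ t ht
    refine le_trans ?_ le_add_self
    refine ENNReal.div_le_of_le_mul ?_
    refine hbound (fun x => F.m x t) _ (fun x => F.hasDerivAt_m ht' x) (F.continuous_dx_m ht') ?_ _
      (F.X_mem_Icc (F.strictMono_X ht').monotone hξ)
    exact image_eq_zero_of_notMem_tsupport (f := fun y => F.m y t) fun h =>
      absurd (F.tsupport_m ht' h).1 (lt_irrefl _)
  · -- A finite time integral of the norm would bound `½ log X_ξ = ∫ m u_x`.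
    by_contra hne
    set S := ∫⁻ t in Ioo 0 T, eLpNorm (fun x => F.m x t) ⊤ volume
    have hS : S ≠ ⊤ := hne
    set M := (∫ θ, |m₀ θ|) / 2
    have hb : ∀ t ∈ Ico 0 T, ‖Real.log (F.Xd ξ t) / 2‖ₑ ≤ ENNReal.ofReal M * S := by
      intro t ht
      rw [← F.integral_m_ux hJ hξ ht, intervalIntegral.integral_of_le ht.1]
      calc _ ≤ ∫⁻ s in Ioc 0 t, ‖F.m (F.X ξ s) s * dx F.u (F.X ξ s) s‖ₑ :=
            enorm_integral_le_lintegral_enorm _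
        _ ≤ ∫⁻ s in Ioo 0 T, ‖F.m (F.X ξ s) s * dx F.u (F.X ξ s) s‖ₑ :=
            lintegral_mono_set fun s hs => ⟨hs.1, hs.2.trans_lt ht.2⟩
        _ ≤ ∫⁻ s in Ioo 0 T, ENNReal.ofReal M * eLpNorm (fun x => F.m x s) ⊤ volume := by
            refine setLIntegral_mono' measurableSet_Ioo fun s hs => ?_
            have hs' := hJ s (Ioo_subset_Ico_self hs)
            rw [enorm_mul, mul_comm]
            refine mul_le_mul' ?_ (enorm_le_eLpNorm_top (F.continuous_m hs') _)
            rw [Real.enorm_eq_ofReal_abs, F.dx_u hs']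
            exact ENNReal.ofReal_le_ofReal (F.abs_ux_le hs' _)
        _ = ENNReal.ofReal M * S := lintegral_const_mul' _ _ ENNReal.ofReal_ne_top
    have hfin : ENNReal.ofReal M * S ≠ ⊤ := ENNReal.mul_ne_top ENNReal.ofReal_ne_top hS
    have h4 := hlog.eventually_lt_atBot (-(ENNReal.ofReal M * S).toReal)
    obtain ⟨t, ht4, ht⟩ := (h4.and hev).exists
    have h5 := ENNReal.toReal_mono hfin (hb t ht)
    rw [toReal_enorm, Real.norm_eq_abs] at h5
    linarith [neg_le_of_abs_le h5]

end CutoffFlow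

/-! ### Total variation of `u` and `u_x` -/

lemma eVariationOn_le_of_dominated {f Φ : ℝ → ℝ} {c : ℝ}
    (h : ∀ x y, x ≤ y → |f y - f x| ≤ Φ y - Φ x) (hΦ : ∀ x, Φ x ∈ Icc 0 c) :
    eVariationOn f univ ≤ ENNReal.ofReal c := by
  refine iSup_le fun ⟨n, v, hv, _⟩ => ?_
  calc ∑ i ∈ Finset.range n, edist (f (v (i + 1))) (f (v i))
      ≤ ∑ i ∈ Finset.range n, ENNReal.ofReal (Φ (v (i + 1)) - Φ (v i)) := by
        refine Finset.sum_le_sum fun i _ => ?_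
        rw [edist_dist, Real.dist_eq]
        exact ENNReal.ofReal_le_ofReal (h _ _ (hv i.le_succ))
    _ = ENNReal.ofReal (Φ (v n) - Φ (v 0)) := by
        rw [← ENNReal.ofReal_sum_of_nonneg fun i _ => (abs_nonneg _).trans (h _ _ (hv i.le_succ)),
          Finset.sum_range_sub (fun i => Φ (v i))]
    _ ≤ ENNReal.ofReal c := ENNReal.ofReal_le_ofReal (by linarith [(hΦ (v n)).2, (hΦ (v 0)).1])

/-- If the variation of a kernel `K` is dominated by that of a function `P` with values in
`[0, c]`, then a superposition of translates of `K` with weight `w` has variation at most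
`c ‖w‖_{L¹}`. -/
lemma eVariationOn_superposition_le {K P w Y : ℝ → ℝ} {C c : ℝ} (hw : Integrable w)
    (hY : Measurable Y) (hK : Measurable K) (hP : Measurable P) (hKC : ∀ x, |K x| ≤ C)
    (hdom : ∀ x y, x ≤ y → |K y - K x| ≤ P y - P x) (hPc : ∀ x, P x ∈ Icc 0 c) :
    eVariationOn (fun x => ∫ θ, K (x - Y θ) * w θ) univ ≤ ENNReal.ofReal (c * ∫ θ, |w θ|) := by
  have hKi : ∀ x, Integrable fun θ => K (x - Y θ) * w θ := fun x =>
    hw.bdd_mul (hK.comp (measurable_const.sub hY)).aestronglyMeasurable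
      (Eventually.of_forall fun θ => hKC _)
  have hPi : ∀ x, Integrable fun θ => P (x - Y θ) * |w θ| := fun x =>
    hw.abs.bdd_mul (hP.comp (measurable_const.sub hY)).aestronglyMeasurable
      (Eventually.of_forall fun θ => by
        rw [Real.norm_eq_abs, abs_of_nonneg (hPc _).1]
        exact (hPc _).2)
  refine eVariationOn_le_of_dominated (Φ := fun x => ∫ θ, P (x - Y θ) * |w θ|)
    (fun x y hxy => ?_) fun x => ⟨integral_nonneg fun θ =>
      mul_nonneg (hPc _).1 (abs_nonneg _), ?_⟩
  · rw [← integral_sub (hKi y) (hKi x), ← integral_sub (hPi y) (hPi x)]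
    refine (abs_integral_le_integral_abs).trans (integral_mono ((hKi y).sub (hKi x)).abs
      ((hPi y).sub (hPi x)) fun θ => ?_)
    simp only
    rw [← sub_mul, abs_mul, ← sub_mul]
    exact mul_le_mul_of_nonneg_right (hdom _ _ (by linarith)) (abs_nonneg _)
  · rw [← integral_const_mul]
    exact integral_mono (hPi x) (hw.abs.const_mul c) fun θ =>
      mul_le_mul_of_nonneg_right (hPc _).2 (abs_nonneg _)

/-- The primitive of `G` that vanishes at `-∞`. -/
def GInt (x : ℝ) : ℝ := if x ≤ 0 then G x else 1 - G x

/-- The normalised Heaviside function; `G' = GInt - heaviside` exhibits `G'` as a difference of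
increasing functions, each of total variation `1`. -/
def heaviside (x : ℝ) : ℝ := (1 + (SignType.sign x : ℝ)) / 2

lemma G_nonneg (x : ℝ) : 0 ≤ G x := by unfold G; positivity

lemma G_le (x : ℝ) : G x ≤ 1 / 2 := (le_abs_self _).trans (abs_G_le x)

lemma measurable_sign : Measurable fun x : ℝ => (SignType.sign x : ℝ) := by
  have : (fun x : ℝ => (SignType.sign x : ℝ)) =
      fun x => if 0 < x then 1 else if x < 0 then -1 else 0 := by
    ext x
    rcases lt_trichotomy x 0 with h | h | h
    · simp [sign_neg h, h, h.le.not_gt]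
    · simp [h]
    · simp [sign_pos h, h]
  rw [this]
  exact Measurable.ite measurableSet_Ioi measurable_const
    (Measurable.ite measurableSet_Iio measurable_const measurable_const)

lemma measurable_G' : Measurable G' := measurable_sign.neg.mul continuous_G.measurable

lemma measurable_GInt : Measurable GInt :=
  Measurable.ite measurableSet_Iic continuous_G.measurable
    (measurable_const.sub continuous_G.measurable)

lemma measurable_heaviside : Measurable heaviside :=
  (measurable_const.add measurable_sign).div_const 2

lemma GInt_mem (x : ℝ) : GInt x ∈ Icc (0 : ℝ) 1 := by
  have h1 := G_nonneg x
  have h2 := G_le x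
  unfold GInt
  split_ifs <;> constructor <;> linarith

lemma heaviside_mem (x : ℝ) : heaviside x ∈ Icc (0 : ℝ) 1 := by
  unfold heaviside
  rcases lt_trichotomy x 0 with h | h | h
  · simp [sign_neg h]
  · norm_num [h]
  · norm_num [sign_pos h]

lemma G'_eq (x : ℝ) : G' x = GInt x - heaviside x := by
  rcases lt_trichotomy x 0 with h | h | h
  · simp [GInt, heaviside, h.le, G'_of_neg h, sign_neg h]
  · simp [h, GInt, heaviside, G', G]
  · simp only [GInt, heaviside, h.not_ge, if_false, G'_of_pos h, sign_pos h, SignType.coe_one]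
    ring

lemma abs_G_sub_le {x y : ℝ} (h : x ≤ y) : |G y - G x| ≤ GInt y - GInt x := by
  rcases le_or_gt y 0 with hy | hy
  · have hx := h.trans hy
    simp only [GInt, hx, hy, if_true]
    refine (abs_of_nonneg ?_).le
    rw [G_of_nonpos hx, G_of_nonpos hy]
    have := Real.exp_le_exp.2 h
    linarith
  · rcases le_or_gt x 0 with hx | hx
    · simp only [GInt, hx, hy.not_ge, if_true, if_false]
      have h1 := G_le x
      have h2 := G_le y
      rw [abs_le]
      constructor <;> linarith
    · simp only [GInt, hx.not_ge, hy.not_ge, if_false]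
      have h1 : G y ≤ G x := by
        rw [G_of_nonneg hx.le, G_of_nonneg hy.le]
        have := Real.exp_le_exp.2 (neg_le_neg h)
        linarith
      rw [abs_of_nonpos (by linarith)]
      linarith

lemma heaviside_mono : Monotone heaviside := fun x y h => by
  unfold heaviside
  have : (SignType.sign x : ℝ) ≤ SignType.sign y := by
    rcases lt_trichotomy x 0 with hx | hx | hx
    · rw [sign_neg hx]
      rcases lt_trichotomy y 0 with hy | hy | hy
      · simp [sign_neg hy]
      · simp [hy]
      · simp only [sign_pos hy, SignType.coe_neg_one, SignType.coe_one]; norm_num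
    · rcases h.lt_or_eq with hy | hy
      · rw [hx] at hy
        simp [hx, sign_pos hy]
      · rw [hy]
    · rw [sign_pos hx, sign_pos (hx.trans_le h)]
  linarith

lemma abs_G'_sub_le {x y : ℝ} (h : x ≤ y) :
    |G' y - G' x| ≤ (GInt y + heaviside y) - (GInt x + heaviside x) := by
  have h1 := (abs_nonneg _).trans (abs_G_sub_le h)
  have h2 := heaviside_mono h
  rw [G'_eq, G'_eq, abs_le]
  constructor <;> linarith

/-- On a bounded set of positions, the kernels decay exponentially. -/
lemma abs_G_sub_le_exp {x y L : ℝ} (h : |y| ≤ L) : |G (x - y)| ≤ Real.exp (L - |x|) := by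
  rw [abs_of_nonneg (G_nonneg _), G]
  have h1 : -|x - y| ≤ L - |x| := by
    have := abs_sub_abs_le_abs_sub x y
    linarith
  have h2 := Real.exp_le_exp.2 h1
  have h3 := Real.exp_pos (-|x - y|)
  linarith

lemma abs_G'_le_abs_G (x : ℝ) : |G' x| ≤ |G x| := by
  rcases lt_trichotomy x 0 with h | h | h
  · rw [G'_of_neg h]
  · simp [h, G']
  · rw [G'_of_pos h, abs_neg]

lemma integrable_exp_sub_abs (L : ℝ) : Integrable fun x : ℝ => Real.exp (L - |x|) := by
  rw [← integrableOn_univ, ← Iic_union_Ioi (a := (0 : ℝ))]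
  refine IntegrableOn.union ?_ ?_
  · refine IntegrableOn.congr_fun ((integrableOn_exp_Iic 0).const_mul (Real.exp L))
      (fun x hx => ?_) measurableSet_Iic
    rw [abs_of_nonpos hx, ← Real.exp_add, sub_neg_eq_add]
  · refine IntegrableOn.congr_fun ((integrableOn_exp_neg_Ioi 0).const_mul (Real.exp L))
      (fun x hx => ?_) measurableSet_Ioi
    rw [abs_of_pos hx, ← Real.exp_add, sub_eq_add_neg]

namespace CutoffFlow

variable {k : ℕ} {L : ℝ} {m₀ : ℝ → ℝ} (F : CutoffFlow k L m₀)

include F in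
lemma eVariationOn_le {K P Y : ℝ → ℝ} {c : ℝ}
    (hY : Measurable Y) (hK : Measurable K) (hP : Measurable P) (hKC : ∀ x, |K x| ≤ 1 / 2)
    (hdom : ∀ x y, x ≤ y → |K y - K x| ≤ P y - P x) (hPc : ∀ x, P x ∈ Icc 0 c) :
    eVariationOn (fun x => ∫ θ in (-L)..L, K (x - Y θ) * m₀ θ) univ ≤
      ENNReal.ofReal (c * ∫ θ, |m₀ θ|) := by
  have h := eVariationOn_superposition_le F.integrable_m₀ hY hK hP hKC hdom hPc
  simpa only [F.integral_mul_m₀] using h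

lemma eVariationOn_u {t : ℝ} :
    eVariationOn (fun x => ∫ θ in (-L)..L, G (x - F.X θ t) * m₀ θ) univ ≤
      ENNReal.ofReal (∫ θ, |m₀ θ|) := by
  have h := F.eVariationOn_le (continuous_left F.continuous_X t).measurable
    continuous_G.measurable measurable_GInt abs_G_le (fun x y => abs_G_sub_le) GInt_mem
  rwa [one_mul] at h

lemma eVariationOn_ux {t : ℝ} :
    eVariationOn (fun x => ∫ θ in (-L)..L, G' (x - F.X θ t) * m₀ θ) univ ≤
      ENNReal.ofReal (2 * ∫ θ, |m₀ θ|) := by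
  refine F.eVariationOn_le (P := fun x => GInt x + heaviside x)
    (continuous_left F.continuous_X t).measurable
    measurable_G' (measurable_GInt.add measurable_heaviside) abs_G'_le
    (fun x y => abs_G'_sub_le) fun x => ?_
  have h1 := GInt_mem x
  have h2 := heaviside_mem x
  exact ⟨by linarith [h1.1, h2.1], by linarith [h1.2, h2.2]⟩

lemma abs_X_le {t : ℝ} (hX : Monotone fun ξ => F.X ξ t) {ξ : ℝ} (hξ : m₀ ξ ≠ 0) :
    |F.X ξ t| ≤ L :=
  abs_le.2 (F.X_mem_Icc hX (Ioo_subset_Icc_self (by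
    by_contra h
    exact hξ (F.m₀_eq_zero h))))

lemma abs_u_le_exp {t : ℝ} (ht : t ∈ F.J) (x : ℝ) :
    |F.u x t| ≤ Real.exp (L - |x|) * ∫ θ, |m₀ θ| := by
  rw [F.u_eq_integral ht]
  exact abs_intervalIntegral_le_of_ne_zero F.integrable_m₀ fun θ hθ =>
    abs_G_sub_le_exp (F.abs_X_le (F.strictMono_X ht).monotone hθ)

lemma abs_ux_le_exp {t : ℝ} (ht : t ∈ F.J) (x : ℝ) :
    |F.ux x t| ≤ Real.exp (L - |x|) * ∫ θ, |m₀ θ| := by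
  rw [F.ux_eq_integral ht]
  exact abs_intervalIntegral_le_of_ne_zero F.integrable_m₀ fun θ hθ =>
    (abs_G'_le_abs_G _).trans
      (abs_G_sub_le_exp (F.abs_X_le (F.strictMono_X ht).monotone hθ))

end CutoffFlow

lemma BVBound.of_exp_bound {f : ℝ → ℝ} {L C M : ℝ} (hf : AEStronglyMeasurable f)
    (hb : ∀ x, |f x| ≤ Real.exp (L - |x|) * C) (hv : eVariationOn f univ ≤ ENNReal.ofReal M) :
    BVBound f M :=
  ⟨⟨((integrable_exp_sub_abs L).mul_const C).mono' hf (Eventually.of_forall hb),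
    (hv.trans_lt ENNReal.ofReal_lt_top).ne⟩, hv⟩

/-- A uniform bound of exponential decay and a uniform bound of the variation pass to pointwise
limits. -/
lemma BVBound.of_tendsto {f : ℝ → ℝ → ℝ} {f₀ : ℝ → ℝ} {L C M T : ℝ}
    (hf : ∀ᶠ t in 𝓝[<] T, AEStronglyMeasurable (fun x => f x t) ∧
      (∀ x, |f x t| ≤ Real.exp (L - |x|) * C) ∧
      eVariationOn (fun x => f x t) univ ≤ ENNReal.ofReal M)
    (hlim : ∀ x, Tendsto (fun t => f x t) (𝓝[<] T) (𝓝 (f₀ x))) : BVBound f₀ M := by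
  refine BVBound.of_exp_bound (L := L) (C := C) ?_ (fun x => ?_) ?_
  · obtain ⟨v, hv⟩ := exists_seq_tendsto (𝓝[<] T)
    obtain ⟨N, hN⟩ := eventually_atTop.1 (hv.eventually hf)
    exact aestronglyMeasurable_of_tendsto_ae atTop
      (f := fun n x => f x (v (n + N))) (fun n => (hN _ (Nat.le_add_left _ _)).1)
      (Eventually.of_forall fun x => ((hlim x).comp hv).comp (tendsto_add_atTop_nat N))
  · exact le_of_tendsto (hlim x).abs (hf.mono fun t ht => ht.2.1 x)
  · refine le_of_forall_lt fun v hv => ?_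
    obtain ⟨t, ht, ht'⟩ :=
      ((eVariationOn.lowerSemicontinuous_aux (fun x _ => hlim x) hv).and hf).exists
    exact ht.trans_le ht'.2.2

namespace CutoffFlow

variable {k : ℕ} {L : ℝ} {m₀ : ℝ → ℝ} (F : CutoffFlow k L m₀)

lemma continuous_ux {t : ℝ} (ht : t ∈ F.J) : Continuous fun x => F.ux x t :=
  (F.spaceC_ux.contDiff ht).continuous

lemma continuous_u {t : ℝ} (ht : t ∈ F.J) : Continuous fun x => F.u x t :=
  (F.spaceC_u.contDiff ht).continuous

lemma variation_u_le {t : ℝ} (ht : t ∈ F.J) :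
    eVariationOn (fun x => F.u x t) univ ≤ ENNReal.ofReal (∫ θ, |m₀ θ|) := by
  rw [show (fun x => F.u x t) = _ from funext fun x => F.u_eq_integral ht x]
  exact F.eVariationOn_u

lemma variation_ux_le {t : ℝ} (ht : t ∈ F.J) :
    eVariationOn (fun x => F.ux x t) univ ≤ ENNReal.ofReal (2 * ∫ θ, |m₀ θ|) := by
  rw [show (fun x => F.ux x t) = _ from funext fun x => F.ux_eq_integral ht x]
  exact F.eVariationOn_ux

lemma bvBound_u {t : ℝ} (ht : t ∈ F.J) : BVBound (fun x => F.u x t) (∫ θ, |m₀ θ|) :=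
  BVBound.of_exp_bound (F.continuous_u ht).aestronglyMeasurable (F.abs_u_le_exp ht)
    (F.variation_u_le ht)

lemma bvBound_ux {t : ℝ} (ht : t ∈ F.J) : BVBound (fun x => F.ux x t) (2 * ∫ θ, |m₀ θ|) :=
  BVBound.of_exp_bound (F.continuous_ux ht).aestronglyMeasurable (F.abs_ux_le_exp ht)
    (F.variation_ux_le ht)

/-! ### The limit of `u` and `u_x` at the time of degeneration -/

lemma tendsto_u {T : ℝ} (hev : ∀ᶠ t in 𝓝[<] T, t ∈ F.J) (x : ℝ) :
    Tendsto (fun t => F.u x t) (𝓝[<] T)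
      (𝓝 (∫ θ in (-L)..L, G (x - F.X θ T) * m₀ θ)) := by
  refine Tendsto.congr' (hev.mono fun t ht => (F.u_eq_integral ht x).symm) ?_
  refine intervalIntegral.tendsto_integral_filter_of_dominated_convergence
    (fun θ => 1 / 2 * |m₀ θ|) (Eventually.of_forall fun t => ?_)
    (Eventually.of_forall fun t => Eventually.of_forall fun θ _ => ?_)
    (F.integrable_m₀.abs.const_mul _).intervalIntegrable
    (Eventually.of_forall fun θ _ => ?_)
  · exact ((continuous_G.comp (continuous_const.sub (continuous_left F.continuous_X t))).mul
      F.continuous_m₀).aestronglyMeasurable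
  · rw [Real.norm_eq_abs, abs_mul]
    exact mul_le_mul_of_nonneg_right (abs_G_le _) (abs_nonneg _)
  · have h : Continuous fun t => G (x - F.X θ t) * m₀ θ :=
      (continuous_G.comp (continuous_const.sub (continuous_right F.continuous_X θ))).mul
        continuous_const
    exact (h.tendsto T).mono_left nhdsWithin_le_nhds

lemma Ep_pos {x : ℝ} (hx : x ∈ Icc (-L) L) : 0 < F.Ep x := by
  rw [F.Ep_eq x hx]
  positivity

lemma Em_pos {x : ℝ} (hx : x ∈ Icc (-L) L) : 0 < F.Em x := by
  rw [F.Em_eq x hx]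
  positivity

/-- Between two labels with the same position, all labels have this position, so that `X_ξ`
vanishes and `m₀` does not. -/
lemma m₀_ne_zero_of_X_eq {T a b c : ℝ} (hmono : Monotone fun ξ => F.X ξ T)
    (hab : F.X a T = F.X b T) (hc : c ∈ Ioo a b) : m₀ c ≠ 0 := by
  intro h0
  have h1 : (fun ξ => F.X ξ T) =ᶠ[𝓝 c] fun _ => F.X a T := by
    filter_upwards [Ioo_mem_nhds hc.1 hc.2] with ξ hξ
    exact le_antisymm ((hmono hξ.2.le).trans_eq hab.symm) (hmono hξ.1.le)
  have h2 := ((F.hasDerivAt_X c T).congr_of_eventuallyEq h1.symm).unique (hasDerivAt_const c _)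
  rw [F.Xd_eq_one h0] at h2
  exact one_ne_zero h2

lemma X_mem_Icc_of_ne_zero {T c : ℝ} (hmono : Monotone fun ξ => F.X ξ T) (h : m₀ c ≠ 0) :
    F.X c T ∈ Icc (-L) L := abs_le.1 (F.abs_X_le hmono h)

/-- Among the labels that have reached the same position, at most two have speed zero: one zero of
`A` and one of `B`, by Rolle's theorem. -/
lemma ae_velocity_ne_zero {T : ℝ} (hmono : Monotone fun ξ => F.X ξ T) (x : ℝ) :
    ∀ᵐ θ, F.X θ T = x → F.V θ T ≠ 0 := by
  have key : ∀ f f' : ℝ → ℝ, (∀ ξ, HasDerivAt f (f' ξ) ξ) →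
      (∀ ξ, m₀ ξ ≠ 0 → f' ξ ≠ 0) → {θ | F.X θ T = x ∧ f θ = 0}.Subsingleton := by
    intro f f' hf hf' a ha b hb
    by_contra hab
    wlog hlt : a < b generalizing a b
    · exact this hb ha (Ne.symm hab) ((Ne.lt_or_gt hab).resolve_left hlt)
    obtain ⟨c, hc, h0⟩ := exists_hasDerivAt_eq_zero hlt
      (fun ξ _ => (hf ξ).continuousAt.continuousWithinAt) (ha.2.trans hb.2.symm)
      fun ξ _ => hf ξ
    exact hf' c (F.m₀_ne_zero_of_X_eq hmono (ha.1.trans hb.1.symm) hc) h0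
  have hA := key (fun ξ => F.A ξ T) _ (fun ξ => F.hasDerivAt_A ξ T) fun ξ h =>
    mul_ne_zero (F.Ep_pos (F.X_mem_Icc_of_ne_zero hmono h)).ne' h
  have hB := key (fun ξ => F.B ξ T) _ (fun ξ => F.hasDerivAt_B ξ T) fun ξ h =>
    neg_ne_zero.2 (mul_ne_zero (F.Em_pos (F.X_mem_Icc_of_ne_zero hmono h)).ne' h)
  have hnull := (hA.finite.countable.union hB.finite.countable).measure_zero volume
  refine measure_mono_null (fun θ hθ => ?_) hnull
  simp only [mem_compl_iff, mem_ofPred_eq, Classical.not_imp, not_not] at hθ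
  exact (mul_eq_zero.1 hθ.2).imp (fun h => ⟨hθ.1, h⟩) fun h => ⟨hθ.1, h⟩

/-- `G'(x - X(θ,t))` converges as `t → T`, unless `X(θ,·)` reaches `x` at time `T` with speed
zero. -/
lemma exists_tendsto_G' {T x θ : ℝ} (h : F.X θ T = x → F.V θ T ≠ 0) :
    ∃ l, Tendsto (fun t => G' (x - F.X θ t)) (𝓝[<] T) (𝓝 l) := by
  have hG : Tendsto (fun t => G (x - F.X θ t)) (𝓝[<] T) (𝓝 (G (x - F.X θ T))) :=
    ((continuous_G.comp (continuous_const.sub (continuous_right F.continuous_X θ))).tendsto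
      T).mono_left nhdsWithin_le_nhds
  have hneg : (∀ᶠ t in 𝓝[<] T, x - F.X θ t < 0) →
      ∃ l, Tendsto (fun t => G' (x - F.X θ t)) (𝓝[<] T) (𝓝 l) := fun h =>
    ⟨_, hG.congr' (h.mono fun t ht => (G'_of_neg ht).symm)⟩
  have hpos : (∀ᶠ t in 𝓝[<] T, 0 < x - F.X θ t) →
      ∃ l, Tendsto (fun t => G' (x - F.X θ t)) (𝓝[<] T) (𝓝 l) := fun h =>
    ⟨_, hG.neg.congr' (h.mono fun t ht => (G'_of_pos ht).symm)⟩
  have hc : Tendsto (fun t => x - F.X θ t) (𝓝[<] T) (𝓝 (x - F.X θ T)) :=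
    ((continuous_const.sub (continuous_right F.continuous_X θ)).tendsto T).mono_left
      nhdsWithin_le_nhds
  rcases lt_trichotomy (F.X θ T) x with hx | hx | hx
  · exact hpos (hc.eventually (lt_mem_nhds (sub_pos.2 hx)))
  · have hs := hasDerivAt_iff_tendsto_slope_left_right.1 (F.hasDerivAt_X_time θ T)
    rcases (h hx).lt_or_gt with hV | hV
    · refine hneg (((hs.1.eventually (gt_mem_nhds hV)).and self_mem_nhdsWithin).mono
        fun t ht => ?_)
      have h1 : 0 < F.X θ t - F.X θ T := by
        have h2 : (t - T)⁻¹ * (F.X θ t - F.X θ T) < 0 := ht.1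
        have h3 : (t - T)⁻¹ < 0 := inv_lt_zero.2 (sub_neg.2 ht.2)
        by_contra h4
        exact absurd h2 (not_lt.2 (mul_nonneg_of_nonpos_of_nonpos h3.le (not_lt.1 h4)))
      linarith
    · refine hpos (((hs.1.eventually (lt_mem_nhds hV)).and self_mem_nhdsWithin).mono
        fun t ht => ?_)
      have h1 : F.X θ t - F.X θ T < 0 := by
        have h2 : 0 < (t - T)⁻¹ * (F.X θ t - F.X θ T) := ht.1
        have h3 : (t - T)⁻¹ < 0 := inv_lt_zero.2 (sub_neg.2 ht.2)
        by_contra h4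
        exact absurd h2 (not_lt.2 (mul_nonpos_of_nonpos_of_nonneg h3.le (not_lt.1 h4)))
      linarith
  · exact hneg (hc.eventually (gt_mem_nhds (sub_neg.2 hx)))

/-- The limit is obtained by dominated convergence in the label integral for `u_x`. -/
lemma exists_tendsto_ux {T : ℝ} (hev : ∀ᶠ t in 𝓝[<] T, t ∈ F.J)
    (hmono : Monotone fun ξ => F.X ξ T) (x : ℝ) :
    ∃ l, Tendsto (fun t => F.ux x t) (𝓝[<] T) (𝓝 l) := by
  classical
  let l : ℝ → ℝ := fun θ =>
    if h : ∃ l, Tendsto (fun t => G' (x - F.X θ t)) (𝓝[<] T) (𝓝 l) then h.choose else 0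
  have hl : ∀ᵐ θ, Tendsto (fun t => G' (x - F.X θ t)) (𝓝[<] T) (𝓝 (l θ)) := by
    filter_upwards [F.ae_velocity_ne_zero hmono x] with θ hθ
    have h := F.exists_tendsto_G' hθ
    simp only [l, dif_pos h]
    exact h.choose_spec
  refine ⟨∫ θ in (-L)..L, l θ * m₀ θ,
    Tendsto.congr' (hev.mono fun t ht => (F.ux_eq_integral ht x).symm) ?_⟩
  refine intervalIntegral.tendsto_integral_filter_of_dominated_convergence
    (fun θ => 1 / 2 * |m₀ θ|) (Eventually.of_forall fun t => ?_)
    (Eventually.of_forall fun t => Eventually.of_forall fun θ _ => ?_)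
    (F.integrable_m₀.abs.const_mul _).intervalIntegrable
    (hl.mono fun θ hθ _ => hθ.mul_const _)
  · exact ((measurable_G'.comp (measurable_const.sub
      (continuous_left F.continuous_X t).measurable)).mul
        F.continuous_m₀.measurable).aestronglyMeasurable
  · rw [Real.norm_eq_abs, abs_mul]
    exact mul_le_mul_of_nonneg_right (abs_G'_le _) (abs_nonneg _)

lemma isWeakDeriv {t : ℝ} (ht : t ∈ F.J) : IsWeakDeriv (fun x => F.u x t) (fun x => F.ux x t) := by
  intro φ hφ hφc
  have h1 : Continuous φ := hφ.continuous
  have h2 : Continuous (deriv φ) := hφ.continuous_deriv (by simp)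
  have i1 : Integrable fun x => F.u x t * deriv φ x :=
    ((F.continuous_u ht).mul h2).integrable_of_hasCompactSupport hφc.deriv.mul_left
  have i2 : Integrable fun x => F.ux x t * φ x :=
    ((F.continuous_ux ht).mul h1).integrable_of_hasCompactSupport hφc.mul_left
  have i3 : Integrable fun x => F.u x t * φ x :=
    ((F.continuous_u ht).mul h1).integrable_of_hasCompactSupport hφc.mul_left
  exact integral_mul_deriv_eq_deriv_mul_of_integrable (fun x _ => F.hasDerivAt_u ht x)
    (fun x _ => (hφ.differentiable (by simp) x).hasDerivAt) i1 i2 i3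

/-- Weak derivatives pass to pointwise bounded limits. -/
lemma isWeakDeriv_of_tendsto {T : ℝ} (hev : ∀ᶠ t in 𝓝[<] T, t ∈ F.J) {uT vT : ℝ → ℝ}
    (hu : ∀ x, Tendsto (fun t => F.u x t) (𝓝[<] T) (𝓝 (uT x)))
    (hv : ∀ x, Tendsto (fun t => F.ux x t) (𝓝[<] T) (𝓝 (vT x))) : IsWeakDeriv uT vT := by
  intro φ hφ hφc
  have h1 : Continuous φ := hφ.continuous
  have h2 : Continuous (deriv φ) := hφ.continuous_deriv (by simp)
  set M := (∫ θ, |m₀ θ|) / 2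
  have l1 : Tendsto (fun t => ∫ x, F.u x t * deriv φ x) (𝓝[<] T)
      (𝓝 (∫ x, uT x * deriv φ x)) := by
    refine tendsto_integral_filter_of_dominated_convergence (fun x => M * |deriv φ x|)
      (hev.mono fun t ht => ((F.continuous_u ht).mul h2).aestronglyMeasurable)
      (hev.mono fun t ht => Eventually.of_forall fun x => ?_)
      ((h2.integrable_of_hasCompactSupport hφc.deriv).abs.const_mul M)
      (Eventually.of_forall fun x => (hu x).mul_const _)
    rw [Real.norm_eq_abs, abs_mul]
    exact mul_le_mul_of_nonneg_right (F.abs_u_le ht x) (abs_nonneg _)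
  have l2 : Tendsto (fun t => ∫ x, F.ux x t * φ x) (𝓝[<] T) (𝓝 (∫ x, vT x * φ x)) := by
    refine tendsto_integral_filter_of_dominated_convergence (fun x => M * |φ x|)
      (hev.mono fun t ht => ((F.continuous_ux ht).mul h1).aestronglyMeasurable)
      (hev.mono fun t ht => Eventually.of_forall fun x => ?_)
      ((h1.integrable_of_hasCompactSupport hφc).abs.const_mul M)
      (Eventually.of_forall fun x => (hv x).mul_const _)
    rw [Real.norm_eq_abs, abs_mul]
    exact mul_le_mul_of_nonneg_right (F.abs_ux_le ht x) (abs_nonneg _)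
  exact tendsto_nhds_unique l1
    (l2.neg.congr' (hev.mono fun t ht => (F.isWeakDeriv ht φ hφ hφc).symm))

lemma existsUnique_limits {T : ℝ} (hev : ∀ᶠ t in 𝓝[<] T, t ∈ F.J)
    (hmono : Monotone fun ξ => F.X ξ T) :
    ∃! uT : ℝ → ℝ, (∀ x, Tendsto (fun t => F.u x t) (𝓝[<] T) (𝓝 (uT x))) ∧
      BVBound uT (∫ x, |m₀ x|) ∧
      ∃! vT : ℝ → ℝ, (∀ x, Tendsto (fun t => dx F.u x t) (𝓝[<] T) (𝓝 (vT x))) ∧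
        IsWeakDeriv uT vT ∧ BVBound vT (2 * ∫ x, |m₀ x|) := by
  have hu := F.tendsto_u hev
  choose vT hv using F.exists_tendsto_ux hev hmono
  have hv' : ∀ x, Tendsto (fun t => dx F.u x t) (𝓝[<] T) (𝓝 (vT x)) := fun x =>
    (hv x).congr' (hev.mono fun t ht => (F.dx_u ht x).symm)
  refine ⟨_, ⟨hu, BVBound.of_tendsto (hev.mono fun t ht =>
    ⟨(F.continuous_u ht).aestronglyMeasurable, F.abs_u_le_exp ht, F.variation_u_le ht⟩) hu,
    vT, ⟨hv', F.isWeakDeriv_of_tendsto hev hu hv, BVBound.of_tendsto (hev.mono fun t ht =>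
      ⟨(F.continuous_ux ht).aestronglyMeasurable, F.abs_ux_le_exp ht, F.variation_ux_le ht⟩) hv⟩,
    fun w hw => funext fun x => tendsto_nhds_unique (hw.1 x) (hv' x)⟩,
    fun w hw => funext fun x => tendsto_nhds_unique (hw.1 x) (hu x)⟩

end CutoffFlow

/-! ### The limit of `m` as a measure -/

lemma integral_toSignedMeasure_sub {p n : Measure ℝ} [IsFiniteMeasure p] [IsFiniteMeasure n]
    (φ : C₀(ℝ, ℝ)) :
    ∫ᵛ x, φ x ∂<•(p.toSignedMeasure - n.toSignedMeasure) = ∫ x, φ x ∂p - ∫ x, φ x ∂n := by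
  have hi : ∀ (q : Measure ℝ) [IsFiniteMeasure q], q.toSignedMeasure.Integrable φ := by
    intro q _
    rw [VectorMeasure.Integrable, Measure.variation_toSignedMeasure]
    exact φ.toBCF.integrable q
  rw [VectorMeasure.integral_sub_vectorMeasure (hi p) (hi n),
    VectorMeasure.integral_toSignedMeasure, VectorMeasure.integral_toSignedMeasure]

/-- A finite signed measure is determined by its action on `C₀(ℝ)`. -/
lemma signedMeasure_ext {μ ν : SignedMeasure ℝ}
    (h : ∀ φ : C₀(ℝ, ℝ), ∫ᵛ x, φ x ∂<•μ = ∫ᵛ x, φ x ∂<•ν) : μ = ν := by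
  set p := μ.toJordanDecomposition.posPart
  set n := μ.toJordanDecomposition.negPart
  set p' := ν.toJordanDecomposition.posPart
  set n' := ν.toJordanDecomposition.negPart
  have hμ : μ = p.toSignedMeasure - n.toSignedMeasure :=
    μ.toSignedMeasure_toJordanDecomposition.symm
  have hν : ν = p'.toSignedMeasure - n'.toSignedMeasure :=
    ν.toSignedMeasure_toJordanDecomposition.symm
  have hsum : p + n' = p' + n := by
    refine Measure.ext_of_integral_eq_on_compactlySupported fun φ => ?_
    have hφ := h ⟨φ.toContinuousMap, φ.hasCompactSupport.is_zero_at_infty⟩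
    rw [hμ, hν, integral_toSignedMeasure_sub, integral_toSignedMeasure_sub] at hφ
    have hi : ∀ (q : Measure ℝ) [IsFiniteMeasure q], Integrable φ q := fun q _ =>
      φ.continuous.integrable_of_hasCompactSupport φ.hasCompactSupport
    rw [integral_add_measure (hi p) (hi n'), integral_add_measure (hi p') (hi n)]
    have hφ' : ∫ x, φ x ∂p - ∫ x, φ x ∂n = ∫ x, φ x ∂p' - ∫ x, φ x ∂n' := hφ
    linarith
  have h2 : p.toSignedMeasure + n'.toSignedMeasure = p'.toSignedMeasure + n.toSignedMeasure := by
    rw [← Measure.toSignedMeasure_add, ← Measure.toSignedMeasure_add]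
    exact Measure.toSignedMeasure_congr hsum
  rw [hμ, hν]
  exact sub_eq_sub_iff_add_eq_add.2 h2

/-- The image under `Y` of the signed measure with density `w`. -/
lemma exists_signedMeasure_integral_eq {w Y : ℝ → ℝ} (hw : Integrable w) (hwm : Measurable w)
    (hY : Measurable Y) :
    ∃ μ : SignedMeasure ℝ, ∀ φ : C₀(ℝ, ℝ), ∫ᵛ x, φ x ∂<•μ = ∫ θ, φ (Y θ) * w θ := by
  have fin : ∀ f : ℝ → ℝ, Integrable f →
      IsFiniteMeasure ((volume.withDensity fun θ => ENNReal.ofReal (f θ)).map Y) := fun f hf =>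
    have := isFiniteMeasure_withDensity_ofReal hf.2
    inferInstance
  have key : ∀ f : ℝ → ℝ, Measurable f → ∀ φ : C₀(ℝ, ℝ),
      ∫ x, φ x ∂((volume.withDensity fun θ => ENNReal.ofReal (f θ)).map Y) =
        ∫ θ, φ (Y θ) * max (f θ) 0 := by
    intro f hf φ
    rw [integral_map (f := fun x => φ x) hY.aemeasurable φ.continuous.aestronglyMeasurable,
      integral_withDensity_eq_integral_toReal_smul hf.ennreal_ofReal
        (Eventually.of_forall fun _ => ENNReal.ofReal_lt_top)]
    refine integral_congr_ae (Eventually.of_forall fun θ => ?_)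
    simp only [ENNReal.toReal_ofReal', smul_eq_mul]
    ring
  have int : ∀ f : ℝ → ℝ, Integrable f → ∀ φ : C₀(ℝ, ℝ),
      Integrable fun θ => φ (Y θ) * max (f θ) 0 := fun f hf φ =>
    hf.pos_part.bdd_mul (φ.continuous.measurable.comp hY).aestronglyMeasurable
      (Eventually.of_forall fun θ => φ.toBCF.norm_coe_le_norm (Y θ))
  have := fin w hw
  have := fin (-w) hw.neg
  refine ⟨((volume.withDensity fun θ => ENNReal.ofReal (w θ)).map Y).toSignedMeasure -
    ((volume.withDensity fun θ => ENNReal.ofReal ((-w) θ)).map Y).toSignedMeasure, fun φ => ?_⟩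
  rw [integral_toSignedMeasure_sub, key w hwm, key (-w) hwm.neg,
    ← integral_sub (int w hw φ) (int (-w) hw.neg φ)]
  refine integral_congr_ae (Eventually.of_forall fun θ => ?_)
  simp only [Pi.neg_apply]
  rw [← mul_sub, ← posPart_def, ← negPart_def, posPart_sub_negPart]

namespace CutoffFlow

variable {k : ℕ} {L : ℝ} {m₀ : ℝ → ℝ} (F : CutoffFlow k L m₀)

lemma existsUnique_weakStarLimit {T : ℝ} (hev : ∀ᶠ t in 𝓝[<] T, t ∈ F.J) :
    ∃! μ : SignedMeasure ℝ, WeakStarTendsto F.m T μ := by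
  obtain ⟨μ, hμ⟩ := exists_signedMeasure_integral_eq F.integrable_m₀ F.continuous_m₀.measurable
    (continuous_left F.continuous_X T).measurable
  have hlim : WeakStarTendsto F.m T μ := fun φ => by
    rw [hμ, F.integral_mul_m₀ fun θ => φ (F.X θ T)]
    refine Tendsto.congr' (hev.mono fun t ht => (F.integral_mul_m ht φ).symm) ?_
    refine intervalIntegral.tendsto_integral_filter_of_dominated_convergence
      (fun θ => ‖φ.toBCF‖ * |m₀ θ|) (Eventually.of_forall fun t => ?_)
      (Eventually.of_forall fun t => Eventually.of_forall fun θ _ => ?_)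
      (F.integrable_m₀.abs.const_mul _).intervalIntegrable
      (Eventually.of_forall fun θ _ => ?_)
    · exact ((φ.continuous.comp (continuous_left F.continuous_X t)).mul
        F.continuous_m₀).aestronglyMeasurable
    · rw [Real.norm_eq_abs, abs_mul]
      exact mul_le_mul_of_nonneg_right (φ.toBCF.norm_coe_le_norm _) (abs_nonneg _)
    · have h : Continuous fun t => φ (F.X θ t) * m₀ θ :=
        (φ.continuous.comp (continuous_right F.continuous_X θ)).mul continuous_const
      exact (h.tendsto T).mono_left nhdsWithin_le_nhds
  exact ⟨μ, hlim, fun ν hν => signedMeasure_ext fun φ => tendsto_nhds_unique (hν φ) (hlim φ)⟩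

end CutoffFlow

end MCH

end

theorem theorem1p1 (k : ℕ) (hk : 1 ≤ k) (L : ℝ) (hL : 0 < L) (m₀ : ℝ → ℝ)
    (hm₀ : ContDiff ℝ k m₀) (hsupp : tsupport m₀ ⊆ Ioo (-L) L) :
    ∃! Tmax : EReal,
      -- `Tmax` is the maximal existence time, for the mCH equation and the Lagrange dynamics
      IsGreatest {T : EReal | 0 < T ∧ ∃ u m, MCH.IsClassicalSolution k m₀ T u m} Tmax ∧
      IsGreatest {T : EReal | 0 < T ∧ ∃ X, MCH.IsLagrangeSolution k L m₀ T X ∧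
        ∀ ξ ∈ Icc (-L) L, ∀ t ∈ MCH.timeIco T, 0 < MCH.Xξ L X ξ t} Tmax ∧
      ∃ X u m : ℝ → ℝ → ℝ,
        -- the unique solution of the Lagrange dynamics
        MCH.IsLagrangeSolution k L m₀ Tmax X ∧
        (∀ T : EReal, 0 < T → T ≤ Tmax → ∀ Y, MCH.IsLagrangeSolution k L m₀ T Y →
          ∀ ξ ∈ Icc (-L) L, ∀ t ∈ MCH.timeIco T, Y ξ t = X ξ t) ∧
        (∀ ξ ∈ Icc (-L) L, ∀ t ∈ MCH.timeIco Tmax, 0 < MCH.Xξ L X ξ t) ∧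
        -- the unique classical solution of the mCH equation
        MCH.IsClassicalSolution k m₀ Tmax u m ∧
        (∀ T : EReal, 0 < T → T ≤ Tmax → ∀ v n, MCH.IsClassicalSolution k m₀ T v n →
          ∀ x, ∀ t ∈ MCH.timeIco T, v x t = u x t ∧ n x t = m x t) ∧
        -- its representation by `X`, and the support of `m`
        (∀ x, ∀ t ∈ MCH.timeIco Tmax, u x t = ∫ θ in (-L)..L, MCH.G (x - X θ t) * m₀ θ) ∧
        (∀ t ∈ MCH.timeIco Tmax, ∀ φ : ℝ → ℝ, Continuous φ → HasCompactSupport φ →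
          ∫ x, φ x * m x t = ∫ θ in (-L)..L, φ (X θ t) * m₀ θ) ∧
        (∀ t ∈ MCH.timeIco Tmax, tsupport (fun x => m x t) ⊆ Ioo (-L) L) ∧
        -- the case of a finite maximal time
        ∀ T : ℝ, Tmax = (T : EReal) →
          -- (i)
          MCH.MemC (k + 1) 1 (Icc (-L) L) (Icc 0 T) X ∧
          -- (ii) the six criteria are equivalent at every time `T₀ ≤ T`, and hold at `T`
          (∀ p : ℝ≥0∞, 1 ≤ p →
            (∀ T₀ : ℝ, 0 < T₀ → T₀ ≤ T → (MCH.blowUpCriteria L X u m p T₀).TFAE) ∧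
            ∀ P ∈ MCH.blowUpCriteria L X u m p T, P) ∧
          -- (iii)
          (∀ t ∈ Ico 0 T, MCH.BVBound (fun x => u x t) (∫ x, |m₀ x|) ∧
            MCH.BVBound (fun x => MCH.dx u x t) (2 * ∫ x, |m₀ x|)) ∧
          (∃! uT : ℝ → ℝ, (∀ x, Tendsto (fun t => u x t) (𝓝[<] T) (𝓝 (uT x))) ∧
            MCH.BVBound uT (∫ x, |m₀ x|) ∧
            ∃! vT : ℝ → ℝ, (∀ x, Tendsto (fun t => MCH.dx u x t) (𝓝[<] T) (𝓝 (vT x))) ∧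
              MCH.IsWeakDeriv uT vT ∧ MCH.BVBound vT (2 * ∫ x, |m₀ x|)) ∧
          -- (iv)
          ∃! μ : SignedMeasure ℝ, MCH.WeakStarTendsto m T μ := by
  obtain ⟨F⟩ := MCH.exists_cutoffFlow hk hL hm₀ hsupp
  obtain ⟨Tmax, hpos, hJ, hdeg⟩ := F.exists_Tmax
  have hcl := F.isClassicalSolution hJ
  have hla := F.isLagrangeSolution hJ
  have hXpos : ∀ ξ ∈ Icc (-L) L, ∀ t ∈ MCH.timeIco Tmax, 0 < MCH.Xξ L F.X ξ t :=
    fun ξ hξ t ht => by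
      rw [F.Xξ_eq hξ]
      exact hJ ht ξ
  have hle : ∀ T : EReal, (∀ T₁ : ℝ, Tmax = T₁ → T ≤ T₁) → T ≤ Tmax := by
    intro T h
    induction Tmax with
    | bot => exact absurd hpos (by simp)
    | top => exact le_top
    | coe T₁ => exact h T₁ rfl
  have hgr : IsGreatest {T : EReal | 0 < T ∧ ∃ u m, MCH.IsClassicalSolution k m₀ T u m} Tmax := by
    refine ⟨⟨hpos, _, _, hcl⟩, fun T ⟨_, u, m, h⟩ => hle T fun T₁ hT₁ => ?_⟩
    subst hT₁
    exact F.classical_maximal (EReal.coe_pos.1 hpos) hJ (hdeg T₁ rfl).1 h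
  refine ⟨Tmax, ⟨hgr, ⟨⟨hpos, _, hla, hXpos⟩, fun T ⟨_, Y, hY, hYpos⟩ => hle T fun T₁ hT₁ => ?_⟩,
    F.X, F.u, F.m, hla, fun T hT hTle Y hY ξ hξ t ht => ?_, hXpos, hcl,
    fun T hT hTle v n hv x t ht => ?_, fun x t ht => F.u_eq_integral (hJ ht) x,
    fun t ht φ _ _ => F.integral_mul_m (hJ ht) φ, fun t ht => F.tsupport_m (hJ ht),
    fun T hT => ?_⟩, fun T' h => h.1.unique hgr⟩
  · subst hT₁
    exact F.lagrange_maximal (EReal.coe_pos.1 hpos)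
      (fun s hs => hJ ⟨hs.1, EReal.coe_lt_coe_iff.2 hs.2⟩) (hdeg T₁ rfl).1 hY hYpos
  · exact F.lagrange_unique hY ht (fun s hs => hJ ⟨hs.1,
      (EReal.coe_lt_coe_iff.2 hs.2).trans (ht.2.trans_le hTle)⟩) ξ hξ
  · exact F.classical_unique hJ hv ht ⟨ht.1, ht.2.trans_le hTle⟩ x
  · subst hT
    have hT0 : 0 < T := EReal.coe_pos.1 hpos
    have hJT : ∀ t ∈ Ico 0 T, t ∈ F.J := fun t ht => hJ ⟨ht.1, EReal.coe_lt_coe_iff.2 ht.2⟩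
    obtain ⟨hX, hnn⟩ := hdeg T rfl
    have hev : ∀ᶠ t in 𝓝[<] T, t ∈ F.J := by
      filter_upwards [Ioo_mem_nhdsLT hT0] with t ht using hJT t (Ioo_subset_Ico_self ht)
    refine ⟨F.memC_Icc hT0, fun p hp => ⟨fun T₀ h0 hT₀ => ?_,
      F.blowUpCriteria_of_degenerate hT0 hJT hX hnn hp⟩, fun t ht => ⟨F.bvBound_u (hJT t ht), ?_⟩,
      F.existsUnique_limits hev (F.monotone_X hnn), F.existsUnique_weakStarLimit hev⟩
    · rcases hT₀.lt_or_eq with h | rfl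
      · exact List.tfae_of_forall False _ fun P hP => iff_false_intro
          (F.not_blowUpCriteria h0 (fun s hs => hJT s ⟨hs.1, hs.2.trans_lt h⟩) p P hP)
      · exact List.tfae_of_forall True _ fun P hP => iff_true_intro
          (F.blowUpCriteria_of_degenerate hT0 hJT hX hnn hp P hP)
    · have := F.bvBound_ux (hJT t ht)
      rwa [show (fun x => F.ux x t) = fun x => MCH.dx F.u x t from
        funext fun x => (F.dx_u (hJT t ht) x).symm] at this
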